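/- Let $n\in\{2,3\}$ and let $\Omega\subset\mathbb R^n$ be an open set with bounded smooth boundary (locally on one side of its boundary), with outward unit normal $\mathbf n$. Write $X^1(\Omega)=\{w\in L^\infty(\Omega):\nabla w\in L^2(\Omega)\}$ and $X^2(\Omega)=\{w\in L^\infty(\Omega):\nabla w\in H^1(\Omega)\}$. Let $T>0$. Let $(\rho,\phi)$ be a real-valued classical solution on $[0,T]$ of $$\partial_t\rho+\operatorname{div}(\rho\nabla\phi)=0,\qquad \partial_t\phi+\tfrac12|\nabla\phi|^2+\rho-1=0\quad\text{in }\Omega,\qquad \nabla\phi\cdot \mathbf n=0\quad\text{on }\partial\Omega,$$ with $\rho\in C([0,T];X^1(\Omega))$, $\rho-1\in C([0,T];L^2(\Omega))$ and $\nabla\phi,\nabla^2\phi,\nabla^3\phi\in C([0,T];L^2(\Omega)\cap L^\infty(\Omega))$. For $\varepsilon\in(0,1]$, consider complex-valued classical solutions $u^\varepsilon$ on $[0,T]$ of $$i\varepsilon\,\partial_t u^\varepsilon+\tfrac{\varepsilon^2}{2}\Delta u^\varepsilon=(|u^\varepsilon|^2-1)u^\varepsilon\quad\text{in }\Omega,\qquad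 \frac{\partial u^\varepsilon}{\partial \mathbf n}=0\quad\text{on }\partial\Omega,$$ with $u^\varepsilon\in C([0,T];X^2(\Omega))$ and $|u^\varepsilon|^2-1\in C([0,T];L^2(\Omega))$. Here "classical" means: $u^\varepsilon,\phi$ (respectively $\rho$) and their spatial derivatives of order $\le 2$ (respectively $\le1$) exist and are continuous on $[0,T]\times\Omega$; for $0<t<T$ the time derivatives exist and the equations hold pointwise in $\Omega$, the gradients $\nabla u^\varepsilon(t),\nabla\phi(t)$ extend continuously to $\overline\Omega$, and the boundary conditions hold pointwise. All other derivatives are weak derivatives. Assume that there is a constant $C_0$, independent of $\varepsilon$, with $$\big\|\varepsilon\nabla u^\varepsilon(0)-iu^\varepsilon(0)\nabla\phi(0)\big\|_{L^2(\Omega)}+\big\||u^\varepsilon(0)|^2-\rho(0)\big\|_{L^2(\Omega)}\le C_0\,\varepsilon .$$ Then $$|u^\varepsilon|^2-\rho=O(\varepsilon)\ \text{ in }L^\infty([0,T];L^2(\Omega)),\qquad \varepsilon\operatorname{Im}(\overline{u^\varepsilon}\nabla u^\varepsilon)-\rho\nabla\phi=O(\varepsilon)\ \text{ in }L^\infty([0,T];L^1_{\rm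 loc}).$$ That is: there is a constant $C$ with $\big\||u^\varepsilon(t)|^2-\rho(t)\big\|_{L^2(\Omega)}\le C\varepsilon$, and for every compact $K\subset\mathbb R^n$ there is a constant $C_K$ with $\big\|\varepsilon\operatorname{Im}(\overline{u^\varepsilon}(t)\nabla u^\varepsilon(t))-\rho(t)\nabla\phi(t)\big\|_{L^1(\Omega\cap K)}\le C_K\varepsilon$, for all $t\in[0,T]$, all $\varepsilon\in(0,1]$ and all such solutions $u^\varepsilon$. The constants depend only on $n,\Omega,T,\rho,\phi,C_0$ (and $K$ for $C_K$). -/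

import Mathlib

open Set Filter Topology MeasureTheory
open scoped ENNReal ContDiff Gradient Laplacian

noncomputable section

namespace GPHydro

/-- `ν` is the outward unit normal to the set `Ω` at the boundary point `x`: near `x`, `Ω` is the
sublevel set `{g < 0}` of a smooth function `g` with `g x = 0`, `∇g x ≠ 0`, and `ν` is the
normalized gradient of `g` at `x`. -/
def IsOutwardUnitNormal {n : ℕ} (Ω : Set (EuclideanSpace ℝ (Fin n)))
    (x ν : EuclideanSpace ℝ (Fin n)) : Prop :=
  ∃ g : EuclideanSpace ℝ (Fin n) → ℝ, ContDiff ℝ ∞ g ∧ (∀ᶠ y in 𝓝 x, y ∈ Ω ↔ g y < 0) ∧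
    g x = 0 ∧ ∇ g x ≠ 0 ∧ ν = ‖∇ g x‖⁻¹ • ∇ g x

/-- An open set with smooth bounded boundary, locally on one side of its boundary. -/
structure IsSmoothDomain {n : ℕ} (Ω : Set (EuclideanSpace ℝ (Fin n))) : Prop where
  isOpen : IsOpen Ω
  bounded_boundary : Bornology.IsBounded (frontier Ω)
  smooth_boundary : ∀ x ∈ frontier Ω, ∃ ν, IsOutwardUnitNormal Ω x ν

section Spaces

variable {n : ℕ} {F : Type*} [NormedAddCommGroup F] [NormedSpace ℝ F]

/-- `f'` is the weak derivative of `f` on the open set `Ω`: for every test function `η` on `Ω`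
and every direction `v`, `∫ (∂_v η) f = - ∫ η (∂_v f)`. -/
def HasWeakFDeriv (Ω : Set (EuclideanSpace ℝ (Fin n))) (f : EuclideanSpace ℝ (Fin n) → F)
    (f' : EuclideanSpace ℝ (Fin n) → EuclideanSpace ℝ (Fin n) →L[ℝ] F) : Prop :=
  LocallyIntegrableOn f Ω ∧ LocallyIntegrableOn f' Ω ∧
    ∀ η : EuclideanSpace ℝ (Fin n) → ℝ, ContDiff ℝ ∞ η → HasCompactSupport η → tsupport η ⊆ Ω →
      ∀ v : EuclideanSpace ℝ (Fin n),
        ∫ x in Ω, (fderiv ℝ η x v) • f x = - ∫ x in Ω, η x • f' x v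

/-- `f ∈ C([0,T]; L^p(Ω))`. -/
def ContInLp (T : ℝ) (Ω : Set (EuclideanSpace ℝ (Fin n))) (p : ℝ≥0∞)
    (f : ℝ → EuclideanSpace ℝ (Fin n) → F) : Prop :=
  (∀ t ∈ Icc 0 T, MemLp (f t) p (volume.restrict Ω)) ∧
    ∀ t ∈ Icc 0 T, Tendsto (fun s => eLpNorm (f s - f t) p (volume.restrict Ω))
      (𝓝[Icc 0 T] t) (𝓝 0)

/-- `f ∈ C([0,T]; X¹(Ω))`, where `X¹(Ω) = {w ∈ L^∞(Ω) : ∇w ∈ L²(Ω)}`. -/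
def ContInX1 (T : ℝ) (Ω : Set (EuclideanSpace ℝ (Fin n)))
    (f : ℝ → EuclideanSpace ℝ (Fin n) → F) : Prop :=
  ContInLp T Ω ⊤ f ∧
    ∃ G : ℝ → EuclideanSpace ℝ (Fin n) → EuclideanSpace ℝ (Fin n) →L[ℝ] F,
      (∀ t ∈ Icc 0 T, HasWeakFDeriv Ω (f t) (G t)) ∧ ContInLp T Ω 2 G

/-- `f ∈ C([0,T]; X²(Ω))`, where `X²(Ω) = {w ∈ L^∞(Ω) : ∇w ∈ H¹(Ω)}`. -/
def ContInX2 (T : ℝ) (Ω : Set (EuclideanSpace ℝ (Fin n)))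
    (f : ℝ → EuclideanSpace ℝ (Fin n) → F) : Prop :=
  ContInLp T Ω ⊤ f ∧
    ∃ (G : ℝ → EuclideanSpace ℝ (Fin n) → EuclideanSpace ℝ (Fin n) →L[ℝ] F)
      (H : ℝ → EuclideanSpace ℝ (Fin n) →
        EuclideanSpace ℝ (Fin n) →L[ℝ] EuclideanSpace ℝ (Fin n) →L[ℝ] F),
      (∀ t ∈ Icc 0 T, HasWeakFDeriv Ω (f t) (G t) ∧ HasWeakFDeriv Ω (G t) (H t)) ∧
        ContInLp T Ω 2 G ∧ ContInLp T Ω 2 H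

/-- `f` and its first-order spatial derivative exist and are continuous on `[0,T] × Ω`. -/
def ContInC1 (T : ℝ) (Ω : Set (EuclideanSpace ℝ (Fin n)))
    (f : ℝ → EuclideanSpace ℝ (Fin n) → F) : Prop :=
  (∀ t ∈ Icc 0 T, DifferentiableOn ℝ (f t) Ω) ∧
    ContinuousOn (fun q : ℝ × EuclideanSpace ℝ (Fin n) => f q.1 q.2) (Icc 0 T ×ˢ Ω) ∧
    ContinuousOn (fun q : ℝ × EuclideanSpace ℝ (Fin n) => fderiv ℝ (f q.1) q.2) (Icc 0 T ×ˢ Ω)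

/-- `f` and its spatial derivatives of order at most two exist and are continuous on
`[0,T] × Ω`. -/
def ContInC2 (T : ℝ) (Ω : Set (EuclideanSpace ℝ (Fin n)))
    (f : ℝ → EuclideanSpace ℝ (Fin n) → F) : Prop :=
  ContInC1 T Ω f ∧ ContInC1 T Ω (fun t => fderiv ℝ (f t))

/-- The homogeneous Neumann condition in the classical sense: the derivative of `f` extends
continuously from `Ω` to its closure, and the extension vanishes on `∂Ω` in the direction of the
outward unit normal. -/
def NeumannCondition (Ω : Set (EuclideanSpace ℝ (Fin n)))
    (f : EuclideanSpace ℝ (Fin n) → F) : Prop :=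
  ∃ D : EuclideanSpace ℝ (Fin n) → EuclideanSpace ℝ (Fin n) →L[ℝ] F,
    ContinuousOn D (closure Ω) ∧ EqOn D (fderiv ℝ f) Ω ∧
      ∀ x ∈ frontier Ω, ∀ ν, IsOutwardUnitNormal Ω x ν → D x ν = 0

end Spaces

/-- The `j`-th partial derivative of a complex-valued function. -/
def cpartial {n : ℕ} (w : EuclideanSpace ℝ (Fin n) → ℂ) (j : Fin n)
    (x : EuclideanSpace ℝ (Fin n)) : ℂ :=
  fderiv ℝ w x (EuclideanSpace.single j 1)

/-- The divergence of a vector field. -/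
def divergence {n : ℕ} (v : EuclideanSpace ℝ (Fin n) → EuclideanSpace ℝ (Fin n))
    (x : EuclideanSpace ℝ (Fin n)) : ℝ :=
  ∑ j, fderiv ℝ v x (EuclideanSpace.single j 1) j

/-- `u` is a classical solution on `[0,T]` of the Gross–Pitaevskii equation
`i ε ∂ₜu + (ε²/2) Δu = (|u|² - 1) u` in `Ω` with `∂u/∂n = 0` on `∂Ω`, with
`u ∈ C([0,T]; X²(Ω))` and `|u|² - 1 ∈ C([0,T]; L²(Ω))`. -/
structure IsGPSolution {n : ℕ} (T : ℝ) (Ω : Set (EuclideanSpace ℝ (Fin n))) (ε : ℝ)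
    (u : ℝ → EuclideanSpace ℝ (Fin n) → ℂ) : Prop where
  classical : ContInC2 T Ω u
  equation : ∀ t ∈ Ioo 0 T, ∀ x ∈ Ω,
    DifferentiableAt ℝ (fun s => u s x) t ∧
      Complex.I * ε * deriv (fun s => u s x) t + (ε : ℂ) ^ 2 / 2 * Δ (u t) x =
        ((‖u t x‖ : ℂ) ^ 2 - 1) * u t x
  neumann : ∀ t ∈ Ioo 0 T, NeumannCondition Ω (u t)
  zhidkov : ContInX2 T Ω u
  density : ContInLp T Ω 2 (fun t x => ‖u t x‖ ^ 2 - 1)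

/-- `(ρ, φ)` is a classical solution on `[0,T]` of `∂ₜρ + div (ρ∇φ) = 0`,
`∂ₜφ + |∇φ|²/2 + ρ - 1 = 0` in `Ω`, with `∇φ · n = 0` on `∂Ω`, such that
`ρ ∈ C([0,T]; X¹(Ω))`, `ρ - 1 ∈ C([0,T]; L²(Ω))` and
`∇φ, ∇²φ, ∇³φ ∈ C([0,T]; L²(Ω) ∩ L^∞(Ω))`. -/
structure IsEulerSolution {n : ℕ} (T : ℝ) (Ω : Set (EuclideanSpace ℝ (Fin n)))
    (ρ φ : ℝ → EuclideanSpace ℝ (Fin n) → ℝ) : Prop where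
  classical_density : ContInC1 T Ω ρ
  classical_phase : ContInC2 T Ω φ
  continuity : ∀ t ∈ Ioo 0 T, ∀ x ∈ Ω,
    DifferentiableAt ℝ (fun s => ρ s x) t ∧
      deriv (fun s => ρ s x) t + divergence (fun y => ρ t y • ∇ (φ t) y) x = 0
  bernoulli : ∀ t ∈ Ioo 0 T, ∀ x ∈ Ω,
    DifferentiableAt ℝ (fun s => φ s x) t ∧
      deriv (fun s => φ s x) t + 1 / 2 * ‖∇ (φ t) x‖ ^ 2 + ρ t x - 1 = 0
  neumann : ∀ t ∈ Ioo 0 T, NeumannCondition Ω (φ t)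
  zhidkov : ContInX1 T Ω ρ
  density : ContInLp T Ω 2 (fun t x => ρ t x - 1)
  phase : ∃ (A : ℝ → EuclideanSpace ℝ (Fin n) →
        EuclideanSpace ℝ (Fin n) →L[ℝ] EuclideanSpace ℝ (Fin n))
      (B : ℝ → EuclideanSpace ℝ (Fin n) →
        EuclideanSpace ℝ (Fin n) →L[ℝ] EuclideanSpace ℝ (Fin n) →L[ℝ] EuclideanSpace ℝ (Fin n)),
      (∀ t ∈ Icc 0 T, HasWeakFDeriv Ω (∇ (φ t)) (A t) ∧ HasWeakFDeriv Ω (A t) (B t)) ∧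
        ∀ p : ℝ≥0∞, p = 2 ∨ p = ⊤ →
          ContInLp T Ω p (fun t => ∇ (φ t)) ∧ ContInLp T Ω p A ∧ ContInLp T Ω p B

/-- The complex vector field `ε∇w - i w ∇ψ`. -/
def modulatedGradient {n : ℕ} (ε : ℝ) (w : EuclideanSpace ℝ (Fin n) → ℂ)
    (ψ : EuclideanSpace ℝ (Fin n) → ℝ) (x : EuclideanSpace ℝ (Fin n)) :
    EuclideanSpace ℂ (Fin n) :=
  WithLp.toLp 2 fun j => ε * cpartial w j x - Complex.I * w x * (∇ ψ x j : ℂ)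

/-- The momentum `ε Im (w̄ ∇w)`. -/
def momentum {n : ℕ} (ε : ℝ) (w : EuclideanSpace ℝ (Fin n) → ℂ)
    (x : EuclideanSpace ℝ (Fin n)) : EuclideanSpace ℝ (Fin n) :=
  WithLp.toLp 2 fun j => ε * (starRingEnd ℂ (w x) * cpartial w j x).im

end GPHydro

end

noncomputable section

/-! Write u = a + ib. The field ε∇u − iu∇φ has real part A = ε∇a + b∇φ and imaginary part B = ε∇b −
a∇φ. With q = |u|² − ρ, the proof controls the modulated energy E = ½∫(|A|² + |B|²) + ½∫q².
Inserting both equations and discarding divergences of fields without flux through ∂Ω leaves dE/dt =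
−∫(D²φ(A,A) + D²φ(B,B)) − ½∫q²Δφ − (ε²/2)∫∇Δφ·(a∇a + b∇b). The first two terms are at most a
constant times E. In the third, ε(a∇a + b∇b) = aA + bB because the terms with ∇φ cancel, so Young's
inequality splits it into a multiple of E and ε² times an integral of |∇Δφ|². Since |u|² = ρ + q, no
bound on |u| uniform in ε is needed. Hence (E + ε²)' ≤ C(E + ε²), and Gronwall's inequality with
E(0) = O(ε²) gives E = O(ε²) on [0,T]. The density estimate is the q² part of E. The momentum
estimate follows from ε Im(ū∇u) − ρ∇φ = Im(ū(ε∇u − iu∇φ)) + q∇φ. It is only local because |u|² need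
not be integrable on an unbounded Ω.

The algebra is `energyRate_eq_add`, the pointwise bound is `modulatedFlux_le`, and the Gronwall step
is `FluidFlow.exists_modulatedEnergy_le`. Most of the length justifies the formula for dE/dt at the
given regularity, which raises three difficulties.

At the boundary, the integrands contain second derivatives that are not assumed to extend to ∂Ω.
`NoFluxField.integral_eq_zero` is therefore a divergence theorem for integrable fields whose normal
component merely tends to zero at ∂Ω. It combines interior cutoffs, a partition of unity and a
cutoff at infinity.

The gradient of Δφ is only weak. `noFluxField_weak_mul` makes it usable next to C¹ fields, after a
mollification argument that admits C¹ test functions.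

The time derivative of u exists pointwise and lies in C([0,T];L²), but ∇u has no time derivative.
`lpTendsto_slope` upgrades the pointwise derivative to one in L², and `tendsto_slope_modulated`
differentiates the kinetic energy by moving the gradient off the difference quotient of u. -/

namespace GPHydro

set_option linter.unusedSectionVars false


/-! ### Convergence in L^p for functions: algebra, Hölder products, limits of integrals -/

section LpTendsto

variable {α ι F G : Type*} [MeasurableSpace α] [NormedAddCommGroup F] [NormedSpace ℝ F]
  [NormedAddCommGroup G] [NormedSpace ℝ G] {μ : Measure α} {l : Filter ι} {p q r : ℝ≥0∞}

/-- Convergence in `L^p` along a filter, for honest functions. -/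
structure LpTendsto (l : Filter ι) (p : ℝ≥0∞) (μ : Measure α) (f : ι → α → F) (f₀ : α → F) :
    Prop where
  eventually_memLp : ∀ᶠ s in l, MemLp (f s) p μ
  memLp : MemLp f₀ p μ
  tendsto : Tendsto (fun s => eLpNorm (f s - f₀) p μ) l (𝓝 0)

namespace LpTendsto

theorem const {f₀ : α → F} (h : MemLp f₀ p μ) : LpTendsto l p μ (fun _ => f₀) f₀ :=
  ⟨Eventually.of_forall fun _ => h, h, by simp [tendsto_const_nhds]⟩

theorem congr {f f' : ι → α → F} {f₀ f₀' : α → F} (h : LpTendsto l p μ f f₀)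
    (hf : ∀ᶠ s in l, f s =ᵐ[μ] f' s) (h₀ : f₀ =ᵐ[μ] f₀') : LpTendsto l p μ f' f₀' := by
  refine ⟨?_, h.2.ae_eq h₀, h.3.congr' ?_⟩
  · filter_upwards [h.1, hf] with s h1 h2 using h1.ae_eq h2
  · filter_upwards [hf] with s h2 using eLpNorm_congr_ae (h2.sub h₀)

theorem add (hp : 1 ≤ p) {f g : ι → α → F} {f₀ g₀ : α → F} (hf : LpTendsto l p μ f f₀)
    (hg : LpTendsto l p μ g g₀) :
    LpTendsto l p μ (fun s x => f s x + g s x) (fun x => f₀ x + g₀ x) := by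
  refine ⟨?_, hf.2.add hg.2, ?_⟩
  · filter_upwards [hf.1, hg.1] with s h1 h2 using h1.add h2
  · have := hf.3.add hg.3
    rw [add_zero] at this
    refine tendsto_of_tendsto_of_tendsto_of_le_of_le' tendsto_const_nhds this
      (Eventually.of_forall fun _ => zero_le) ?_
    filter_upwards [hf.1, hg.1] with s h1 h2
    refine le_trans (le_of_eq ?_) (eLpNorm_add_le (h1.sub hf.2).1 (h2.sub hg.2).1 hp)
    congr 1
    ext x
    simp only [Pi.sub_apply, Pi.add_apply]
    abel

theorem clm (L : F →L[ℝ] G) {f : ι → α → F} {f₀ : α → F} (hf : LpTendsto l p μ f f₀) :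
    LpTendsto l p μ (fun s x => L (f s x)) (fun x => L (f₀ x)) := by
  refine ⟨?_, L.comp_memLp' hf.2, ?_⟩
  · filter_upwards [hf.1] with s h1 using L.comp_memLp' h1
  · have := ENNReal.Tendsto.const_mul (a := ENNReal.ofReal ‖L‖) hf.3 (Or.inr ENNReal.ofReal_ne_top)
    rw [mul_zero] at this
    refine tendsto_of_tendsto_of_tendsto_of_le_of_le tendsto_const_nhds this
      (fun _ => zero_le) fun s => ?_
    refine eLpNorm_le_mul_eLpNorm_of_ae_le_mul (Eventually.of_forall fun x => ?_) p
    simpa using L.le_opNorm (f s x - f₀ x)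

theorem const_mul (c : ℝ) {f : ι → α → ℝ} {f₀ : α → ℝ} (hf : LpTendsto l p μ f f₀) :
    LpTendsto l p μ (fun s x => c * f s x) (fun x => c * f₀ x) := by
  simpa using hf.clm (c • ContinuousLinearMap.id ℝ ℝ)

theorem neg {f : ι → α → ℝ} {f₀ : α → ℝ} (hf : LpTendsto l p μ f f₀) :
    LpTendsto l p μ (fun s x => - f s x) (fun x => - f₀ x) := by
  simpa using hf.const_mul (-1)

theorem sub (hp : 1 ≤ p) {f g : ι → α → ℝ} {f₀ g₀ : α → ℝ} (hf : LpTendsto l p μ f f₀)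
    (hg : LpTendsto l p μ g g₀) :
    LpTendsto l p μ (fun s x => f s x - g s x) (fun x => f₀ x - g₀ x) := by
  simpa [sub_eq_add_neg] using hf.add hp hg.neg

theorem sum (hp : 1 ≤ p) {κ : Type*} (S : Finset κ) {f : κ → ι → α → ℝ} {f₀ : κ → α → ℝ}
    (hf : ∀ k ∈ S, LpTendsto l p μ (f k) (f₀ k)) :
    LpTendsto l p μ (fun s x => ∑ k ∈ S, f k s x) (fun x => ∑ k ∈ S, f₀ k x) := by
  classical
  induction S using Finset.induction_on with
  | empty => simpa using LpTendsto.const (f₀ := fun _ : α => (0 : ℝ)) (by simp)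
  | insert a S ha ih =>
    simp only [Finset.sum_insert ha]
    exact (hf a (by simp)).add hp (ih fun k hk => hf k (by simp [hk]))

theorem mul (hr : 1 ≤ r) [ENNReal.HolderTriple p q r] {f g : ι → α → ℝ} {f₀ g₀ : α → ℝ}
    (hf : LpTendsto l p μ f f₀) (hg : LpTendsto l q μ g g₀) :
    LpTendsto l r μ (fun s x => f s x * g s x) (fun x => f₀ x * g₀ x) := by
  refine ⟨?_, hg.2.mul' hf.2, ?_⟩
  · filter_upwards [hf.1, hg.1] with s h1 h2 using h2.mul' h1
  have h1 : Tendsto (fun s => eLpNorm (f s - f₀) p μ * eLpNorm (g s - g₀) q μ +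
      eLpNorm f₀ p μ * eLpNorm (g s - g₀) q μ + eLpNorm (f s - f₀) p μ * eLpNorm g₀ q μ)
      l (𝓝 0) := by
    have a := ENNReal.Tendsto.mul hf.3 (Or.inr ENNReal.zero_ne_top) hg.3
      (Or.inr ENNReal.zero_ne_top)
    have b := ENNReal.Tendsto.const_mul (a := eLpNorm f₀ p μ) hg.3 (Or.inr hf.2.eLpNorm_ne_top)
    have c := ENNReal.Tendsto.mul_const (b := eLpNorm g₀ q μ) hf.3 (Or.inr hg.2.eLpNorm_ne_top)
    simpa using (a.add b).add c
  refine tendsto_of_tendsto_of_tendsto_of_le_of_le' tendsto_const_nhds h1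
    (Eventually.of_forall fun _ => zero_le) ?_
  filter_upwards [hf.1, hg.1] with s h1 h2
  -- Expanding around the limits leaves only the norms of the differences and of the fixed limits,
  -- so no bound on `f s` or `g s` along the filter is needed.
  have e1 : (fun x => f s x * g s x) - (fun x => f₀ x * g₀ x) =
      (f s - f₀) • (g s - g₀) + f₀ • (g s - g₀) + (f s - f₀) • g₀ := by
    ext x
    simp only [Pi.sub_apply, Pi.add_apply, Pi.mul_apply, smul_eq_mul]
    ring
  have m1 := h1.sub hf.2
  have m2 := h2.sub hg.2
  rw [e1]
  refine (eLpNorm_add_le ((m1.1.smul m2.1).add (hf.2.1.smul m2.1)) (m1.1.smul hg.2.1) hr).trans ?_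
  refine add_le_add ((eLpNorm_add_le (m1.1.smul m2.1) (hf.2.1.smul m2.1) hr).trans ?_) ?_
  · exact add_le_add (eLpNorm_smul_le_mul_eLpNorm m2.1 m1.1)
      (eLpNorm_smul_le_mul_eLpNorm m2.1 hf.2.1)
  · exact eLpNorm_smul_le_mul_eLpNorm hg.2.1 m1.1

theorem integral {f : ι → α → ℝ} {f₀ : α → ℝ} (hf : LpTendsto l 1 μ f f₀) :
    Tendsto (fun s => ∫ x, f s x ∂μ) l (𝓝 (∫ x, f₀ x ∂μ)) := by
  refine tendsto_integral_of_L1' f₀ ?_ ?_ ?_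
  · exact hf.2.1
  · filter_upwards [hf.1] with s hs using memLp_one_iff_integrable.1 hs
  · exact hf.3

theorem integral_mul {f g : ι → α → ℝ} {f₀ g₀ : α → ℝ}
    (hf : LpTendsto l 2 μ f f₀) (hg : LpTendsto l 2 μ g g₀) :
    Tendsto (fun s => ∫ x, f s x * g s x ∂μ) l (𝓝 (∫ x, f₀ x * g₀ x ∂μ)) :=
  (hf.mul (r := 1) le_rfl hg).integral

end LpTendsto

end LpTendsto

/-! ### Curves that are continuous in time with values in L^p -/

section ContInLp

variable {n : ℕ} {F : Type*} [NormedAddCommGroup F] [NormedSpace ℝ F] {T : ℝ}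
  {Ω : Set (EuclideanSpace ℝ (Fin n))} {p q r : ℝ≥0∞}

theorem ContInLp.lpTendsto {f : ℝ → EuclideanSpace ℝ (Fin n) → F} (h : ContInLp T Ω p f) {t : ℝ}
    (ht : t ∈ Icc 0 T) : LpTendsto (𝓝[Icc 0 T] t) p (volume.restrict Ω) f (f t) :=
  ⟨eventually_mem_nhdsWithin.mono fun s hs => h.1 s hs, h.1 t ht, h.2 t ht⟩

theorem contInLp_iff {f : ℝ → EuclideanSpace ℝ (Fin n) → F} : ContInLp T Ω p f ↔
    ∀ t ∈ Icc 0 T, LpTendsto (𝓝[Icc 0 T] t) p (volume.restrict Ω) f (f t) :=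
  ⟨fun h _ ht => h.lpTendsto ht, fun h => ⟨fun t ht => (h t ht).2, fun t ht => (h t ht).3⟩⟩

theorem ContInLp.congr {f g : ℝ → EuclideanSpace ℝ (Fin n) → F} (h : ContInLp T Ω p f)
    (hfg : ∀ t ∈ Icc 0 T, f t =ᵐ[volume.restrict Ω] g t) : ContInLp T Ω p g :=
  contInLp_iff.2 fun _ ht => (h.lpTendsto ht).congr
    (eventually_mem_nhdsWithin.mono fun s hs => hfg s hs) (hfg _ ht)

theorem ContInLp.clm {G : Type*} [NormedAddCommGroup G] [NormedSpace ℝ G] (L : F →L[ℝ] G)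
    {f : ℝ → EuclideanSpace ℝ (Fin n) → F} (h : ContInLp T Ω p f) :
    ContInLp T Ω p (fun t x => L (f t x)) :=
  contInLp_iff.2 fun _ ht => (h.lpTendsto ht).clm L

section Real

variable {f g : ℝ → EuclideanSpace ℝ (Fin n) → ℝ}

theorem ContInLp.add (hp : 1 ≤ p) (hf : ContInLp T Ω p f) (hg : ContInLp T Ω p g) :
    ContInLp T Ω p (fun t x => f t x + g t x) :=
  contInLp_iff.2 fun _ ht => (hf.lpTendsto ht).add hp (hg.lpTendsto ht)

theorem ContInLp.sub (hp : 1 ≤ p) (hf : ContInLp T Ω p f) (hg : ContInLp T Ω p g) :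
    ContInLp T Ω p (fun t x => f t x - g t x) :=
  contInLp_iff.2 fun _ ht => (hf.lpTendsto ht).sub hp (hg.lpTendsto ht)

theorem ContInLp.neg (hf : ContInLp T Ω p f) : ContInLp T Ω p (fun t x => - f t x) :=
  contInLp_iff.2 fun _ ht => (hf.lpTendsto ht).neg

theorem ContInLp.const_mul (c : ℝ) (hf : ContInLp T Ω p f) :
    ContInLp T Ω p (fun t x => c * f t x) :=
  contInLp_iff.2 fun _ ht => (hf.lpTendsto ht).const_mul c

theorem ContInLp.sum (hp : 1 ≤ p) {κ : Type*} (S : Finset κ)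
    {f : κ → ℝ → EuclideanSpace ℝ (Fin n) → ℝ} (hf : ∀ k ∈ S, ContInLp T Ω p (f k)) :
    ContInLp T Ω p (fun t x => ∑ k ∈ S, f k t x) :=
  contInLp_iff.2 fun _ ht => .sum hp S fun k hk => (hf k hk).lpTendsto ht

theorem ContInLp.mul (hr : 1 ≤ r) [ENNReal.HolderTriple p q r] (hf : ContInLp T Ω p f)
    (hg : ContInLp T Ω q g) : ContInLp T Ω r (fun t x => f t x * g t x) :=
  contInLp_iff.2 fun _ ht => (hf.lpTendsto ht).mul hr (hg.lpTendsto ht)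

/-- Bounded times square integrable. -/
theorem ContInLp.bdd_mul (hf : ContInLp T Ω ⊤ f) (hg : ContInLp T Ω 2 g) :
    ContInLp T Ω 2 (fun t x => f t x * g t x) := hf.mul one_le_two hg

theorem ContInLp.mul_bdd (hf : ContInLp T Ω 2 f) (hg : ContInLp T Ω ⊤ g) :
    ContInLp T Ω 2 (fun t x => f t x * g t x) := hf.mul one_le_two hg

theorem ContInLp.continuousOn_integral (hf : ContInLp T Ω 1 f) :
    ContinuousOn (fun t => ∫ x in Ω, f t x) (Icc 0 T) :=
  fun _ ht => (hf.lpTendsto ht).integral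

end Real

/-- Near each time the norm exceeds its value there by at most 1. Compactness of [0,T] then reduces
to finitely many such local bounds. -/
theorem ContInLp.exists_eLpNorm_le (hp : 1 ≤ p) {f : ℝ → EuclideanSpace ℝ (Fin n) → F}
    (hf : ContInLp T Ω p f) :
    ∃ C : ℝ, 0 ≤ C ∧ ∀ t ∈ Icc 0 T, eLpNorm (f t) p (volume.restrict Ω) ≤ ENNReal.ofReal C := by
  refine (isCompact_Icc (a := (0 : ℝ)) (b := T)).induction_on
    (p := fun S => ∃ C : ℝ, 0 ≤ C ∧ ∀ t ∈ S, eLpNorm (f t) p (volume.restrict Ω) ≤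
      ENNReal.ofReal C) ⟨0, le_rfl, by simp⟩ ?_ ?_ ?_
  · rintro s t hst ⟨C, hC, h⟩
    exact ⟨C, hC, fun x hx => h x (hst hx)⟩
  · rintro s t ⟨C, hC, h⟩ ⟨D, hD, h'⟩
    refine ⟨max C D, le_max_of_le_left hC, fun x hx => hx.elim (fun hx => (h x hx).trans ?_)
      fun hx => (h' x hx).trans ?_⟩
    · exact ENNReal.ofReal_le_ofReal (le_max_left _ _)
    · exact ENNReal.ofReal_le_ofReal (le_max_right _ _)
  · intro t ht
    have h1 : ∀ᶠ s in 𝓝[Icc 0 T] t, eLpNorm (f s - f t) p (volume.restrict Ω) < 1 :=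
      (hf.2 t ht).eventually (gt_mem_nhds one_pos)
    refine ⟨_, h1.and eventually_mem_nhdsWithin, 1 + (eLpNorm (f t) p (volume.restrict Ω)).toReal,
      by positivity, ?_⟩
    rintro s ⟨hs, hsI⟩
    rw [ENNReal.ofReal_add zero_le_one ENNReal.toReal_nonneg, ENNReal.ofReal_one,
      ENNReal.ofReal_toReal (hf.1 t ht).eLpNorm_ne_top]
    have : f s = (f s - f t) + f t := by simp
    calc eLpNorm (f s) p (volume.restrict Ω)
        = eLpNorm ((f s - f t) + f t) p (volume.restrict Ω) := by rw [← this]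
      _ ≤ _ := eLpNorm_add_le ((hf.1 s hsI).sub (hf.1 t ht)).1 (hf.1 t ht).1 hp
      _ ≤ _ := by gcongr

theorem ContInLp.exists_ae_bound {f : ℝ → EuclideanSpace ℝ (Fin n) → F}
    (hf : ContInLp T Ω ⊤ f) :
    ∃ C : ℝ, 0 ≤ C ∧ ∀ t ∈ Icc 0 T, ∀ᵐ x ∂(volume.restrict Ω), ‖f t x‖ ≤ C := by
  obtain ⟨C, hC, h⟩ := hf.exists_eLpNorm_le le_top
  refine ⟨C, hC, fun t ht => ?_⟩
  have h1 := h t ht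
  rw [eLpNorm_exponent_top] at h1
  filter_upwards [ae_le_eLpNormEssSup (f := f t) (μ := volume.restrict Ω)] with x hx
  have := hx.trans h1
  rwa [← ofReal_norm, ENNReal.ofReal_le_ofReal_iff hC] at this

/-- An a.e. bound of a continuous function on an open set holds everywhere. -/
theorem forall_le_of_ae_le (hΩ : IsOpen Ω) {f : EuclideanSpace ℝ (Fin n) → F}
    (hf : ContinuousOn f Ω) {C : ℝ} (h : ∀ᵐ x ∂(volume.restrict Ω), ‖f x‖ ≤ C) :
    ∀ x ∈ Ω, ‖f x‖ ≤ C := by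
  by_contra! hcon
  obtain ⟨x, hx, hlt⟩ := hcon
  have ho : IsOpen (Ω ∩ (fun x => ‖f x‖) ⁻¹' (Ioi C)) :=
    hf.norm.isOpen_inter_preimage hΩ isOpen_Ioi
  have h0 : volume (Ω ∩ (fun x => ‖f x‖) ⁻¹' (Ioi C)) = 0 := by
    rw [ae_restrict_iff' hΩ.measurableSet, ae_iff] at h
    refine measure_mono_null (fun y hy => ?_) h
    simp only [mem_ofPred_eq, Classical.not_imp, not_le]
    exact hy
  exact (ho.measure_pos volume ⟨x, hx, hlt⟩).ne' h0

end ContInLp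

/-- The Euclidean space of dimension `n`. -/
abbrev Euc (n : ℕ) := EuclideanSpace ℝ (Fin n)

/-- The `j`-th partial derivative of a real-valued function. -/
def pd {n : ℕ} (j : Fin n) (f : Euc n → ℝ) (x : Euc n) : ℝ :=
  fderiv ℝ f x (EuclideanSpace.single j 1)

/-! ### Test functions, and weak versus classical derivatives -/

section TestFunctions

variable {n : ℕ} {F : Type*} [NormedAddCommGroup F] [NormedSpace ℝ F] {Ω : Set (Euc n)}
  {η : Euc n → ℝ} {f : Euc n → F}

theorem integrableOn_test_smul (hη : Continuous η) (hc : HasCompactSupport η)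
    (hs : tsupport η ⊆ Ω) (hf : LocallyIntegrableOn f Ω) :
    IntegrableOn (fun x => η x • f x) Ω := by
  have h1 : IntegrableOn (fun x => η x • f x) (tsupport η) :=
    (hf.integrableOn_compact_subset hs hc).continuousOn_smul hη.continuousOn hc
  rw [integrableOn_iff_integrable_of_support_subset] at h1
  · exact h1.integrableOn
  · exact (Function.support_smul_subset_left η f).trans (subset_tsupport η)

theorem continuous_test_smul (hΩ : IsOpen Ω) (hη : Continuous η) (hs : tsupport η ⊆ Ω)
    (hf : ContinuousOn f Ω) : Continuous fun x => η x • f x :=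
  (hη.continuousOn.smul hf).continuous_of_tsupport_subset hΩ
    ((closure_mono (Function.support_smul_subset_left η f)).trans hs)

theorem integrable_test_smul (hΩ : IsOpen Ω) (hη : Continuous η) (hc : HasCompactSupport η)
    (hs : tsupport η ⊆ Ω) (hf : ContinuousOn f Ω) : Integrable fun x => η x • f x :=
  (continuous_test_smul hΩ hη hs hf).integrable_of_hasCompactSupport hc.smul_right

theorem tsupport_fderiv_apply_subset (v : Euc n) :
    tsupport (fun x => fderiv ℝ η x v) ⊆ tsupport η := by
  refine closure_minimal (fun x hx => ?_) (isClosed_tsupport η)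
  by_contra h
  exact hx (by simp [fderiv_of_notMem_tsupport ℝ h])

theorem continuous_fderiv_apply_of_contDiff (hη : ContDiff ℝ 1 η) (v : Euc n) :
    Continuous fun x => fderiv ℝ η x v :=
  (hη.continuous_fderiv one_ne_zero).clm_apply continuous_const

/-- Integration by parts against a test function, for a classically differentiable function. -/
theorem integral_test_fderiv (hΩ : IsOpen Ω) (hη : ContDiff ℝ 1 η) (hc : HasCompactSupport η)
    (hs : tsupport η ⊆ Ω) (hf : DifferentiableOn ℝ f Ω) (hf' : ContinuousOn (fderiv ℝ f) Ω)
    (v : Euc n) :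
    ∫ x in Ω, fderiv ℝ η x v • f x = - ∫ x in Ω, η x • fderiv ℝ f x v := by
  have hsd := (tsupport_fderiv_apply_subset (η := η) v)
  have z : ∀ x ∉ Ω, η x = 0 := fun x hx => image_eq_zero_of_notMem_tsupport fun h => hx (hs h)
  have z' : ∀ x ∉ Ω, fderiv ℝ η x v = 0 := fun x hx => by
    rw [fderiv_of_notMem_tsupport ℝ fun h => hx (hs h)]; rfl
  have hcd : HasCompactSupport fun x => fderiv ℝ η x v :=
    hc.mono' (subset_closure.trans hsd)
  rw [setIntegral_eq_integral_of_forall_compl_eq_zero fun x hx => by simp [z' x hx],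
    setIntegral_eq_integral_of_forall_compl_eq_zero fun x hx => by simp [z x hx]]
  have key := integral_bilinear_hasFDerivAt_right_eq_neg_left_of_integrable (μ := volume)
    (f := η) (f' := fderiv ℝ η) (g := f) (g' := fderiv ℝ f) (v := v)
    (B := ContinuousLinearMap.lsmul ℝ ℝ) ?_ ?_ ?_ ?_ ?_
  · simp only [ContinuousLinearMap.lsmul_apply] at key
    rw [key, neg_neg]
  · exact integrable_test_smul hΩ (continuous_fderiv_apply_of_contDiff hη v) hcd (hsd.trans hs)
      hf.continuousOn
  · exact integrable_test_smul hΩ hη.continuous hc hs (hf'.clm_apply continuousOn_const)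
  · exact integrable_test_smul hΩ hη.continuous hc hs hf.continuousOn
  · exact fun x _ => (hη.differentiable one_ne_zero x).hasFDerivAt
  · exact fun x hx => ((hf x (hs hx)).differentiableAt (hΩ.mem_nhds (hs hx))).hasFDerivAt

/-- A weak derivative coincides almost everywhere with a continuous classical derivative. -/
theorem HasWeakFDeriv.ae_eq_fderiv [CompleteSpace F] (hΩ : IsOpen Ω)
    {f' : Euc n → Euc n →L[ℝ] F} (h : HasWeakFDeriv Ω f f') (hf : DifferentiableOn ℝ f Ω)
    (hf' : ContinuousOn (fderiv ℝ f) Ω) : f' =ᵐ[volume.restrict Ω] fderiv ℝ f := by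
  have hd : LocallyIntegrableOn (fderiv ℝ f) Ω := hf'.locallyIntegrableOn hΩ.measurableSet
  have key : ∀ j : Fin n, ∀ᵐ x ∂(volume : Measure (Euc n)), x ∈ Ω →
      f' x (EuclideanSpace.single j 1) - fderiv ℝ f x (EuclideanSpace.single j 1) = 0 := by
    intro j
    set v : Euc n := EuclideanSpace.single j 1
    have l1 : LocallyIntegrableOn (fun x => f' x v) Ω := fun x hx =>
      let ⟨s, hs, h⟩ := h.2.1 x hx
      ⟨s, hs, (ContinuousLinearMap.apply ℝ F v).integrable_comp h⟩
    have l2 : LocallyIntegrableOn (fun x => fderiv ℝ f x v) Ω := fun x hx =>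
      let ⟨s, hs, h⟩ := hd x hx
      ⟨s, hs, (ContinuousLinearMap.apply ℝ F v).integrable_comp h⟩
    refine hΩ.ae_eq_zero_of_integral_contDiff_smul_eq_zero (l1.sub l2) fun g hg hgc hgs => ?_
    have e1 := h.2.2 g hg hgc hgs v
    rw [integral_test_fderiv hΩ (hg.of_le (by exact_mod_cast le_top)) hgc hgs hf hf' v] at e1
    have e2 : ∫ x in Ω, g x • (f' x v - fderiv ℝ f x v) = 0 := by
      simp only [smul_sub]
      rw [integral_sub (integrableOn_test_smul hg.continuous hgc hgs l1)
        (integrableOn_test_smul hg.continuous hgc hgs l2), sub_eq_zero]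
      exact (neg_injective e1).symm
    rw [← setIntegral_eq_integral_of_forall_compl_eq_zero (s := Ω)]
    · exact e2
    · intro x hx
      simp [image_eq_zero_of_notMem_tsupport fun h => hx (hgs h)]
  rw [EventuallyEq, ae_restrict_iff' hΩ.measurableSet]
  filter_upwards [ae_all_iff.2 key] with x hx hxΩ
  refine ContinuousLinearMap.coe_injective
    ((EuclideanSpace.basisFun (Fin n) ℝ).toBasis.ext fun j => ?_)
  simpa [sub_eq_zero] using hx j hxΩ

/-- The components of `κ` are the weak partial derivatives of the scalar function `k`. -/
structure HasWeakGrad (Ω : Set (Euc n)) (k : Euc n → ℝ) (κ : Fin n → Euc n → ℝ) : Prop where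
  locallyIntegrableOn : LocallyIntegrableOn k Ω
  locallyIntegrableOn_grad : ∀ j, LocallyIntegrableOn (κ j) Ω
  integral_eq : ∀ η : Euc n → ℝ, ContDiff ℝ ∞ η → HasCompactSupport η → tsupport η ⊆ Ω →
    ∀ j, ∫ x in Ω, pd j η x * k x = - ∫ x in Ω, η x * κ j x

/-- A continuous linear functional commutes with the integrals that define the weak derivative.
Taking the trace for `L` turns the weak derivative of ∇²φ into a weak gradient of Δφ. -/
theorem HasWeakFDeriv.hasWeakGrad [CompleteSpace F] {f' : Euc n → Euc n →L[ℝ] F}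
    (h : HasWeakFDeriv Ω f f') (L : F →L[ℝ] ℝ) :
    HasWeakGrad Ω (fun x => L (f x)) (fun j x => L (f' x (EuclideanSpace.single j 1))) := by
  have l1 : ∀ v : Euc n, LocallyIntegrableOn (fun x => f' x v) Ω := fun v x hx =>
    let ⟨s, hs, h⟩ := h.2.1 x hx
    ⟨s, hs, (ContinuousLinearMap.apply ℝ F v).integrable_comp h⟩
  refine ⟨fun x hx => ?_, fun j x hx => ?_, fun η hη hc hs j => ?_⟩
  · obtain ⟨s, hs, h⟩ := h.1 x hx
    exact ⟨s, hs, L.integrable_comp h⟩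
  · obtain ⟨s, hs, h⟩ := l1 (EuclideanSpace.single j 1) x hx
    exact ⟨s, hs, L.integrable_comp h⟩
  · have h1 : ContDiff ℝ 1 η := hη.of_le (by exact_mod_cast le_top)
    have hsd := (tsupport_fderiv_apply_subset (η := η) (EuclideanSpace.single j 1))
    have e := congrArg L (h.2.2 η hη hc hs (EuclideanSpace.single j 1))
    rw [map_neg, ← L.integral_comp_comm (integrableOn_test_smul
      (continuous_fderiv_apply_of_contDiff h1 _) (hc.mono' (subset_closure.trans hsd))
      (hsd.trans hs) h.1), ← L.integral_comp_comm
      (integrableOn_test_smul hη.continuous hc hs (l1 _))] at e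
    simpa [pd] using e

theorem HasWeakGrad.congr {k k' : Euc n → ℝ} {κ : Fin n → Euc n → ℝ} (h : HasWeakGrad Ω k κ)
    (hk : k =ᵐ[volume.restrict Ω] k') : HasWeakGrad Ω k' κ := by
  refine ⟨fun x hx => ?_, h.2, fun η hη hc hs j => ?_⟩
  · obtain ⟨s, hs, h⟩ := h.1 x hx
    refine ⟨s ∩ Ω, inter_mem hs self_mem_nhdsWithin, (h.mono_set inter_subset_left).congr ?_⟩
    exact ae_restrict_of_ae_restrict_of_subset inter_subset_right hk
  · rw [← h.3 η hη hc hs j]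
    refine integral_congr_ae ?_
    filter_upwards [hk] with x hx
    rw [hx]

end TestFunctions

/-! ### Weak gradients tested with C¹ functions -/

section Mollification

variable {n : ℕ} {Ω : Set (Euc n)}

open scoped Convolution

/-- The average differs from `g x` by at most the oscillation 2C, and |g x| ≤ C. The factor 3 is not
sharp, but any uniform bound serves for dominated convergence. -/
theorem abs_normed_convolution_le (φ : ContDiffBump (0 : Euc n)) {g : Euc n → ℝ}
    (hg : Continuous g) {C : ℝ} (hC : ∀ x, |g x| ≤ C) (x : Euc n) :
    |(φ.normed volume ⋆[ContinuousLinearMap.lsmul ℝ ℝ, volume] g) x| ≤ 3 * C := by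
  have h := φ.dist_normed_convolution_le (μ := volume) (x₀ := x) (g := g) (ε := 2 * C)
    hg.aestronglyMeasurable fun y _ => by
      rw [Real.dist_eq]
      exact (abs_sub _ _).trans (by linarith [hC x, hC y])
  rw [Real.dist_eq] at h
  have := abs_sub_abs_le_abs_sub
    ((φ.normed volume ⋆[ContinuousLinearMap.lsmul ℝ ℝ, volume] g) x) (g x)
  linarith [hC x]

/-- A weak gradient can be tested with compactly supported functions of class `C¹`. -/
theorem HasWeakGrad.integral_eq_of_contDiff_one {k : Euc n → ℝ} {κ : Fin n → Euc n → ℝ}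
    (h : HasWeakGrad Ω k κ) (hΩ : IsOpen Ω) {η : Euc n → ℝ} (hη : ContDiff ℝ 1 η)
    (hc : HasCompactSupport η) (hs : tsupport η ⊆ Ω) (j : Fin n) :
    ∫ x in Ω, pd j η x * k x = - ∫ x in Ω, η x * κ j x := by
  -- All mollifier radii are at most δ, so every mollification of η and of its derivatives vanishes
  -- outside the single compact set K ⊆ Ω. On K the merely locally integrable functions are
  -- integrable and furnish the dominating function.
  obtain ⟨δ, hδ, hδΩ⟩ := hc.isCompact.exists_cthickening_subset_open hΩ hs
  set K := Metric.cthickening δ (tsupport η)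
  have hK : IsCompact K := hc.isCompact.cthickening
  let φ : ℕ → ContDiffBump (0 : Euc n) := fun m =>
    ⟨δ / (m + 1) / 2, δ / (m + 1), by positivity, half_lt_self (by positivity)⟩
  have hφδ : ∀ m, (φ m).rOut ≤ δ := fun m => div_le_self hδ.le (by simp)
  have hφ : Tendsto (fun m => (φ m).rOut) atTop (𝓝 0) :=
    tendsto_const_div_atTop_nhds_zero_nat δ |>.comp (tendsto_add_atTop_nat 1) |>.congr
      fun m => by simp [φ]
  have vanish : ∀ g : Euc n → ℝ, (tsupport g ⊆ tsupport η) → ∀ m, ∀ x ∉ K,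
      ((φ m).normed volume ⋆[ContinuousLinearMap.lsmul ℝ ℝ, volume] g) x = 0 := by
    intro g hg m x hx
    have hb : ∀ y ∈ Metric.ball x (φ m).rOut, g y = 0 := by
      intro y hy
      by_contra hne
      refine hx (Metric.mem_cthickening_of_dist_le x y δ _ (hg (subset_tsupport g hne)) ?_)
      rw [dist_comm]
      exact (Metric.mem_ball.1 hy).le.trans (hφδ m)
    have hx0 := hb x (Metric.mem_ball_self (φ m).rOut_pos)
    rw [(φ m).normed_convolution_eq_right fun y hy => by rw [hb y hy, hx0], hx0]
  have lim : ∀ g : Euc n → ℝ, Continuous g → tsupport g ⊆ tsupport η → ∀ w : Euc n → ℝ,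
      LocallyIntegrableOn w Ω → Tendsto (fun m => ∫ x in Ω,
        ((φ m).normed volume ⋆[ContinuousLinearMap.lsmul ℝ ℝ, volume] g) x * w x) atTop
        (𝓝 (∫ x in Ω, g x * w x)) := by
    intro g hg hgs w hw
    obtain ⟨C, hC⟩ := (hc.mono' (subset_closure.trans hgs)).exists_bound_of_continuous hg
    have hwK : Integrable (K.indicator w) (volume.restrict Ω) :=
      (hw.integrableOn_compact_subset hδΩ hK).integrable_indicator hK.measurableSet
        |>.integrableOn
    refine tendsto_integral_filter_of_dominated_convergence (fun x => 3 * C * |K.indicator w x|)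
      (Eventually.of_forall fun m => ?_) (Eventually.of_forall fun m =>
      Eventually.of_forall fun x => ?_) (hwK.abs.const_mul _)
      (Eventually.of_forall fun x => ?_)
    · exact (((φ m).hasCompactSupport_normed.continuous_convolution_left _
        (φ m).continuous_normed hg.locallyIntegrable).aestronglyMeasurable).mul
        hw.aestronglyMeasurable
    · by_cases hx : x ∈ K
      · rw [indicator_of_mem hx, norm_mul]
        exact mul_le_mul_of_nonneg_right (abs_normed_convolution_le (φ m) hg hC x) (abs_nonneg _)
      · simp [vanish g hgs m x hx, indicator_of_notMem hx]
    · exact (ContDiffBump.convolution_tendsto_right_of_continuous hφ hg x).mul_const _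
  have smooth : ∀ m, ContDiff ℝ ∞
      ((φ m).normed volume ⋆[ContinuousLinearMap.lsmul ℝ ℝ, volume] η) := fun m =>
    (φ m).hasCompactSupport_normed.contDiff_convolution_left _ (φ m).contDiff_normed
      hη.continuous.locallyIntegrable
  -- The derivative is put on η, not on the mollifier, so the mollified derivatives converge to the
  -- derivative of η.
  have deriv_eq : ∀ m x, pd j ((φ m).normed volume ⋆[ContinuousLinearMap.lsmul ℝ ℝ, volume] η) x =
      ((φ m).normed volume ⋆[ContinuousLinearMap.lsmul ℝ ℝ, volume] (pd j η)) x := by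
    intro m x
    rw [pd, (hc.hasFDerivAt_convolution_right (ContinuousLinearMap.lsmul ℝ ℝ)
      (φ m).continuous_normed.locallyIntegrable hη x).fderiv,
      convolution_precompR_apply _ (φ m).continuous_normed.locallyIntegrable (hc.fderiv ℝ)
      (hη.continuous_fderiv one_ne_zero)]
    rfl
  have l1 := lim (pd j η) (continuous_fderiv_apply_of_contDiff hη _)
    (tsupport_fderiv_apply_subset _) k h.1
  have l2 := (lim η hη.continuous subset_rfl (κ j) (h.2 j)).neg
  refine tendsto_nhds_unique l1 (l2.congr fun m => ?_)
  have hcK : ∀ x ∉ K, ((φ m).normed volume ⋆[ContinuousLinearMap.lsmul ℝ ℝ, volume] η) x = 0 :=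
    vanish η subset_rfl m
  have := h.3 _ (smooth m) (HasCompactSupport.intro hK hcK)
    ((closure_minimal (Function.support_subset_iff'.2 hcK) hK.isClosed).trans hδΩ) j
  simp only [deriv_eq] at this
  exact this.symm

end Mollification

/-! ### Boundary cutoffs and fields with vanishing normal trace -/

section DivergenceTheorem

variable {n : ℕ} {Ω : Set (Euc n)}

/-- The normal component of the vector field `W`, defined on `Ω`, tends to zero at the boundary:
the derivative of any local defining function of `Ω` along `W` tends to zero. -/
def ZeroTrace (Ω : Set (Euc n)) (W : Fin n → Euc n → ℝ) : Prop :=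
  ∀ x ∈ frontier Ω, ∀ g : Euc n → ℝ, ContDiff ℝ ∞ g → (∀ᶠ y in 𝓝 x, y ∈ Ω ↔ g y < 0) →
    g x = 0 → ∇ g x ≠ 0 → Tendsto (fun y => ∑ j, pd j g y * W j y) (𝓝[Ω] x) (𝓝 0)

/-- `W` is an integrable vector field on `Ω` with integrable weak divergence `d` and with vanishing
normal component at the boundary. -/
structure NoFluxField (Ω : Set (Euc n)) (W : Fin n → Euc n → ℝ) (d : Euc n → ℝ) : Prop where
  integrable : ∀ j, IntegrableOn (W j) Ω
  integrable_div : IntegrableOn d Ω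
  integral_test : ∀ η : Euc n → ℝ, ContDiff ℝ ∞ η → HasCompactSupport η → tsupport η ⊆ Ω →
    ∫ x in Ω, (∑ j, pd j η x * W j x + η x * d x) = 0
  zeroTrace : ZeroTrace Ω W

theorem pd_eq_zero_of_notMem_tsupport {η : Euc n → ℝ} {x : Euc n} (h : x ∉ tsupport η)
    (j : Fin n) : pd j η x = 0 := by
  simp [pd, fderiv_of_notMem_tsupport ℝ h]

theorem continuous_pd {η : Euc n → ℝ} (hη : ContDiff ℝ ∞ η) (j : Fin n) : Continuous (pd j η) :=
  (hη.continuous_fderiv (by simp)).clm_apply continuous_const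

theorem contDiff_pd {η : Euc n → ℝ} (hη : ContDiff ℝ ∞ η) (j : Fin n) : ContDiff ℝ ∞ (pd j η) :=
  (hη.fderiv_right (m := ∞) (by simp)).clm_apply contDiff_const

theorem pd_mul {j : Fin n} {f g : Euc n → ℝ} {x : Euc n} (hf : DifferentiableAt ℝ f x)
    (hg : DifferentiableAt ℝ g x) :
    pd j (fun y => f y * g y) x = pd j f x * g x + f x * pd j g x := by
  simp only [pd, fderiv_fun_mul hf hg, add_apply,
    smul_apply, smul_eq_mul]
  ring

theorem exists_pd_ne_zero {g : Euc n → ℝ} {x : Euc n} (h : ∇ g x ≠ 0) : ∃ j, pd j g x ≠ 0 := by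
  by_contra! hcon
  refine h ?_
  have h0 : fderiv ℝ g x = 0 := ContinuousLinearMap.coe_injective
    ((EuclideanSpace.basisFun (Fin n) ℝ).toBasis.ext fun j => by simpa [pd] using hcon j)
  rw [gradient, h0, map_zero]

theorem gradient_ne_zero_of_pd_ne_zero {g : Euc n → ℝ} {x : Euc n} {j : Fin n}
    (h : pd j g x ≠ 0) : ∇ g x ≠ 0 := by
  intro h0
  refine h ?_
  rw [pd, ← toDual_gradient, h0, map_zero]
  rfl

theorem integrableOn_mul_of_compactSupport {w η : Euc n → ℝ} (hw : IntegrableOn w Ω)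
    (hη : Continuous η) (hc : HasCompactSupport η) : IntegrableOn (fun x => η x * w x) Ω := by
  obtain ⟨C, hC⟩ := hc.exists_bound_of_continuous hη
  exact hw.bdd_mul hη.aestronglyMeasurable (Eventually.of_forall hC)

/-- A smooth cutoff near the zero set of `g`. -/
def levelCutoff (g : Euc n → ℝ) (δ : ℝ) (y : Euc n) : ℝ := Real.smoothTransition (-g y / δ - 1)

/-- Minus the derivative of `levelCutoff` with respect to the value of `g`. -/
def levelCutoffDeriv (g : Euc n → ℝ) (δ : ℝ) (y : Euc n) : ℝ :=
  deriv Real.smoothTransition (-g y / δ - 1) / δ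

theorem contDiff_levelCutoff {g : Euc n → ℝ} (hg : ContDiff ℝ ∞ g) (δ : ℝ) :
    ContDiff ℝ ∞ (levelCutoff g δ) :=
  (Real.smoothTransition.contDiff (n := ⊤)).comp ((hg.neg.div_const δ).sub contDiff_const)

theorem continuous_levelCutoffDeriv {g : Euc n → ℝ} (hg : ContDiff ℝ ∞ g) (δ : ℝ) :
    Continuous (levelCutoffDeriv g δ) :=
  (((Real.smoothTransition.contDiff (n := ⊤)).continuous_deriv (by simp)).comp
    ((hg.continuous.neg.div_const δ).sub continuous_const)).div_const δ

theorem levelCutoffDeriv_nonneg (g : Euc n → ℝ) {δ : ℝ} (hδ : 0 < δ) (y : Euc n) :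
    0 ≤ levelCutoffDeriv g δ y :=
  div_nonneg Real.smoothTransition.monotone.deriv_nonneg hδ.le

theorem levelCutoffDeriv_eq_zero (g : Euc n → ℝ) {δ : ℝ} (hδ : 0 < δ) {y : Euc n}
    (hy : 2 * δ < - g y) : levelCutoffDeriv g δ y = 0 := by
  have h1 : 1 < -g y / δ - 1 := by
    have : 2 < -g y / δ := (lt_div_iff₀ hδ).2 hy
    linarith
  have : Real.smoothTransition =ᶠ[𝓝 (-g y / δ - 1)] fun _ => 1 := by
    filter_upwards [lt_mem_nhds h1] with s hs using Real.smoothTransition.one_of_one_le hs.le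
  rw [levelCutoffDeriv, this.deriv_eq]
  simp

theorem pd_levelCutoff {g : Euc n → ℝ} (hg : ContDiff ℝ ∞ g) (δ : ℝ) (j : Fin n) (y : Euc n) :
    pd j (levelCutoff g δ) y = - levelCutoffDeriv g δ y * pd j g y := by
  have h1 : HasDerivAt Real.smoothTransition (deriv Real.smoothTransition (-g y / δ - 1))
      (-g y / δ - 1) :=
    ((Real.smoothTransition.contDiff (n := 1)).differentiable (by simp) _).hasDerivAt
  have h2 : HasFDerivAt (fun y => -g y / δ - 1) (δ⁻¹ • -fderiv ℝ g y) y := by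
    have := ((hg.differentiable (by simp) y).hasFDerivAt.neg.const_mul δ⁻¹).sub_const 1
    simpa [div_eq_inv_mul] using this
  have h3 := h1.comp_hasFDerivAt y h2
  have : pd j (levelCutoff g δ) y = deriv Real.smoothTransition (-g y / δ - 1) *
      (δ⁻¹ * -pd j g y) := by
    rw [pd, show levelCutoff g δ = Real.smoothTransition ∘ fun y => -g y / δ - 1 from rfl,
      h3.fderiv]
    simp [pd]
  rw [this, levelCutoffDeriv]
  ring

/-- The cutoff vanishes where −g ≤ δ, so the product is supported in the closed set {g ≤ −δ}, which
inside V lies in Ω. Multiplying by the cutoff thus turns a test function touching ∂Ω into an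
interior one. -/
theorem tsupport_mul_levelCutoff_subset {ζ g : Euc n → ℝ} (hg : ContDiff ℝ ∞ g) {δ : ℝ}
    (hδ : 0 < δ) {V : Set (Euc n)} (hV : ∀ y ∈ V, (y ∈ Ω ↔ g y < 0)) (hζ : tsupport ζ ⊆ V) :
    tsupport (fun y => ζ y * levelCutoff g δ y) ⊆ Ω := by
  have hsub : tsupport (fun y => ζ y * levelCutoff g δ y) ⊆ tsupport ζ ∩ {y | g y ≤ -δ} := by
    refine closure_minimal (fun y hy => ⟨subset_tsupport ζ fun h => hy (by simp [h]), ?_⟩)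
      ((isClosed_tsupport ζ).inter (isClosed_le hg.continuous continuous_const))
    by_contra h
    simp only [mem_ofPred_eq, not_le] at h
    refine hy ?_
    have : -g y / δ < 1 := (div_lt_one hδ).2 (by linarith)
    simp only [levelCutoff]
    rw [Real.smoothTransition.zero_of_nonpos (by linarith), mul_zero]
  intro y hy
  obtain ⟨h1, h2⟩ := hsub hy
  have h2 : g y ≤ -δ := h2
  exact (hV y (hζ h1)).2 (by linarith)

/-- Near the boundary, the cutoffs have bounded normal derivative in `L¹`. -/
theorem integral_levelCutoffDeriv_le {g ξ : Euc n → ℝ} (hΩ : IsOpen Ω) (hg : ContDiff ℝ ∞ g)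
    (hξ : ContDiff ℝ ∞ ξ) (hc : HasCompactSupport ξ) {V : Set (Euc n)}
    (hV : ∀ y ∈ V, (y ∈ Ω ↔ g y < 0)) (hs : tsupport ξ ⊆ V) {δ : ℝ} (hδ : 0 < δ) :
    ∫ y in Ω, ξ y * levelCutoffDeriv g δ y * ∑ j, pd j g y ^ 2 ≤
      ∫ y in Ω, |∑ j, (pd j ξ y * pd j g y + ξ y * pd j (pd j g) y)| := by
  have hh := contDiff_levelCutoff hg δ
  have hts := tsupport_mul_levelCutoff_subset hg hδ hV hs
  have hcc : HasCompactSupport fun y => ξ y * levelCutoff g δ y := hc.mul_right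
  have hcp : ∀ j, HasCompactSupport (pd j ξ) := fun j =>
    hc.mono' (subset_closure.trans (tsupport_fderiv_apply_subset _))
  have i1 : ∀ j, IntegrableOn (fun y => pd j ξ y * pd j g y) Ω := fun j =>
    (((continuous_pd hξ j).mul (continuous_pd hg j)).integrable_of_hasCompactSupport
      (hcp j).mul_right).integrableOn
  have i2 : ∀ j, IntegrableOn (fun y => ξ y * pd j (pd j g) y) Ω := fun j =>
    ((hξ.continuous.mul (continuous_pd (contDiff_pd hg j) j)).integrable_of_hasCompactSupport
      hc.mul_right).integrableOn
  have i3 : IntegrableOn (fun y => ∑ j, (pd j ξ y * pd j g y + ξ y * pd j (pd j g) y)) Ω :=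
    integrable_finsetSum _ fun j _ => (i1 j).add (i2 j)
  have b0 : ∀ y, ‖levelCutoff g δ y‖ ≤ 1 := fun y => by
    rw [levelCutoff, Real.norm_of_nonneg (Real.smoothTransition.nonneg _)]
    exact Real.smoothTransition.le_one _
  have i4 : IntegrableOn (fun y => levelCutoff g δ y *
      ∑ j, (pd j ξ y * pd j g y + ξ y * pd j (pd j g) y)) Ω :=
    i3.bdd_mul hh.continuous.aestronglyMeasurable (Eventually.of_forall b0)
  -- The field ξ·h·∇g, with h the cutoff, is compactly supported in Ω, so its divergence has
  -- integral zero. The part where h is differentiated is minus the left side of the claim. The rest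
  -- is bounded independently of δ because 0 ≤ h ≤ 1.
  have key : ∀ j, ∫ y in Ω, (pd j (fun y => ξ y * levelCutoff g δ y) y * pd j g y +
      ξ y * levelCutoff g δ y * pd j (pd j g) y) = 0 := by
    intro j
    have hcd := (hξ.mul hh).of_le (m := 1) (by exact_mod_cast le_top)
    have := integral_test_fderiv hΩ hcd hcc hts
      ((contDiff_pd hg j).differentiable (by simp)).differentiableOn
      ((contDiff_pd hg j).continuous_fderiv (by simp)).continuousOn (EuclideanSpace.single j 1)
    rw [integral_add]
    · exact eq_neg_iff_add_eq_zero.1 this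
    · exact (((continuous_pd (hξ.mul hh) j).mul
        (continuous_pd hg j)).integrable_of_hasCompactSupport
        (hcc.mono' (subset_closure.trans (tsupport_fderiv_apply_subset _))).mul_right).integrableOn
    · exact (((hξ.continuous.mul hh.continuous).mul
        (continuous_pd (contDiff_pd hg j) j)).integrable_of_hasCompactSupport
        hcc.mul_right).integrableOn
  have expand : ∀ y, ∑ j, (pd j (fun y => ξ y * levelCutoff g δ y) y * pd j g y +
      ξ y * levelCutoff g δ y * pd j (pd j g) y) =
      levelCutoff g δ y * ∑ j, (pd j ξ y * pd j g y + ξ y * pd j (pd j g) y) -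
        ξ y * levelCutoffDeriv g δ y * ∑ j, pd j g y ^ 2 := by
    intro y
    rw [Finset.mul_sum, Finset.mul_sum, ← Finset.sum_sub_distrib]
    refine Finset.sum_congr rfl fun j _ => ?_
    rw [pd_mul (hξ.differentiable (by simp) y) (hh.differentiable (by simp) y),
      pd_levelCutoff hg]
    ring
  have i5 : IntegrableOn (fun y => ξ y * levelCutoffDeriv g δ y * ∑ j, pd j g y ^ 2) Ω :=
    (((hξ.continuous.mul (continuous_levelCutoffDeriv hg δ)).mul (continuous_finsetSum _
      fun j _ => (continuous_pd hg j).pow 2)).integrable_of_hasCompactSupport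
      hc.mul_right.mul_right).integrableOn
  have total : ∫ y in Ω, ∑ j, (pd j (fun y => ξ y * levelCutoff g δ y) y * pd j g y +
      ξ y * levelCutoff g δ y * pd j (pd j g) y) = 0 := by
    rw [integral_finsetSum, Finset.sum_eq_zero fun j _ => key j]
    intro j _
    refine Integrable.add ?_ ?_
    · exact (((continuous_pd (hξ.mul hh) j).mul
        (continuous_pd hg j)).integrable_of_hasCompactSupport
        (hcc.mono' (subset_closure.trans (tsupport_fderiv_apply_subset _))).mul_right).integrableOn
    · exact (((hξ.continuous.mul hh.continuous).mul
        (continuous_pd (contDiff_pd hg j) j)).integrable_of_hasCompactSupport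
        hcc.mul_right).integrableOn
  simp only [expand] at total
  rw [integral_sub i4 i5, sub_eq_zero] at total
  rw [← total]
  refine integral_mono i4 i3.abs fun y => ?_
  refine (le_abs_self _).trans ?_
  rw [abs_mul]
  exact mul_le_of_le_one_left (abs_nonneg _) (b0 y)

/-- Uniform smallness of the normal component near the boundary. -/
theorem ZeroTrace.exists_uniform {W : Fin n → Euc n → ℝ} (hW : ZeroTrace Ω W) (hΩ : IsOpen Ω)
    {g η : Euc n → ℝ} (hg : ContDiff ℝ ∞ g) {V : Set (Euc n)} (hVo : IsOpen V)
    (hV : ∀ y ∈ V, (y ∈ Ω ↔ g y < 0)) (hpos : ∀ y ∈ V, 0 < ∑ j, pd j g y ^ 2) {K : Set (Euc n)}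
    (hK : IsCompact K) (hKV : K ⊆ V) (hη : Continuous η) {θ : ℝ} (hθ : 0 < θ) :
    ∃ δ₀ > 0, ∀ y ∈ K, y ∈ Ω → -g y ≤ δ₀ →
      |η y * ∑ j, pd j g y * W j y| ≤ θ * ∑ j, pd j g y ^ 2 := by
  suffices h : ∃ δ₀ > 0, ∀ y ∈ K, y ∈ V → y ∈ Ω → -g y ≤ δ₀ →
      |η y * ∑ j, pd j g y * W j y| ≤ θ * ∑ j, pd j g y ^ 2 by
    obtain ⟨δ₀, h0, h⟩ := h
    exact ⟨δ₀, h0, fun y hy => h y hy (hKV hy)⟩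
  refine hK.induction_on (p := fun S => ∃ δ₀ > 0, ∀ y ∈ S, y ∈ V → y ∈ Ω → -g y ≤ δ₀ →
      |η y * ∑ j, pd j g y * W j y| ≤ θ * ∑ j, pd j g y ^ 2) ⟨1, one_pos, by simp⟩ ?_ ?_ ?_
  · rintro s t hst ⟨δ, hδ, h⟩
    exact ⟨δ, hδ, fun y hy => h y (hst hy)⟩
  · rintro s t ⟨δ, hδ, h⟩ ⟨δ', hδ', h'⟩
    refine ⟨min δ δ', lt_min hδ hδ', fun y hy hyV hyΩ hle => hy.elim (fun hy => ?_) fun hy => ?_⟩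
    · exact h y hy hyV hyΩ (hle.trans (min_le_left _ _))
    · exact h' y hy hyV hyΩ (hle.trans (min_le_right _ _))
  · intro z hz
    have hzV := hKV hz
    -- There are three kinds of points. Near an interior point −g is bounded below, so the claim is
    -- void for small δ₀. Near a boundary point it is the zero trace condition, with |∇g|² > 0. Near
    -- an exterior point Ω is absent.
    by_cases hzΩ : z ∈ Ω
    · have hgz := (hV z hzV).1 hzΩ
      have : ∀ᶠ y in 𝓝 z, g y < g z / 2 :=
        hg.continuous.continuousAt.eventually (gt_mem_nhds (by linarith))
      refine ⟨_, nhdsWithin_le_nhds this, -g z / 4, by linarith, fun y hy _ _ hle => ?_⟩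
      have hy : g y < g z / 2 := hy
      linarith
    by_cases hzc : z ∈ closure Ω
    · have hzf : z ∈ frontier Ω := by rw [hΩ.frontier_eq]; exact ⟨hzc, hzΩ⟩
      have hloc : ∀ᶠ y in 𝓝 z, y ∈ Ω ↔ g y < 0 := by
        filter_upwards [hVo.mem_nhds hzV] with y hy using hV y hy
      have hg0 : g z = 0 := by
        refine le_antisymm ?_ (not_lt.1 fun h => hzΩ ((hV z hzV).2 h))
        have hne : (𝓝[Ω] z).NeBot := mem_closure_iff_nhdsWithin_neBot.1 hzc
        refine le_of_tendsto (hg.continuous.continuousAt.tendsto.mono_left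
          (nhdsWithin_le_nhds (s := Ω))) ?_
        filter_upwards [nhdsWithin_le_nhds hloc, self_mem_nhdsWithin] with y h1 h2
          using (h1.1 h2).le
      have hgrad : ∇ g z ≠ 0 := by
        have := (hpos z hzV).ne'
        obtain ⟨j, _, hj⟩ := Finset.exists_ne_zero_of_sum_ne_zero this
        exact gradient_ne_zero_of_pd_ne_zero (j := j) fun h => hj (by simp [h])
      have t1 := (hη.continuousAt (x := z)).tendsto.mono_left (nhdsWithin_le_nhds (s := Ω)) |>.mul
        (hW z hzf g hg hloc hg0 hgrad) |>.abs
      have t2 : Tendsto (fun y => θ * ∑ j, pd j g y ^ 2) (𝓝[Ω] z)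
          (𝓝 (θ * ∑ j, pd j g z ^ 2)) :=
        ((continuous_const.mul (continuous_finsetSum _ fun j _ =>
          (continuous_pd hg j).pow 2)).continuousAt.tendsto).mono_left nhdsWithin_le_nhds
      rw [mul_zero, abs_zero] at t1
      have := t1.eventually_lt t2 (mul_pos hθ (hpos z hzV))
      rw [eventually_nhdsWithin_iff] at this
      exact ⟨_, nhdsWithin_le_nhds this, 1, one_pos, fun y hy _ hyΩ _ => (hy hyΩ).le⟩
    · refine ⟨(closure Ω)ᶜ, nhdsWithin_le_nhds (isClosed_closure.isOpen_compl.mem_nhds hzc), 1,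
        one_pos, fun y hy _ hyΩ _ => absurd (subset_closure hyΩ) hy⟩

end DivergenceTheorem

/-! ### The divergence theorem for no-flux fields -/

section DivergenceTheorem

variable {n : ℕ} {Ω : Set (Euc n)} {W : Fin n → Euc n → ℝ} {d : Euc n → ℝ}

theorem NoFluxField.integrable_test (hW : NoFluxField Ω W d) {η : Euc n → ℝ}
    (hη : ContDiff ℝ ∞ η) (hc : HasCompactSupport η) :
    IntegrableOn (fun x => ∑ j, pd j η x * W j x + η x * d x) Ω :=
  (integrable_finsetSum _ fun j _ => integrableOn_mul_of_compactSupport (hW.integrable j)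
    (continuous_pd hη j) (hc.mono' (subset_closure.trans (tsupport_fderiv_apply_subset _)))).add
    (integrableOn_mul_of_compactSupport hW.integrable_div hη.continuous hc)

/-- Test the interior identity with η times the cutoff and let δ → 0. The error is the integral of
`levelCutoffDeriv` times η∇g·W. By the zero trace, |η∇g·W| ≤ θ|∇g|² on a thin layer, and the
integral of ξ·`levelCutoffDeriv`·|∇g|² stays bounded as δ → 0. The error is thus at most a constant
times the arbitrary θ. Neither a surface measure nor differentiability of W up to the boundary
enters. -/
theorem NoFluxField.exists_nhds_of_mem_frontier (hW : NoFluxField Ω W d) (hΩ : IsSmoothDomain Ω)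
    {x : Euc n} (hx : x ∈ frontier Ω) : ∃ U : Set (Euc n), IsOpen U ∧ x ∈ U ∧
      ∀ η : Euc n → ℝ, ContDiff ℝ ∞ η → HasCompactSupport η → tsupport η ⊆ U →
        ∫ x in Ω, (∑ j, pd j η x * W j x + η x * d x) = 0 := by
  obtain ⟨-, g, hg, hloc, -, hgrad, -⟩ := hΩ.smooth_boundary x hx
  have hposx : 0 < ∑ j, pd j g x ^ 2 := by
    obtain ⟨j, hj⟩ := exists_pd_ne_zero hgrad
    exact Finset.sum_pos' (fun i _ => sq_nonneg _) ⟨j, Finset.mem_univ _, by positivity⟩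
  have hG : Continuous fun y => ∑ j, pd j g y ^ 2 :=
    continuous_finsetSum _ fun j _ => (continuous_pd hg j).pow 2
  obtain ⟨R, hR, hball⟩ := Metric.eventually_nhds_iff_ball.1
    (hloc.and (hG.continuousAt.eventually (lt_mem_nhds hposx)))
  -- ξ equals 1 on the ball of radius R/3 that contains the support of every admissible η. The bound
  -- M below therefore depends on ξ and g but not on δ.
  let ξ : ContDiffBump x := ⟨R / 3, R / 2, by positivity, by linarith⟩
  have hVΩ : ∀ y ∈ Metric.ball x R, (y ∈ Ω ↔ g y < 0) := fun y hy => (hball y hy).1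
  have hVp : ∀ y ∈ Metric.ball x R, 0 < ∑ j, pd j g y ^ 2 := fun y hy => (hball y hy).2
  have hξV : tsupport ξ ⊆ Metric.ball x R := by
    rw [ξ.tsupport_eq]
    exact Metric.closedBall_subset_ball (by simp only [ξ]; linarith)
  refine ⟨Metric.ball x (R / 3), Metric.isOpen_ball, Metric.mem_ball_self (by positivity),
    fun η hη hc hs => ?_⟩
  have hsV : tsupport η ⊆ Metric.ball x R := hs.trans (Metric.ball_subset_ball (by linarith))
  set M := ∫ y in Ω, |∑ j, (pd j ξ y * pd j g y + ξ y * pd j (pd j g) y)|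
  have hM0 : 0 ≤ M := integral_nonneg fun _ => abs_nonneg _
  have identity : ∀ δ > 0, ∫ y in Ω, levelCutoff g δ y * (∑ j, pd j η y * W j y + η y * d y) =
      ∫ y in Ω, levelCutoffDeriv g δ y * (η y * ∑ j, pd j g y * W j y) := by
    intro δ hδ
    have hh := contDiff_levelCutoff hg δ
    have e := hW.integral_test _ (hη.mul hh) hc.mul_right
      (tsupport_mul_levelCutoff_subset hg hδ hVΩ hsV)
    have expand : ∀ y, ∑ j, pd j (fun y => η y * levelCutoff g δ y) y * W j y +
        η y * levelCutoff g δ y * d y =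
        levelCutoff g δ y * (∑ j, pd j η y * W j y + η y * d y) -
          levelCutoffDeriv g δ y * (η y * ∑ j, pd j g y * W j y) := by
      intro y
      have : ∀ j, pd j (fun y => η y * levelCutoff g δ y) y * W j y =
          levelCutoff g δ y * (pd j η y * W j y) -
            levelCutoffDeriv g δ y * η y * (pd j g y * W j y) := fun j => by
        rw [pd_mul (hη.differentiable (by simp) y) (hh.differentiable (by simp) y),
          pd_levelCutoff hg]
        ring
      rw [Finset.sum_congr rfl fun j _ => this j, Finset.sum_sub_distrib, ← Finset.mul_sum,
        ← Finset.mul_sum]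
      ring
    simp only [expand] at e
    rw [integral_sub, sub_eq_zero] at e
    · exact e
    · refine (hW.integrable_test hη hc).bdd_mul (c := 1) hh.continuous.aestronglyMeasurable
        (Eventually.of_forall fun y => ?_)
      rw [levelCutoff, Real.norm_of_nonneg (Real.smoothTransition.nonneg _)]
      exact Real.smoothTransition.le_one _
    · have : ∀ y, levelCutoffDeriv g δ y * (η y * ∑ j, pd j g y * W j y) =
          ∑ j, (η y * (levelCutoffDeriv g δ y * pd j g y)) * W j y := fun y => by
        rw [Finset.mul_sum, Finset.mul_sum]
        exact Finset.sum_congr rfl fun j _ => by ring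
      simp only [this]
      exact integrable_finsetSum _ fun j _ => integrableOn_mul_of_compactSupport (hW.integrable j)
        (hη.continuous.mul ((continuous_levelCutoffDeriv hg δ).mul (continuous_pd hg j)))
        hc.mul_right
  have lim1 : Tendsto (fun δ => ∫ y in Ω, levelCutoff g δ y *
      (∑ j, pd j η y * W j y + η y * d y)) (𝓝[>] 0)
      (𝓝 (∫ y in Ω, (∑ j, pd j η y * W j y + η y * d y))) := by
    refine tendsto_integral_filter_of_dominated_convergence
      (fun y => |∑ j, pd j η y * W j y + η y * d y|) (Eventually.of_forall fun δ => ?_)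
      (Eventually.of_forall fun δ => Eventually.of_forall fun y => ?_)
      (hW.integrable_test hη hc).abs ?_
    · exact (contDiff_levelCutoff hg δ).continuous.aestronglyMeasurable.mul
        (hW.integrable_test hη hc).aestronglyMeasurable
    · rw [norm_mul, levelCutoff, Real.norm_of_nonneg (Real.smoothTransition.nonneg _)]
      exact mul_le_of_le_one_left (norm_nonneg _) (Real.smoothTransition.le_one _)
    · refine (ae_restrict_mem hΩ.isOpen.measurableSet).mono fun y hy => ?_
      by_cases hyV : y ∈ tsupport η
      · have hgy := (hVΩ y (hsV hyV)).1 hy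
        refine tendsto_const_nhds.congr' ?_
        have : ∀ᶠ δ in 𝓝[>] (0 : ℝ), δ < -g y / 2 :=
          nhdsWithin_le_nhds (gt_mem_nhds (by linarith))
        filter_upwards [this, self_mem_nhdsWithin] with δ h1 h2
        have h2 : 0 < δ := h2
        have : 2 ≤ -g y / δ := (le_div_iff₀ h2).2 (by linarith)
        rw [levelCutoff, Real.smoothTransition.one_of_one_le (by linarith), one_mul]
      · simp [pd_eq_zero_of_notMem_tsupport hyV, image_eq_zero_of_notMem_tsupport hyV]
  have lim2 : Tendsto (fun δ => ∫ y in Ω, levelCutoffDeriv g δ y *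
      (η y * ∑ j, pd j g y * W j y)) (𝓝[>] 0) (𝓝 0) := by
    rw [Metric.tendsto_nhds]
    intro ε hε
    -- With θ = ε/(M+1) the final bound is θM < ε, also when M = 0. The cutoff varies only where −g
    -- ≤ 2δ, hence the requirement δ < δ₀/2.
    obtain ⟨δ₀, hδ₀, hsmall⟩ := hW.zeroTrace.exists_uniform hΩ.isOpen hg Metric.isOpen_ball hVΩ hVp
      hc.isCompact hsV hη.continuous (θ := ε / (M + 1)) (by positivity)
    filter_upwards [nhdsWithin_le_nhds (gt_mem_nhds (show 0 < δ₀ / 2 by positivity)),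
      self_mem_nhdsWithin] with δ h1 h2
    have hδ : 0 < δ := h2
    have h1 : δ < δ₀ / 2 := h1
    rw [dist_zero_right]
    have bound : ∀ y ∈ Ω, ‖levelCutoffDeriv g δ y * (η y * ∑ j, pd j g y * W j y)‖ ≤
        ε / (M + 1) * (ξ y * levelCutoffDeriv g δ y * ∑ j, pd j g y ^ 2) := by
      intro y hy
      have hs0 := levelCutoffDeriv_nonneg g hδ y
      have hsum : 0 ≤ ∑ j, pd j g y ^ 2 := Finset.sum_nonneg fun _ _ => sq_nonneg _
      have hrhs : 0 ≤ ε / (M + 1) * (ξ y * levelCutoffDeriv g δ y * ∑ j, pd j g y ^ 2) := by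
        have := ξ.nonneg (x := y)
        positivity
      by_cases hyV : y ∈ tsupport η
      · by_cases hfar : 2 * δ < -g y
        · rw [levelCutoffDeriv_eq_zero g hδ hfar]
          simp
        · have hξ1 : ξ y = 1 := ξ.one_of_mem_closedBall (Metric.ball_subset_closedBall (hs hyV))
          have := hsmall y hyV hy (by linarith)
          rw [norm_mul, Real.norm_of_nonneg hs0, Real.norm_eq_abs, hξ1]
          calc levelCutoffDeriv g δ y * |η y * ∑ j, pd j g y * W j y|
              ≤ levelCutoffDeriv g δ y * (ε / (M + 1) * ∑ j, pd j g y ^ 2) := by gcongr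
            _ = _ := by ring
      · rw [image_eq_zero_of_notMem_tsupport hyV]
        simpa using hrhs
    have hint : IntegrableOn (fun y => ε / (M + 1) *
        (ξ y * levelCutoffDeriv g δ y * ∑ j, pd j g y ^ 2)) Ω :=
      ((((ξ.continuous.mul (continuous_levelCutoffDeriv hg δ)).mul
        hG).integrable_of_hasCompactSupport
        ξ.hasCompactSupport.mul_right.mul_right).const_mul _).integrableOn
    calc ‖∫ y in Ω, levelCutoffDeriv g δ y * (η y * ∑ j, pd j g y * W j y)‖
        ≤ ∫ y in Ω, ε / (M + 1) * (ξ y * levelCutoffDeriv g δ y * ∑ j, pd j g y ^ 2) :=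
          norm_integral_le_of_norm_le hint
            ((ae_restrict_mem hΩ.isOpen.measurableSet).mono bound)
      _ = ε / (M + 1) * ∫ y in Ω, ξ y * levelCutoffDeriv g δ y * ∑ j, pd j g y ^ 2 :=
          integral_const_mul _ _
      _ ≤ ε / (M + 1) * M := by
          gcongr
          exact integral_levelCutoffDeriv_le hΩ.isOpen hg ξ.contDiff ξ.hasCompactSupport hVΩ hξV hδ
      _ < ε := by
          rw [div_mul_eq_mul_div, div_lt_iff₀ (by positivity)]
          nlinarith
  refine tendsto_nhds_unique lim1 (lim2.congr' ?_)
  filter_upwards [self_mem_nhdsWithin] with δ hδ using (identity δ hδ).symm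

theorem NoFluxField.exists_nhds (hW : NoFluxField Ω W d) (hΩ : IsSmoothDomain Ω) (x : Euc n) :
    ∃ U : Set (Euc n), IsOpen U ∧ x ∈ U ∧
      ∀ η : Euc n → ℝ, ContDiff ℝ ∞ η → HasCompactSupport η → tsupport η ⊆ U →
        ∫ x in Ω, (∑ j, pd j η x * W j x + η x * d x) = 0 := by
  by_cases hxΩ : x ∈ Ω
  · exact ⟨Ω, hΩ.isOpen, hxΩ, hW.integral_test⟩
  by_cases hxc : x ∈ closure Ω
  · exact hW.exists_nhds_of_mem_frontier hΩ (by rw [hΩ.isOpen.frontier_eq]; exact ⟨hxc, hxΩ⟩)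
  · refine ⟨(closure Ω)ᶜ, isClosed_closure.isOpen_compl, hxc, fun η _ _ hs => ?_⟩
    refine integral_eq_zero_of_ae ((ae_restrict_mem hΩ.isOpen.measurableSet).mono fun y hy => ?_)
    have hy' : y ∉ tsupport η := fun h => hs h (subset_closure hy)
    simp [pd_eq_zero_of_notMem_tsupport hy', image_eq_zero_of_notMem_tsupport hy']

/-- A field without normal component can be tested with functions that do not vanish at the
boundary. -/
theorem NoFluxField.integral_test_of_hasCompactSupport (hW : NoFluxField Ω W d)
    (hΩ : IsSmoothDomain Ω) {η : Euc n → ℝ} (hη : ContDiff ℝ ∞ η) (hc : HasCompactSupport η) :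
    ∫ x in Ω, (∑ j, pd j η x * W j x + η x * d x) = 0 := by
  choose U hUo hxU hU using hW.exists_nhds hΩ
  obtain ⟨t, ht⟩ := hc.isCompact.elim_finite_subcover U hUo
    fun x _ => mem_iUnion.2 ⟨x, hxU x⟩
  -- The local statements add up because the f i sum to 1 on the support of η, which makes η equal
  -- to the sum of the pieces f i · η everywhere.
  obtain ⟨f, hf⟩ := SmoothPartitionOfUnity.exists_isSubordinate (modelWithCornersSelf ℝ (Euc n))
    (isClosed_tsupport η) (fun i : t => U i) (fun i => hUo i) (by simpa [iUnion_subtype] using ht)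
  have hfs : ∀ i, ContDiff ℝ ∞ (f i) := fun i => (f i).contMDiff.contDiff
  have hsum : ∀ y, η y = ∑ i, f i y * η y := by
    intro y
    by_cases hy : y ∈ tsupport η
    · have := f.sum_eq_one hy
      rw [finsum_eq_sum_of_fintype] at this
      rw [← Finset.sum_mul, this, one_mul]
    · simp [image_eq_zero_of_notMem_tsupport hy]
  have hpd : ∀ j y, pd j η y = ∑ i, pd j (fun y => f i y * η y) y := by
    intro j y
    have : η = fun y => ∑ i, f i y * η y := funext hsum
    conv_lhs => rw [this, pd, fderiv_fun_sum fun i _ =>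
      ((hfs i).mul hη).differentiable (by simp) y]
    simp [pd]
  have hpiece : ∀ i, ∫ x in Ω, (∑ j, pd j (fun y => f i y * η y) x * W j x +
      f i x * η x * d x) = 0 := fun i =>
    hU i _ ((hfs i).mul hη) hc.mul_left ((tsupport_mul_subset_left).trans (hf i))
  calc ∫ x in Ω, (∑ j, pd j η x * W j x + η x * d x)
      = ∫ x in Ω, ∑ i, (∑ j, pd j (fun y => f i y * η y) x * W j x + f i x * η x * d x) := by
        refine integral_congr_ae (Eventually.of_forall fun x => ?_)
        simp only
        rw [Finset.sum_add_distrib, Finset.sum_comm, ← Finset.sum_mul, ← hsum]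
        congr 1
        exact Finset.sum_congr rfl fun j _ => by rw [hpd, Finset.sum_mul]
    _ = 0 := by
        rw [integral_finsetSum _ fun i _ => hW.integrable_test ((hfs i).mul hη) hc.mul_left]
        exact Finset.sum_eq_zero fun i _ => hpiece i

/-- **Divergence theorem** for a field without normal component at the boundary. -/
theorem NoFluxField.integral_eq_zero (hW : NoFluxField Ω W d) (hΩ : IsSmoothDomain Ω) :
    ∫ x in Ω, d x = 0 := by
  let χ : ContDiffBump (0 : Euc n) := ⟨1, 2, one_pos, one_lt_two⟩
  -- Ω may be unbounded. These cutoffs equal 1 on balls of radius m+1 and have gradients of size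
  -- O(1/(m+1)). Integrability of W then makes the gradient term vanish in the limit.
  let η : ℕ → Euc n → ℝ := fun m x => χ ((m + 1 : ℝ)⁻¹ • x)
  have hm : ∀ m : ℕ, (m + 1 : ℝ)⁻¹ ≠ 0 := fun m => by positivity
  have hηs : ∀ m, ContDiff ℝ ∞ (η m) := fun m => χ.contDiff.comp (contDiff_const_smul _)
  have hηc : ∀ m, HasCompactSupport (η m) := fun m =>
    χ.hasCompactSupport.comp_homeomorph (Homeomorph.smulOfNeZero _ (hm m))
  have hpd : ∀ m j x, pd j (η m) x = (m + 1 : ℝ)⁻¹ * pd j χ ((m + 1 : ℝ)⁻¹ • x) := by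
    intro m j x
    have h1 : HasFDerivAt χ (fderiv ℝ χ ((m + 1 : ℝ)⁻¹ • x)) ((m + 1 : ℝ)⁻¹ • x) :=
      ((χ.contDiff (n := 1)).differentiable (by simp) _).hasFDerivAt
    have h2 : HasFDerivAt (fun y : Euc n => (m + 1 : ℝ)⁻¹ • y)
      ((m + 1 : ℝ)⁻¹ • ContinuousLinearMap.id ℝ (Euc n)) x :=
      ((m + 1 : ℝ)⁻¹ • ContinuousLinearMap.id ℝ (Euc n)).hasFDerivAt
    have := (h1.comp x h2).fderiv
    rw [pd, show η m = χ ∘ fun y : Euc n => (m + 1 : ℝ)⁻¹ • y from rfl, this]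
    simp [pd]
  have hC : ∀ j, ∃ C, ∀ x, |pd j χ x| ≤ C := fun j =>
    (χ.hasCompactSupport.mono' (subset_closure.trans
      (tsupport_fderiv_apply_subset _))).exists_bound_of_continuous (continuous_pd χ.contDiff j)
  choose C hC using hC
  have hinv : ∀ m : ℕ, (m + 1 : ℝ)⁻¹ ≤ 1 := fun m => inv_le_one_of_one_le₀ (by simp)
  have hlim0 : Tendsto (fun m : ℕ => (m + 1 : ℝ)⁻¹) atTop (𝓝 0) := by
    simpa using tendsto_one_div_add_atTop_nhds_zero_nat (𝕜 := ℝ)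
  have lim : Tendsto (fun m => ∫ x in Ω, (∑ j, pd j (η m) x * W j x + η m x * d x)) atTop
      (𝓝 (∫ x in Ω, d x)) := by
    refine tendsto_integral_filter_of_dominated_convergence
      (fun x => ∑ j, C j * |W j x| + |d x|)
      (Eventually.of_forall fun m => (hW.integrable_test (hηs m) (hηc m)).aestronglyMeasurable)
      (Eventually.of_forall fun m => Eventually.of_forall fun x => ?_)
      ((integrable_finsetSum _ fun j _ => (hW.integrable j).abs.const_mul _).add
        hW.integrable_div.abs) (Eventually.of_forall fun x => ?_)
    · refine (norm_add_le _ _).trans (add_le_add ((norm_sum_le _ _).trans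
        (Finset.sum_le_sum fun j _ => ?_)) ?_)
      · rw [hpd, norm_mul, norm_mul]
        refine mul_le_mul_of_nonneg_right ?_ (norm_nonneg _)
        rw [Real.norm_of_nonneg (by positivity)]
        exact (mul_le_of_le_one_left (norm_nonneg _) (hinv m)).trans (hC j _)
      · rw [norm_mul]
        refine mul_le_of_le_one_left (norm_nonneg _) ?_
        rw [Real.norm_of_nonneg χ.nonneg]
        exact χ.le_one
    · have t1 : Tendsto (fun m => ∑ j, pd j (η m) x * W j x) atTop
          (𝓝 (∑ j : Fin n, 0 * W j x)) := by
        refine tendsto_finsetSum _ fun j _ => Tendsto.mul_const _ ?_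
        refine squeeze_zero_norm (fun m => ?_) (by simpa using hlim0.mul_const (C j))
        rw [hpd, norm_mul, Real.norm_of_nonneg (by positivity)]
        exact mul_le_mul_of_nonneg_left (hC j _) (by positivity)
      have t2 : Tendsto (fun m => η m x) atTop (𝓝 1) := by
        have : Tendsto (fun m : ℕ => (m + 1 : ℝ)⁻¹ • x) atTop (𝓝 0) := by
          simpa using hlim0.smul_const x
        have := ((χ.continuous.tendsto 0).comp this)
        rwa [χ.one_of_mem_closedBall (by simp [χ])] at this
      simpa using t1.add (t2.mul_const (d x))
  refine tendsto_nhds_unique lim (tendsto_const_nhds.congr fun m => ?_)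
  exact (hW.integral_test_of_hasCompactSupport hΩ (hηs m) (hηc m)).symm

end DivergenceTheorem

/-! ### Product rules for gradients, Laplacians and Hessians in coordinates -/

section VectorCalculus

variable {n : ℕ} {Ω : Set (Euc n)} {f g h : Euc n → ℝ} {x : Euc n}

/-- The inner product of the gradients of two functions. -/
def gd (f g : Euc n → ℝ) (x : Euc n) : ℝ := ∑ j, pd j f x * pd j g x

/-- The Laplacian in coordinates. -/
def lap (f : Euc n → ℝ) (x : Euc n) : ℝ := ∑ j, pd j (pd j f) x

/-- The Hessian of `φ`, applied to the gradients of `f` and `g`. -/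
def hess (φ f g : Euc n → ℝ) (x : Euc n) : ℝ :=
  ∑ j, ∑ k, pd j f x * pd k g x * pd j (pd k φ) x

theorem gd_comm (f g : Euc n → ℝ) (x : Euc n) : gd f g x = gd g f x :=
  Finset.sum_congr rfl fun _ _ => mul_comm _ _

theorem contDiffOn_pd (hΩ : IsOpen Ω) (hf : ContDiffOn ℝ 2 f Ω) (j : Fin n) :
    ContDiffOn ℝ 1 (pd j f) Ω :=
  (hf.fderiv_of_isOpen hΩ (m := 1) (by norm_num)).clm_apply contDiffOn_const

theorem continuousOn_pd (hΩ : IsOpen Ω) (hf : ContDiffOn ℝ 1 f Ω) (j : Fin n) :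
    ContinuousOn (pd j f) Ω :=
  (hf.continuousOn_fderiv_of_isOpen hΩ le_rfl).clm_apply continuousOn_const

theorem differentiableAt_of_contDiffOn (hΩ : IsOpen Ω) (hf : ContDiffOn ℝ 1 f Ω) (hx : x ∈ Ω) :
    DifferentiableAt ℝ f x :=
  (hf.differentiableOn one_ne_zero x hx).differentiableAt (hΩ.mem_nhds hx)

theorem contDiffOn_gd (hΩ : IsOpen Ω) (hf : ContDiffOn ℝ 2 f Ω) (hg : ContDiffOn ℝ 2 g Ω) :
    ContDiffOn ℝ 1 (gd f g) Ω :=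
  ContDiffOn.sum fun j _ => (contDiffOn_pd hΩ hf j).mul (contDiffOn_pd hΩ hg j)

theorem pd_const (c : ℝ) (j : Fin n) (x : Euc n) : pd j (fun _ => c) x = 0 := by
  simp [pd]

theorem pd_add {j : Fin n} (hf : DifferentiableAt ℝ f x) (hg : DifferentiableAt ℝ g x) :
    pd j (fun y => f y + g y) x = pd j f x + pd j g x := by
  simp [pd, fderiv_fun_add hf hg]

theorem pd_sub {j : Fin n} (hf : DifferentiableAt ℝ f x) (hg : DifferentiableAt ℝ g x) :
    pd j (fun y => f y - g y) x = pd j f x - pd j g x := by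
  simp [pd, fderiv_fun_sub hf hg]

theorem pd_sum {ι : Type*} {s : Finset ι} {F : ι → Euc n → ℝ} {j : Fin n}
    (hF : ∀ i ∈ s, DifferentiableAt ℝ (F i) x) :
    pd j (fun y => ∑ i ∈ s, F i y) x = ∑ i ∈ s, pd j (F i) x := by
  simp [pd, fderiv_fun_sum hF]

theorem gd_add_left (hf : DifferentiableAt ℝ f x) (hg : DifferentiableAt ℝ g x) :
    gd (fun y => f y + g y) h x = gd f h x + gd g h x := by
  simp only [gd, pd_add hf hg, add_mul, Finset.sum_add_distrib]

theorem gd_sub_left (hf : DifferentiableAt ℝ f x) (hg : DifferentiableAt ℝ g x) :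
    gd (fun y => f y - g y) h x = gd f h x - gd g h x := by
  simp only [gd, pd_sub hf hg, sub_mul, Finset.sum_sub_distrib]

theorem gd_const_left (c : ℝ) : gd (fun _ => c) h x = 0 := by
  simp [gd, pd_const]

theorem gd_mul_left (hf : DifferentiableAt ℝ f x) (hg : DifferentiableAt ℝ g x) :
    gd (fun y => f y * g y) h x = gd f h x * g x + f x * gd g h x := by
  simp only [gd, pd_mul hf hg, Finset.sum_mul, Finset.mul_sum, ← Finset.sum_add_distrib]
  exact Finset.sum_congr rfl fun j _ => by ring

theorem gd_const_mul_left (c : ℝ) (hf : DifferentiableAt ℝ f x) :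
    gd (fun y => c * f y) h x = c * gd f h x := by
  rw [gd_mul_left (differentiableAt_const c) hf, gd_const_left]
  ring

theorem pd_pd_eq (hΩ : IsOpen Ω) (hf : ContDiffOn ℝ 2 f Ω) (hx : x ∈ Ω) (i j : Fin n) :
    pd i (pd j f) x =
      fderiv ℝ (fderiv ℝ f) x (EuclideanSpace.single i 1) (EuclideanSpace.single j 1) := by
  have h1 : DifferentiableAt ℝ (fderiv ℝ f) x :=
    ((hf.fderiv_of_isOpen hΩ (m := 1) (by norm_num)).differentiableOn one_ne_zero x
      hx).differentiableAt (hΩ.mem_nhds hx)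
  have : HasFDerivAt (pd j f) ((ContinuousLinearMap.apply ℝ ℝ
      (EuclideanSpace.single j (1 : ℝ))).comp (fderiv ℝ (fderiv ℝ f) x)) x :=
    (ContinuousLinearMap.apply ℝ ℝ (EuclideanSpace.single j (1 : ℝ))).hasFDerivAt.comp x
      h1.hasFDerivAt
  rw [pd, this.fderiv]
  rfl

theorem pd_pd_comm (hΩ : IsOpen Ω) (hf : ContDiffOn ℝ 2 f Ω) (hx : x ∈ Ω) (i j : Fin n) :
    pd i (pd j f) x = pd j (pd i f) x := by
  rw [pd_pd_eq hΩ hf hx, pd_pd_eq hΩ hf hx]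
  exact ((hf.contDiffAt (hΩ.mem_nhds hx)).isSymmSndFDerivAt (by simp)) _ _

theorem pd_gd (hΩ : IsOpen Ω) (hf : ContDiffOn ℝ 2 f Ω) (hg : ContDiffOn ℝ 2 g Ω) (hx : x ∈ Ω)
    (j : Fin n) : pd j (gd f g) x =
      ∑ k, (pd j (pd k f) x * pd k g x + pd k f x * pd j (pd k g) x) := by
  have h1 : ∀ k, DifferentiableAt ℝ (pd k f) x := fun k =>
    differentiableAt_of_contDiffOn hΩ (contDiffOn_pd hΩ hf k) hx
  have h2 : ∀ k, DifferentiableAt ℝ (pd k g) x := fun k =>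
    differentiableAt_of_contDiffOn hΩ (contDiffOn_pd hΩ hg k) hx
  rw [show gd f g = fun y => ∑ k, pd k f y * pd k g y from rfl,
    pd_sum (F := fun k y => pd k f y * pd k g y) fun k _ => (h1 k).mul (h2 k)]
  exact Finset.sum_congr rfl fun k _ => pd_mul (h1 k) (h2 k)

theorem hess_comm (hΩ : IsOpen Ω) {φ : Euc n → ℝ} (hφ : ContDiffOn ℝ 2 φ Ω) (hx : x ∈ Ω)
    (f g : Euc n → ℝ) : hess φ f g x = hess φ g f x := by
  rw [hess, Finset.sum_comm]
  refine Finset.sum_congr rfl fun j _ => Finset.sum_congr rfl fun k _ => ?_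
  rw [pd_pd_comm hΩ hφ hx k j]
  ring

/-- Differentiating ∇f·∇g along ∇h produces one Hessian term per factor. Every second-order term of
the energy balance is brought to this form. -/
theorem gd_gd (hΩ : IsOpen Ω) (hf : ContDiffOn ℝ 2 f Ω) (hg : ContDiffOn ℝ 2 g Ω) (hx : x ∈ Ω)
    (h : Euc n → ℝ) : gd (gd f g) h x = hess f h g x + hess g h f x := by
  simp only [gd, hess, ← Finset.sum_add_distrib, pd_gd hΩ hf hg hx, Finset.sum_mul]
  exact Finset.sum_congr rfl fun j _ => Finset.sum_congr rfl fun k _ => by ring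

end VectorCalculus

/-! ### Green's formulas without boundary terms -/

section IntegrationByParts

variable {n : ℕ} {Ω : Set (Euc n)} {W : Fin n → Euc n → ℝ} {w w' f : Euc n → ℝ}

/-- The function `w` on `Ω` is bounded near every boundary point. -/
def BddNear (Ω : Set (Euc n)) (w : Euc n → ℝ) : Prop :=
  ∀ x ∈ frontier Ω, ∃ C, ∀ᶠ y in 𝓝[Ω] x, |w y| ≤ C

theorem BddNear.of_bound {C : ℝ} (h : ∀ x ∈ Ω, ‖w x‖ ≤ C) : BddNear Ω w := fun _ _ =>
  ⟨C, eventually_mem_nhdsWithin.mono h⟩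

theorem BddNear.mul (hw : BddNear Ω w) (hw' : BddNear Ω w') :
    BddNear Ω fun x => w x * w' x := fun x hx => by
  obtain ⟨C, hC⟩ := hw x hx
  obtain ⟨C', hC'⟩ := hw' x hx
  refine ⟨C * C', ?_⟩
  filter_upwards [hC, hC'] with y h1 h2
  rw [abs_mul]
  exact mul_le_mul h1 h2 (abs_nonneg _) ((abs_nonneg _).trans h1)

theorem BddNear.add (hw : BddNear Ω w) (hw' : BddNear Ω w') :
    BddNear Ω fun x => w x + w' x := fun x hx => by
  obtain ⟨C, hC⟩ := hw x hx
  obtain ⟨C', hC'⟩ := hw' x hx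
  refine ⟨C + C', ?_⟩
  filter_upwards [hC, hC'] with y h1 h2
  exact (abs_add_le _ _).trans (add_le_add h1 h2)

theorem bddNear_const (c : ℝ) : BddNear Ω fun _ => c := .of_bound fun _ _ => le_rfl

theorem BddNear.sub (hw : BddNear Ω w) (hw' : BddNear Ω w') :
    BddNear Ω fun x => w x - w' x := by
  simpa [sub_eq_add_neg] using hw.add ((bddNear_const (-1)).mul hw')

theorem BddNear.sum {ι : Type*} {s : Finset ι} {F : ι → Euc n → ℝ}
    (hF : ∀ i ∈ s, BddNear Ω (F i)) : BddNear Ω fun x => ∑ i ∈ s, F i x := by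
  classical
  induction s using Finset.induction_on with
  | empty => simpa using bddNear_const 0
  | insert a s ha ih =>
    simp only [Finset.sum_insert ha]
    exact (hF a (by simp)).add (ih fun i hi => hF i (by simp [hi]))

/-- A factor bounded near ∂Ω cannot spoil a normal component tending to zero. The weights therefore
need no limit at the boundary. -/
theorem ZeroTrace.mul (hW : ZeroTrace Ω W) (hw : BddNear Ω w) :
    ZeroTrace Ω fun j x => w x * W j x := by
  intro x hx g hg hloc hgx hgrad
  obtain ⟨C, hC⟩ := hw x hx
  have h := (hW x hx g hg hloc hgx hgrad).norm.const_mul C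
  rw [norm_zero, mul_zero] at h
  refine squeeze_zero_norm' ?_ h
  filter_upwards [hC] with y hy
  have : ∑ j, pd j g y * (w y * W j y) = w y * ∑ j, pd j g y * W j y := by
    rw [Finset.mul_sum]
    exact Finset.sum_congr rfl fun j _ => by ring
  rw [this, norm_mul]
  exact mul_le_mul_of_nonneg_right hy (norm_nonneg _)

/-- The weight `k` is only weakly differentiable, the field `V` is of class `C¹`. -/
theorem noFluxField_weak_mul (hΩ : IsOpen Ω) {k : Euc n → ℝ} {κ V : Fin n → Euc n → ℝ}
    (hk : HasWeakGrad Ω k κ) (hV : ∀ j, ContDiffOn ℝ 1 (V j) Ω)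
    (hi : ∀ j, IntegrableOn (fun x => k x * V j x) Ω)
    (hd : IntegrableOn (fun x => ∑ j, κ j x * V j x + k x * ∑ j, pd j (V j) x) Ω)
    (ht : ZeroTrace Ω fun j x => k x * V j x) :
    NoFluxField Ω (fun j x => k x * V j x)
      (fun x => ∑ j, κ j x * V j x + k x * ∑ j, pd j (V j) x) := by
  refine ⟨hi, hd, fun η hη hc hs => ?_, ht⟩
  have hη1 : ContDiff ℝ 1 η := hη.of_le (by exact_mod_cast le_top)
  have hsub : ∀ j, tsupport (fun x => η x * V j x) ⊆ tsupport η := fun j =>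
    tsupport_mul_subset_left
  -- η·V j is C¹ on the whole space with compact support in Ω, but no smoother than V j. This is why
  -- the weak gradient of k had to be extended to C¹ test functions.
  have hηV : ∀ j, ContDiff ℝ 1 fun x => η x * V j x := fun j =>
    contDiff_iff_contDiffAt.2 fun x => by
      by_cases hx : x ∈ tsupport fun x => η x * V j x
      · exact hη1.contDiffAt.mul ((hV j).contDiffAt (hΩ.mem_nhds (hs (hsub j hx))))
      · exact contDiffAt_const.congr_of_eventuallyEq (notMem_tsupport_iff_eventuallyEq.1 hx)
  have hcc : ∀ j, HasCompactSupport fun x => η x * V j x := fun j => hc.mul_right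
  have key : ∀ j, ∫ x in Ω, (pd j (fun x => η x * V j x) x * k x + η x * V j x * κ j x) = 0 := by
    intro j
    rw [integral_add, hk.integral_eq_of_contDiff_one hΩ (hηV j) (hcc j) ((hsub j).trans hs) j,
      neg_add_cancel]
    · exact integrableOn_test_smul (continuous_fderiv_apply_of_contDiff (hηV j) _)
        ((hcc j).mono' (subset_closure.trans (tsupport_fderiv_apply_subset _)))
        ((tsupport_fderiv_apply_subset _).trans ((hsub j).trans hs)) hk.1
    · exact integrableOn_test_smul (hηV j).continuous (hcc j) ((hsub j).trans hs) (hk.2 j)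
  have hint : ∀ j, IntegrableOn
      (fun x => pd j (fun x => η x * V j x) x * k x + η x * V j x * κ j x) Ω := fun j => by
    refine Integrable.add ?_ ?_
    · exact integrableOn_test_smul (continuous_fderiv_apply_of_contDiff (hηV j) _)
        ((hcc j).mono' (subset_closure.trans (tsupport_fderiv_apply_subset _)))
        ((tsupport_fderiv_apply_subset _).trans ((hsub j).trans hs)) hk.1
    · exact integrableOn_test_smul (hηV j).continuous (hcc j) ((hsub j).trans hs) (hk.2 j)
  rw [← Finset.sum_eq_zero fun j (_ : j ∈ Finset.univ) => key j,
    ← integral_finsetSum _ fun j _ => hint j]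
  refine integral_congr_ae ((ae_restrict_mem hΩ.measurableSet).mono fun x hx => ?_)
  simp only [mul_add, Finset.mul_sum, ← Finset.sum_add_distrib]
  refine Finset.sum_congr rfl fun j _ => ?_
  rw [pd_mul (hη1.differentiable one_ne_zero x) (differentiableAt_of_contDiffOn hΩ (hV j) hx)]
  ring

theorem hasWeakGrad_pd (hΩ : IsOpen Ω) (hf : ContDiffOn ℝ 1 f Ω) :
    HasWeakGrad Ω f fun j => pd j f := by
  refine ⟨hf.continuousOn.locallyIntegrableOn hΩ.measurableSet, fun j =>
    (continuousOn_pd hΩ hf j).locallyIntegrableOn hΩ.measurableSet,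
    fun η hη hc hs j => ?_⟩
  exact integral_test_fderiv hΩ (hη.of_le (by exact_mod_cast le_top)) hc hs
    (hf.differentiableOn one_ne_zero) (hf.continuousOn_fderiv_of_isOpen hΩ le_rfl)
    (EuclideanSpace.single j 1)

/-- A function of class `C²` in `Ω` with vanishing normal derivative and with gradient bounded near
the boundary. -/
structure IsNeumann (Ω : Set (Euc n)) (f : Euc n → ℝ) : Prop where
  contDiffOn : ContDiffOn ℝ 2 f Ω
  zeroTrace : ZeroTrace Ω fun j => pd j f
  bddNear : ∀ j, BddNear Ω (pd j f)

/-- **Green's formula** for a function with vanishing normal derivative. -/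
theorem IsNeumann.integral_gd_add (hf : IsNeumann Ω f) (hΩ : IsSmoothDomain Ω)
    (hw : ContDiffOn ℝ 1 w Ω) (hb : BddNear Ω w)
    (hi : ∀ j, IntegrableOn (fun x => w x * pd j f x) Ω)
    (hd : IntegrableOn (fun x => gd w f x + w x * lap f x) Ω) :
    ∫ x in Ω, (gd w f x + w x * lap f x) = 0 :=
  (noFluxField_weak_mul hΩ.isOpen (hasWeakGrad_pd hΩ.isOpen hw)
    (contDiffOn_pd hΩ.isOpen hf.contDiffOn) hi hd (hf.zeroTrace.mul hb)).integral_eq_zero hΩ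

/-- Green's formula with a weakly differentiable factor. -/
theorem IsNeumann.integral_weak (hf : IsNeumann Ω f) (hΩ : IsSmoothDomain Ω) {k : Euc n → ℝ}
    {κ : Fin n → Euc n → ℝ} (hk : HasWeakGrad Ω k κ) (hw : ContDiffOn ℝ 1 w Ω)
    (hkb : BddNear Ω k) (hb : BddNear Ω w)
    (hi : ∀ j, IntegrableOn (fun x => k x * (w x * pd j f x)) Ω)
    (hd : IntegrableOn (fun x => ∑ j, κ j x * (w x * pd j f x) +
      k x * (gd w f x + w x * lap f x)) Ω) :
    ∫ x in Ω, (∑ j, κ j x * (w x * pd j f x) + k x * (gd w f x + w x * lap f x)) = 0 := by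
  have hdiv : ∀ x ∈ Ω, ∑ j, pd j (fun y => w y * pd j f y) x = gd w f x + w x * lap f x := by
    intro x hx
    rw [gd, lap, Finset.mul_sum, ← Finset.sum_add_distrib]
    exact Finset.sum_congr rfl fun j _ => pd_mul (differentiableAt_of_contDiffOn hΩ.isOpen hw hx)
      (differentiableAt_of_contDiffOn hΩ.isOpen (contDiffOn_pd hΩ.isOpen hf.contDiffOn j) hx)
  have hae : (fun x => ∑ j, κ j x * (w x * pd j f x) + k x * (gd w f x + w x * lap f x))
      =ᵐ[volume.restrict Ω] fun x => ∑ j, κ j x * (w x * pd j f x) +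
        k x * ∑ j, pd j (fun y => w y * pd j f y) x :=
    (ae_restrict_mem hΩ.isOpen.measurableSet).mono fun x hx => by simp only [hdiv x hx]
  rw [integral_congr_ae hae]
  exact (noFluxField_weak_mul hΩ.isOpen hk
    (fun j => hw.mul (contDiffOn_pd hΩ.isOpen hf.contDiffOn j)) hi (hd.congr hae)
    ((hf.zeroTrace.mul hb).mul hkb)).integral_eq_zero hΩ

end IntegrationByParts

/-! ### Integrability of products, and the regularity of the solutions at a fixed time -/

section Slices

variable {n : ℕ} {Ω : Set (Euc n)} {f g : Euc n → ℝ}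

theorem memLp_bdd_mul (hf : MemLp f ⊤ (volume.restrict Ω)) (hg : MemLp g 2 (volume.restrict Ω)) :
    MemLp (fun x => f x * g x) 2 (volume.restrict Ω) := hg.mul' hf

theorem memLp_mul_bdd (hf : MemLp f 2 (volume.restrict Ω)) (hg : MemLp g ⊤ (volume.restrict Ω)) :
    MemLp (fun x => f x * g x) 2 (volume.restrict Ω) := hg.mul' hf

theorem memLp_top_mul (hf : MemLp f ⊤ (volume.restrict Ω)) (hg : MemLp g ⊤ (volume.restrict Ω)) :
    MemLp (fun x => f x * g x) ⊤ (volume.restrict Ω) := hg.mul' hf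

theorem integrableOn_mul (hf : MemLp f 2 (volume.restrict Ω))
    (hg : MemLp g 2 (volume.restrict Ω)) : IntegrableOn (fun x => f x * g x) Ω :=
  hf.integrable_mul hg

theorem integrableOn_bdd_mul (hf : MemLp f ⊤ (volume.restrict Ω)) (hg : IntegrableOn g Ω) :
    IntegrableOn (fun x => f x * g x) Ω := by
  rw [IntegrableOn, ← memLp_one_iff_integrable] at hg ⊢
  exact hg.mul' hf

theorem integrableOn_mul_bdd (hf : IntegrableOn f Ω) (hg : MemLp g ⊤ (volume.restrict Ω)) :
    IntegrableOn (fun x => f x * g x) Ω := by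
  simpa only [mul_comm] using integrableOn_bdd_mul hg hf

theorem exists_bound_of_memLp_top (hΩ : IsOpen Ω) (hf : MemLp f ⊤ (volume.restrict Ω))
    (hc : ContinuousOn f Ω) : ∃ C, ∀ x ∈ Ω, ‖f x‖ ≤ C := by
  refine ⟨(eLpNorm f ⊤ (volume.restrict Ω)).toReal, forall_le_of_ae_le hΩ hc ?_⟩
  have h := hf.eLpNorm_ne_top
  rw [eLpNorm_exponent_top] at h ⊢
  filter_upwards [ae_le_eLpNormEssSup (f := f) (μ := volume.restrict Ω)] with x hx
  rwa [← ENNReal.ofReal_le_iff_le_toReal h, ofReal_norm]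

theorem bddNear_of_memLp_top (hΩ : IsOpen Ω) (hf : MemLp f ⊤ (volume.restrict Ω))
    (hc : ContinuousOn f Ω) : BddNear Ω f :=
  let ⟨_, h⟩ := exists_bound_of_memLp_top hΩ hf hc
  .of_bound h

theorem BddNear.gd (hf : ∀ j, BddNear Ω (pd j f)) (hg : ∀ j, BddNear Ω (pd j g)) :
    BddNear Ω (gd f g) := .sum fun j _ => (hf j).mul (hg j)

theorem integrableOn_gd (hf : ∀ j, MemLp (pd j f) 2 (volume.restrict Ω))
    (hg : ∀ j, MemLp (pd j g) 2 (volume.restrict Ω)) : IntegrableOn (gd f g) Ω :=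
  integrable_finsetSum _ fun j _ => integrableOn_mul (hf j) (hg j)

theorem memLp_gd (hf : ∀ j, MemLp (pd j f) 2 (volume.restrict Ω))
    (hg : ∀ j, MemLp (pd j g) ⊤ (volume.restrict Ω)) : MemLp (gd f g) 2 (volume.restrict Ω) :=
  memLp_finsetSum _ fun j _ => memLp_mul_bdd (hf j) (hg j)

theorem memLp_top_gd (hf : ∀ j, MemLp (pd j f) ⊤ (volume.restrict Ω))
    (hg : ∀ j, MemLp (pd j g) ⊤ (volume.restrict Ω)) : MemLp (gd f g) ⊤ (volume.restrict Ω) :=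
  memLp_finsetSum _ fun j _ => memLp_top_mul (hf j) (hg j)

theorem memLp_lap {p : ℝ≥0∞} (hf : ∀ i j, MemLp (pd i (pd j f)) p (volume.restrict Ω)) :
    MemLp (lap f) p (volume.restrict Ω) := memLp_finsetSum _ fun j _ => hf j j

theorem integrableOn_hess {φ : Euc n → ℝ}
    (hf : ∀ j, MemLp (pd j f) 2 (volume.restrict Ω))
    (hg : ∀ j, MemLp (pd j g) 2 (volume.restrict Ω))
    (hφ : ∀ i j, MemLp (pd i (pd j φ)) ⊤ (volume.restrict Ω)) : IntegrableOn (hess φ f g) Ω :=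
  integrable_finsetSum _ fun j _ => integrable_finsetSum _ fun k _ =>
    integrableOn_mul_bdd (integrableOn_mul (hf j) (hg k)) (hφ j k)

/-- The regularity of the real or imaginary part of the wave function at a fixed time. -/
structure WaveSlice (Ω : Set (Euc n)) (a : Euc n → ℝ) : Prop where
  neumann : IsNeumann Ω a
  memLp_top : MemLp a ⊤ (volume.restrict Ω)
  memLp_pd : ∀ j, MemLp (pd j a) 2 (volume.restrict Ω)
  memLp_pd_pd : ∀ i j, MemLp (pd i (pd j a)) 2 (volume.restrict Ω)

/-- The regularity of the solution of the Euler equation at a fixed time. -/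
structure FluidSlice (Ω : Set (Euc n)) (ρ φ : Euc n → ℝ) (κ : Fin n → Euc n → ℝ) : Prop where
  neumann : IsNeumann Ω φ
  memLp_pd : ∀ j, MemLp (pd j φ) 2 (volume.restrict Ω)
  memLp_top_pd : ∀ j, MemLp (pd j φ) ⊤ (volume.restrict Ω)
  memLp_pd_pd : ∀ i j, MemLp (pd i (pd j φ)) 2 (volume.restrict Ω)
  memLp_top_pd_pd : ∀ i j, MemLp (pd i (pd j φ)) ⊤ (volume.restrict Ω)
  contDiffOn_density : ContDiffOn ℝ 1 ρ Ω
  memLp_top_density : MemLp ρ ⊤ (volume.restrict Ω)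
  memLp_density : MemLp (fun x => ρ x - 1) 2 (volume.restrict Ω)
  memLp_pd_density : ∀ j, MemLp (pd j ρ) 2 (volume.restrict Ω)
  hasWeakGrad : HasWeakGrad Ω (lap φ) κ
  memLp_grad : ∀ j, MemLp (κ j) 2 (volume.restrict Ω)

/-- An integrable function with vanishing integral. -/
def HasZeroIntegral (Ω : Set (Euc n)) (d : Euc n → ℝ) : Prop :=
  IntegrableOn d Ω ∧ ∫ x in Ω, d x = 0

theorem HasZeroIntegral.add (hf : HasZeroIntegral Ω f) (hg : HasZeroIntegral Ω g) :
    HasZeroIntegral Ω fun x => f x + g x :=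
  ⟨hf.1.add hg.1, by rw [integral_add hf.1 hg.1, hf.2, hg.2, add_zero]⟩

theorem HasZeroIntegral.const_mul (c : ℝ) (hf : HasZeroIntegral Ω f) :
    HasZeroIntegral Ω fun x => c * f x :=
  ⟨hf.1.const_mul c, by rw [integral_const_mul, hf.2, mul_zero]⟩

theorem IsNeumann.hasZeroIntegral (hf : IsNeumann Ω f) (hΩ : IsSmoothDomain Ω) {w : Euc n → ℝ}
    (hw : ContDiffOn ℝ 1 w Ω) (hb : BddNear Ω w)
    (hi : ∀ j, IntegrableOn (fun x => w x * pd j f x) Ω)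
    (hg : IntegrableOn (gd w f) Ω) (hl : IntegrableOn (fun x => w x * lap f x) Ω) :
    HasZeroIntegral Ω fun x => gd w f x + w x * lap f x :=
  ⟨hg.add hl, hf.integral_gd_add hΩ hw hb hi (hg.add hl)⟩

theorem integrableOn_congr (hΩ : IsOpen Ω) (hg : IntegrableOn g Ω) (h : EqOn f g Ω) :
    IntegrableOn f Ω :=
  hg.congr_fun h.symm hΩ.measurableSet

end Slices

/-! ### Divergences with vanishing integral -/

section SliceIdentities

variable {n : ℕ} {Ω : Set (Euc n)} {a b ρ φ : Euc n → ℝ} {κ : Fin n → Euc n → ℝ}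

/-- The integrand is the divergence of (∇a·∇φ)∇a, tangential because a satisfies the Neumann
condition. It is integrable since ∇a and ∇²a are in L² while ∇φ and ∇²φ are bounded. -/
theorem hasZeroIntegral_stress (hΩ : IsSmoothDomain Ω) (ha : WaveSlice Ω a)
    (hφ : FluidSlice Ω ρ φ κ) :
    HasZeroIntegral Ω fun x => gd (gd a φ) a x + gd a φ x * lap a x := by
  refine ha.neumann.hasZeroIntegral hΩ (contDiffOn_gd hΩ.isOpen ha.neumann.1 hφ.neumann.1)
    (.gd ha.neumann.3 hφ.neumann.3)
    (fun j => integrableOn_mul (memLp_gd ha.memLp_pd hφ.memLp_top_pd) (ha.memLp_pd j)) ?_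
    (integrableOn_mul (memLp_gd ha.memLp_pd hφ.memLp_top_pd) (memLp_lap ha.memLp_pd_pd))
  have : EqOn (gd (gd a φ) a) (fun x => hess a a φ x + hess φ a a x) Ω := fun x hx =>
    gd_gd hΩ.isOpen ha.neumann.1 hφ.neumann.1 hx a
  refine integrableOn_congr hΩ.isOpen (.add ?_
    (integrableOn_hess ha.memLp_pd ha.memLp_pd hφ.memLp_top_pd_pd)) this
  refine integrable_finsetSum _ fun j _ => integrable_finsetSum _ fun k _ => ?_
  exact integrableOn_mul (memLp_mul_bdd (ha.memLp_pd j) (hφ.memLp_top_pd k)) (ha.memLp_pd_pd j k)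

/-- The integrand is the divergence of |∇a|²∇φ, tangential because φ satisfies the Neumann
condition. -/
theorem hasZeroIntegral_energy (hΩ : IsSmoothDomain Ω) (ha : WaveSlice Ω a)
    (hφ : FluidSlice Ω ρ φ κ) :
    HasZeroIntegral Ω fun x => gd (gd a a) φ x + gd a a x * lap φ x := by
  have hi := integrableOn_gd ha.memLp_pd ha.memLp_pd
  refine hφ.neumann.hasZeroIntegral hΩ (contDiffOn_gd hΩ.isOpen ha.neumann.1 ha.neumann.1)
    (.gd ha.neumann.3 ha.neumann.3) (fun j => integrableOn_mul_bdd hi (hφ.memLp_top_pd j)) ?_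
    (integrableOn_mul_bdd hi (memLp_lap hφ.memLp_top_pd_pd))
  have : EqOn (gd (gd a a) φ) (fun x => hess a φ a x + hess a φ a x) Ω := fun x hx =>
    gd_gd hΩ.isOpen ha.neumann.1 ha.neumann.1 hx φ
  have h2 : IntegrableOn (hess a φ a) Ω :=
    integrable_finsetSum _ fun j _ => integrable_finsetSum _ fun k _ =>
      integrableOn_mul (memLp_bdd_mul (hφ.memLp_top_pd j) (ha.memLp_pd k)) (ha.memLp_pd_pd j k)
  exact integrableOn_congr hΩ.isOpen (h2.add h2) this

/-- The integrand is the divergence of Δφ·a∇a. This is the one place where ∇Δφ, with components κ,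
appears. It exists only weakly, so the weak Green formula is needed. -/
theorem hasZeroIntegral_quantum (hΩ : IsSmoothDomain Ω) (ha : WaveSlice Ω a)
    (hφ : FluidSlice Ω ρ φ κ) :
    HasZeroIntegral Ω fun x => ∑ j, κ j x * (a x * pd j a x) +
      lap φ x * (gd a a x + a x * lap a x) := by
  have hi : IntegrableOn (fun x => ∑ j, κ j x * (a x * pd j a x) +
      lap φ x * (gd a a x + a x * lap a x)) Ω := by
    refine .add (integrable_finsetSum _ fun j _ => integrableOn_mul (hφ.memLp_grad j)
      (memLp_bdd_mul ha.memLp_top (ha.memLp_pd j))) ?_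
    simp only [mul_add]
    refine .add (integrableOn_bdd_mul (memLp_lap hφ.memLp_top_pd_pd)
      (integrableOn_gd ha.memLp_pd ha.memLp_pd)) ?_
    exact integrableOn_mul (memLp_lap hφ.memLp_pd_pd)
      (memLp_bdd_mul ha.memLp_top (memLp_lap ha.memLp_pd_pd))
  have ha1 := ha.neumann.1.of_le one_le_two
  refine ⟨hi, ha.neumann.integral_weak hΩ hφ.hasWeakGrad ha1 ?_
    (bddNear_of_memLp_top hΩ.isOpen ha.memLp_top ha1.continuousOn)
    (fun j => integrableOn_mul (memLp_lap hφ.memLp_pd_pd)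
      (memLp_bdd_mul ha.memLp_top (ha.memLp_pd j))) hi⟩
  refine bddNear_of_memLp_top hΩ.isOpen (memLp_lap hφ.memLp_top_pd_pd) ?_
  exact continuousOn_finsetSum _ fun j _ =>
    continuousOn_pd hΩ.isOpen (contDiffOn_pd hΩ.isOpen hφ.neumann.1 j) j

/-- Functions of class `C¹` and bounded in `Ω`, with square integrable gradient. -/
structure BoundedC1 (Ω : Set (Euc n)) (w : Euc n → ℝ) : Prop where
  contDiffOn : ContDiffOn ℝ 1 w Ω
  memLp_top : MemLp w ⊤ (volume.restrict Ω)
  memLp_pd : ∀ j, MemLp (pd j w) 2 (volume.restrict Ω)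

theorem BoundedC1.bddNear (hΩ : IsOpen Ω) (h : BoundedC1 Ω a) : BddNear Ω a :=
  bddNear_of_memLp_top hΩ h.memLp_top h.contDiffOn.continuousOn

theorem memLp_congr (hΩ : IsOpen Ω) {f g : Euc n → ℝ} {p : ℝ≥0∞}
    (hg : MemLp g p (volume.restrict Ω)) (h : EqOn f g Ω) : MemLp f p (volume.restrict Ω) :=
  hg.ae_eq ((ae_restrict_mem hΩ.measurableSet).mono fun _ hx => (h hx).symm)

theorem BoundedC1.mul (hΩ : IsOpen Ω) (ha : BoundedC1 Ω a) (hb : BoundedC1 Ω b) :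
    BoundedC1 Ω fun x => a x * b x := by
  refine ⟨ha.1.mul hb.1, memLp_top_mul ha.2 hb.2, fun j => ?_⟩
  exact memLp_congr hΩ ((memLp_mul_bdd (ha.3 j) hb.2).add (memLp_bdd_mul ha.2 (hb.3 j)))
    fun x hx => pd_mul (differentiableAt_of_contDiffOn hΩ ha.1 hx)
      (differentiableAt_of_contDiffOn hΩ hb.1 hx)

theorem BoundedC1.add (hΩ : IsOpen Ω) (ha : BoundedC1 Ω a) (hb : BoundedC1 Ω b) :
    BoundedC1 Ω fun x => a x + b x := by
  refine ⟨ha.1.add hb.1, ha.2.add hb.2, fun j => ?_⟩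
  exact memLp_congr hΩ ((ha.3 j).add (hb.3 j))
    fun x hx => pd_add (differentiableAt_of_contDiffOn hΩ ha.1 hx)
      (differentiableAt_of_contDiffOn hΩ hb.1 hx)

theorem BoundedC1.const (c : ℝ) : BoundedC1 Ω fun _ => c :=
  ⟨contDiffOn_const, memLp_top_const c, fun j => by
    simp [show pd j (fun _ : Euc n => c) = fun _ => 0 from funext fun x => pd_const c j x]⟩

theorem BoundedC1.sub (hΩ : IsOpen Ω) (ha : BoundedC1 Ω a) (hb : BoundedC1 Ω b) :
    BoundedC1 Ω fun x => a x - b x := by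
  simpa [sub_eq_add_neg] using ha.add hΩ ((BoundedC1.const (-1)).mul hΩ hb)

theorem WaveSlice.boundedC1 (ha : WaveSlice Ω a) : BoundedC1 Ω a :=
  ⟨ha.neumann.1.of_le one_le_two, ha.memLp_top, ha.memLp_pd⟩

theorem FluidSlice.boundedC1 (h : FluidSlice Ω ρ φ κ) : BoundedC1 Ω ρ :=
  ⟨h.contDiffOn_density, h.memLp_top_density, h.memLp_pd_density⟩

theorem FluidSlice.boundedC1_gd (hΩ : IsOpen Ω) (h : FluidSlice Ω ρ φ κ) :
    BoundedC1 Ω (gd φ φ) := by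
  refine ⟨contDiffOn_gd hΩ h.neumann.1 h.neumann.1, memLp_top_gd h.memLp_top_pd h.memLp_top_pd,
    fun j => ?_⟩
  refine memLp_congr hΩ (memLp_finsetSum _ fun k _ => .add
    (memLp_mul_bdd (h.memLp_pd_pd j k) (h.memLp_top_pd k))
    (memLp_bdd_mul (h.memLp_top_pd k) (h.memLp_pd_pd j k))) fun x hx =>
    pd_gd hΩ h.neumann.1 h.neumann.1 hx j

/-- Green's formula for a bounded weight. -/
theorem hasZeroIntegral_of_bounded (hΩ : IsSmoothDomain Ω) {w f : Euc n → ℝ}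
    (hw : BoundedC1 Ω w) (hf : IsNeumann Ω f) (hf1 : ∀ j, MemLp (pd j f) 2 (volume.restrict Ω))
    (hi : ∀ j, IntegrableOn (fun x => w x * pd j f x) Ω)
    (hl : IntegrableOn (fun x => w x * lap f x) Ω) :
    HasZeroIntegral Ω fun x => gd w f x + w x * lap f x :=
  hf.hasZeroIntegral hΩ hw.1 (hw.bddNear hΩ.isOpen) hi (integrableOn_gd hw.3 hf1) hl

/-- Green's formula for a bounded square integrable weight. -/
theorem hasZeroIntegral_of_memLp (hΩ : IsSmoothDomain Ω) {w f : Euc n → ℝ}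
    (hw : BoundedC1 Ω w) (hw2 : MemLp w 2 (volume.restrict Ω)) (hf : IsNeumann Ω f)
    (hf1 : ∀ j, MemLp (pd j f) 2 (volume.restrict Ω))
    (hf2 : ∀ i j, MemLp (pd i (pd j f)) 2 (volume.restrict Ω)) :
    HasZeroIntegral Ω fun x => gd w f x + w x * lap f x :=
  hasZeroIntegral_of_bounded hΩ hw hf hf1 (fun j => integrableOn_mul hw2 (hf1 j))
    (integrableOn_mul hw2 (memLp_lap hf2))

end SliceIdentities

/-! ### The algebra of the modulated energy balance -/

section RateIdentity

variable {n : ℕ} {Ω : Set (Euc n)} {a b ρ φ : Euc n → ℝ} {κ : Fin n → Euc n → ℝ}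

/-- The integrand of the time derivative of the modulated energy, in terms of the time derivatives
`at'`, `bt'` of the real and imaginary part of the wave function. -/
def energyRate (ε : ℝ) (a b ρ φ at' bt' : Euc n → ℝ) (x : Euc n) : ℝ :=
  -(ε * at' x) * (ε * lap a x + (gd b φ x + b x * lap φ x)) -
    (ε * bt' x) * (ε * lap b x - (gd a φ x + a x * lap φ x)) +
    ∑ j, (bt' x * pd j φ x + b x * -(1 / 2 * pd j (gd φ φ) x + pd j ρ x)) *
      (ε * pd j a x + b x * pd j φ x) -
    ∑ j, (at' x * pd j φ x + a x * -(1 / 2 * pd j (gd φ φ) x + pd j ρ x)) *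
      (ε * pd j b x - a x * pd j φ x) +
    (a x ^ 2 + b x ^ 2 - ρ x) *
      (2 * a x * at' x + 2 * b x * bt' x + (gd ρ φ x + ρ x * lap φ x))

/-- The modulated energy flux after all integrations by parts. -/
def modulatedFlux (ε : ℝ) (a b ρ φ : Euc n → ℝ) (κ : Fin n → Euc n → ℝ) (x : Euc n) : ℝ :=
  -(∑ j, ∑ k, ((ε * pd j a x + b x * pd j φ x) * (ε * pd k a x + b x * pd k φ x) +
      (ε * pd j b x - a x * pd j φ x) * (ε * pd k b x - a x * pd k φ x)) * pd j (pd k φ) x) -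
    1 / 2 * (a x ^ 2 + b x ^ 2 - ρ x) ^ 2 * lap φ x -
    ε ^ 2 / 2 * ∑ j, κ j x * (a x * pd j a x + b x * pd j b x)

/-- The sum of all divergences which are dropped in the modulated energy balance. -/
def droppedDivergence (ε : ℝ) (a b ρ φ : Euc n → ℝ) (κ : Fin n → Euc n → ℝ) (x : Euc n) : ℝ :=
  ε ^ 2 * (gd (gd a φ) a x + gd a φ x * lap a x) +
  (ε ^ 2 * (gd (gd b φ) b x + gd b φ x * lap b x) +
  (-(ε ^ 2 / 2) * (gd (gd a a) φ x + gd a a x * lap φ x) +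
  (-(ε ^ 2 / 2) * (gd (gd b b) φ x + gd b b x * lap φ x) +
  (ε ^ 2 / 2 * (∑ j, κ j x * (a x * pd j a x) + lap φ x * (gd a a x + a x * lap a x)) +
  (ε ^ 2 / 2 * (∑ j, κ j x * (b x * pd j b x) + lap φ x * (gd b b x + b x * lap b x)) +
  (-(1 / 2) * (gd (fun y => (a y * a y + b y * b y - 1) * (a y * a y + b y * b y - 1)) φ x +
    (a x * a x + b x * b x - 1) * (a x * a x + b x * b x - 1) * lap φ x) +
  (-ε * (gd (fun y => a y * (1 / 2 * gd φ φ y - (ρ y - 1))) b x +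
    a x * (1 / 2 * gd φ φ x - (ρ x - 1)) * lap b x) +
  (ε * (gd (fun y => b y * (1 / 2 * gd φ φ y - (ρ y - 1))) a x +
    b x * (1 / 2 * gd φ φ x - (ρ x - 1)) * lap a x) +
  (-(1 / 2) * (gd (fun y => (ρ y - 1) * (ρ y + 1)) φ x +
    (ρ x - 1) * (ρ x + 1) * lap φ x))))))))))

/-- Each summand is a weight times a Neumann gradient, under a divergence. On an unbounded Ω only
|u|² − 1 and ρ − 1, not |u|² and ρ, are known to be square integrable. The lower-order weights are
therefore normalised to carry |u|² − 1, ½|∇φ|² − (ρ − 1), or ρ² − 1 = (ρ − 1)(ρ + 1). -/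
theorem hasZeroIntegral_droppedDivergence (hΩ : IsSmoothDomain Ω) (ε : ℝ) (ha : WaveSlice Ω a)
    (hb : WaveSlice Ω b) (hφ : FluidSlice Ω ρ φ κ)
    (hN : MemLp (fun x => a x ^ 2 + b x ^ 2 - 1) 2 (volume.restrict Ω)) :
    HasZeroIntegral Ω (droppedDivergence ε a b ρ φ κ) := by
  have ho := hΩ.isOpen
  have hN' : MemLp (fun x => a x * a x + b x * b x - 1) 2 (volume.restrict Ω) := by
    simpa only [pow_two] using hN
  have b1 : BoundedC1 Ω fun x => a x * a x + b x * b x - 1 :=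
    ((ha.boundedC1.mul ho ha.boundedC1).add ho (hb.boundedC1.mul ho hb.boundedC1)).sub ho (.const 1)
  have bρ : BoundedC1 Ω fun x => ρ x - 1 := hφ.boundedC1.sub ho (.const 1)
  have bp : BoundedC1 Ω fun x => 1 / 2 * gd φ φ x - (ρ x - 1) :=
    ((BoundedC1.const (1 / 2)).mul ho (hφ.boundedC1_gd ho)).sub ho bρ
  have hp : MemLp (fun x => 1 / 2 * gd φ φ x - (ρ x - 1)) 2 (volume.restrict Ω) :=
    ((memLp_gd hφ.memLp_pd hφ.memLp_top_pd).const_mul (1 / 2)).sub hφ.memLp_density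
  have d4 := hasZeroIntegral_of_memLp hΩ (b1.mul ho b1) (memLp_bdd_mul b1.2 hN') hφ.neumann
    hφ.memLp_pd hφ.memLp_pd_pd
  have d5 := hasZeroIntegral_of_memLp hΩ (ha.boundedC1.mul ho bp) (memLp_bdd_mul ha.memLp_top hp)
    hb.neumann hb.memLp_pd hb.memLp_pd_pd
  have d6 := hasZeroIntegral_of_memLp hΩ (hb.boundedC1.mul ho bp) (memLp_bdd_mul hb.memLp_top hp)
    ha.neumann ha.memLp_pd ha.memLp_pd_pd
  have b7 : BoundedC1 Ω fun x => ρ x + 1 := hφ.boundedC1.add ho (.const 1)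
  have d7 := hasZeroIntegral_of_memLp hΩ (bρ.mul ho b7) (memLp_mul_bdd hφ.memLp_density b7.2)
    hφ.neumann hφ.memLp_pd hφ.memLp_pd_pd
  exact ((hasZeroIntegral_stress hΩ ha hφ).const_mul _).add <|
    ((hasZeroIntegral_stress hΩ hb hφ).const_mul _).add <|
    ((hasZeroIntegral_energy hΩ ha hφ).const_mul _).add <|
    ((hasZeroIntegral_energy hΩ hb hφ).const_mul _).add <|
    ((hasZeroIntegral_quantum hΩ ha hφ).const_mul _).add <|
    ((hasZeroIntegral_quantum hΩ hb hφ).const_mul _).add <|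
    (d4.const_mul _).add <| (d5.const_mul _).add <| (d6.const_mul _).add (d7.const_mul _)

/-- Expands the quadratic forms D²φ(A,A) and D²φ(B,B). Symmetry of the Hessian merges the two mixed
terms of each. -/
theorem modulatedFlux_eq (hΩ : IsOpen Ω) (hφ : ContDiffOn ℝ 2 φ Ω) (ε : ℝ) {x : Euc n}
    (hx : x ∈ Ω) : modulatedFlux ε a b ρ φ κ x =
      -(ε ^ 2 * hess φ a a x + 2 * ε * b x * hess φ a φ x + b x ^ 2 * hess φ φ φ x +
        (ε ^ 2 * hess φ b b x - 2 * ε * a x * hess φ b φ x + a x ^ 2 * hess φ φ φ x)) -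
      1 / 2 * (a x ^ 2 + b x ^ 2 - ρ x) ^ 2 * lap φ x -
      ε ^ 2 / 2 * ∑ j, κ j x * (a x * pd j a x + b x * pd j b x) := by
  have e1 : 2 * ε * b x * hess φ a φ x = ε * b x * (hess φ a φ x + hess φ φ a x) := by
    rw [hess_comm hΩ hφ hx φ a]; ring
  have e2 : 2 * ε * a x * hess φ b φ x = ε * a x * (hess φ b φ x + hess φ φ b x) := by
    rw [hess_comm hΩ hφ hx φ b]; ring
  rw [modulatedFlux, e1, e2]
  congr 3
  simp only [hess, Finset.mul_sum, ← Finset.sum_add_distrib, ← Finset.sum_sub_distrib]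
  exact Finset.sum_congr rfl fun j _ => Finset.sum_congr rfl fun k _ => by ring

/-- Replaces coordinate sums by `gd` and `hess`, using ½∇|∇φ|²·∇f = D²φ(∇f,∇φ). The balance then
becomes a polynomial identity in these quantities. -/
theorem energyRate_eq (hΩ : IsOpen Ω) (hφ : ContDiffOn ℝ 2 φ Ω) (ε : ℝ) {at' bt' : Euc n → ℝ}
    {x : Euc n} (hx : x ∈ Ω) : energyRate ε a b ρ φ at' bt' x =
      -(ε * at' x) * (ε * lap a x + (gd b φ x + b x * lap φ x)) -
      (ε * bt' x) * (ε * lap b x - (gd a φ x + a x * lap φ x)) +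
      (bt' x * (ε * gd a φ x + b x * gd φ φ x) -
        b x * (ε * (hess φ a φ x + gd ρ a x) + b x * (hess φ φ φ x + gd ρ φ x))) -
      (at' x * (ε * gd b φ x - a x * gd φ φ x) -
        a x * (ε * (hess φ b φ x + gd ρ b x) - a x * (hess φ φ φ x + gd ρ φ x))) +
      (a x ^ 2 + b x ^ 2 - ρ x) *
        (2 * a x * at' x + 2 * b x * bt' x + (gd ρ φ x + ρ x * lap φ x)) := by
  have hh : ∀ f : Euc n → ℝ, hess φ f φ x = 1 / 2 * gd (gd φ φ) f x := fun f => by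
    rw [gd_gd hΩ hφ hφ hx f]; ring
  rw [energyRate]
  congr 1
  congr 1
  · congr 1
    simp only [hh, gd, Finset.mul_sum, ← Finset.sum_add_distrib, ← Finset.sum_sub_distrib]
    exact Finset.sum_congr rfl fun j _ => by ring
  · simp only [hh, gd, Finset.mul_sum, ← Finset.sum_add_distrib, ← Finset.sum_sub_distrib]
    exact Finset.sum_congr rfl fun j _ => by ring

theorem droppedDivergence_eq (hΩ : IsOpen Ω) (ε : ℝ) (ha : ContDiffOn ℝ 2 a Ω)
    (hb : ContDiffOn ℝ 2 b Ω) (hφ : ContDiffOn ℝ 2 φ Ω) (hρ : ContDiffOn ℝ 1 ρ Ω) {x : Euc n}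
    (hx : x ∈ Ω) : droppedDivergence ε a b ρ φ κ x =
      ε ^ 2 * (hess φ a a x + gd a φ x * lap a x - 1 / 2 * gd a a x * lap φ x) +
      ε ^ 2 * (hess φ b b x + gd b φ x * lap b x - 1 / 2 * gd b b x * lap φ x) +
      ε ^ 2 / 2 * (∑ j, κ j x * (a x * pd j a x + b x * pd j b x) +
        lap φ x * (gd a a x + a x * lap a x + gd b b x + b x * lap b x)) -
      (2 * (a x ^ 2 + b x ^ 2 - 1) * (a x * gd a φ x + b x * gd b φ x) +
        1 / 2 * (a x ^ 2 + b x ^ 2 - 1) ^ 2 * lap φ x) -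
      ε * (a x * (hess φ b φ x - gd ρ b x) - b x * (hess φ a φ x - gd ρ a x) +
        (1 / 2 * gd φ φ x - (ρ x - 1)) * (a x * lap b x - b x * lap a x)) -
      (ρ x * gd ρ φ x + 1 / 2 * (ρ x ^ 2 - 1) * lap φ x) := by
  have da := differentiableAt_of_contDiffOn hΩ (ha.of_le one_le_two) hx
  have db := differentiableAt_of_contDiffOn hΩ (hb.of_le one_le_two) hx
  have dρ := differentiableAt_of_contDiffOn hΩ hρ hx
  have dg := differentiableAt_of_contDiffOn hΩ (contDiffOn_gd hΩ hφ hφ) hx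
  have dN : DifferentiableAt ℝ (fun y => a y * a y + b y * b y - 1) x :=
    ((da.mul da).add (db.mul db)).sub_const 1
  have dp : DifferentiableAt ℝ (fun y => 1 / 2 * gd φ φ y - (ρ y - 1)) x :=
    (dg.const_mul _).sub (dρ.sub_const 1)
  have eN : gd (fun y => a y * a y + b y * b y - 1) φ x =
      2 * (a x * gd a φ x + b x * gd b φ x) := by
    rw [gd_sub_left (f := fun y => a y * a y + b y * b y) ((da.mul da).add (db.mul db))
      (differentiableAt_const 1), gd_const_left,
      gd_add_left (f := fun y => a y * a y) (g := fun y => b y * b y) (da.mul da) (db.mul db),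
      gd_mul_left da da, gd_mul_left db db]
    ring
  have eρ : ∀ h, gd (fun y => ρ y - 1) h x = gd ρ h x := fun h => by
    rw [gd_sub_left dρ (differentiableAt_const 1), gd_const_left, sub_zero]
  have ep : ∀ h, gd (fun y => 1 / 2 * gd φ φ y - (ρ y - 1)) h x = hess φ h φ x - gd ρ h x := by
    intro h
    rw [gd_sub_left (dg.const_mul _) (dρ.sub_const 1), gd_const_mul_left _ dg, eρ,
      gd_gd hΩ hφ hφ hx]
    ring
  have eρ2 : gd (fun y => (ρ y - 1) * (ρ y + 1)) φ x = 2 * ρ x * gd ρ φ x := by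
    rw [gd_mul_left (dρ.sub_const 1) (dρ.add_const 1), eρ, gd_add_left dρ
      (differentiableAt_const 1), gd_const_left]
    ring
  have esum : ∑ j, κ j x * (a x * pd j a x + b x * pd j b x) =
      ∑ j, κ j x * (a x * pd j a x) + ∑ j, κ j x * (b x * pd j b x) := by
    simp only [mul_add, Finset.sum_add_distrib]
  rw [droppedDivergence, gd_gd hΩ ha hφ hx, gd_gd hΩ hb hφ hx, gd_gd hΩ ha ha hx,
    gd_gd hΩ hb hb hx, gd_mul_left dN dN, eN, gd_mul_left da dp, gd_mul_left db dp, ep, ep, eρ2,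
    hess_comm hΩ ha hx a φ, hess_comm hΩ hb hx b φ, gd_comm b a, esum]
  ring

/-- The pointwise modulated energy balance. -/
theorem energyRate_eq_add (hΩ : IsOpen Ω) {ε : ℝ} (hε : ε ≠ 0) (ha : ContDiffOn ℝ 2 a Ω)
    (hb : ContDiffOn ℝ 2 b Ω) (hφ : ContDiffOn ℝ 2 φ Ω) (hρ : ContDiffOn ℝ 1 ρ Ω)
    {at' bt' : Euc n → ℝ} {x : Euc n} (hx : x ∈ Ω)
    (hat : ε * at' x = -(ε ^ 2 / 2 * lap b x) + (a x ^ 2 + b x ^ 2 - 1) * b x)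
    (hbt : ε * bt' x = ε ^ 2 / 2 * lap a x - (a x ^ 2 + b x ^ 2 - 1) * a x) :
    energyRate ε a b ρ φ at' bt' x =
      modulatedFlux ε a b ρ φ κ x + droppedDivergence ε a b ρ φ κ x := by
  -- This is mass conservation for |u|²/2. The nonlinear terms cancel, which removes the singular
  -- factor 1/ε.
  have hN : a x * at' x + b x * bt' x = -(ε / 2) * (a x * lap b x - b x * lap a x) := by
    apply mul_left_cancel₀ hε
    linear_combination a x * hat + b x * hbt
  rw [energyRate_eq hΩ hφ ε hx, modulatedFlux_eq hΩ hφ ε hx,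
    droppedDivergence_eq hΩ ε ha hb hφ hρ hx]
  -- The coefficients of `hat` and `hbt` are those of ε∂ₜa and ε∂ₜb in the rate. The remaining time
  -- derivatives occur only through a∂ₜa + b∂ₜb, once with |∇φ|² and once with 2q, and are
  -- eliminated by `hN`.
  linear_combination (-(ε * lap a x + (gd b φ x + b x * lap φ x)) - gd b φ x) * hat +
    (-(ε * lap b x - (gd a φ x + a x * lap φ x)) + gd a φ x) * hbt +
    (gd φ φ x + 2 * (a x ^ 2 + b x ^ 2 - ρ x)) * hN

theorem integrableOn_modulatedFlux (ε : ℝ) (ha : WaveSlice Ω a)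
    (hb : WaveSlice Ω b) (hφ : FluidSlice Ω ρ φ κ)
    (hN : MemLp (fun x => a x ^ 2 + b x ^ 2 - 1) 2 (volume.restrict Ω)) :
    IntegrableOn (modulatedFlux ε a b ρ φ κ) Ω := by
  have hA : ∀ j, MemLp (fun x => ε * pd j a x + b x * pd j φ x) 2 (volume.restrict Ω) :=
    fun j => ((ha.memLp_pd j).const_mul ε).add (memLp_bdd_mul hb.memLp_top (hφ.memLp_pd j))
  have hB : ∀ j, MemLp (fun x => ε * pd j b x - a x * pd j φ x) 2 (volume.restrict Ω) :=
    fun j => ((hb.memLp_pd j).const_mul ε).sub (memLp_bdd_mul ha.memLp_top (hφ.memLp_pd j))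
  have hq : MemLp (fun x => a x ^ 2 + b x ^ 2 - ρ x) 2 (volume.restrict Ω) :=
    (hN.sub hφ.memLp_density).ae_eq (Eventually.of_forall fun x => by simp)
  refine .sub (.sub (Integrable.neg (integrable_finsetSum _ fun j _ => integrable_finsetSum _
    fun k _ => integrableOn_mul_bdd (.add ?_ ?_) (hφ.memLp_top_pd_pd j k))) ?_)
    (Integrable.const_mul (integrable_finsetSum _ fun j _ => integrableOn_mul (hφ.memLp_grad j)
      ((memLp_bdd_mul ha.memLp_top (ha.memLp_pd j)).add
      (memLp_bdd_mul hb.memLp_top (hb.memLp_pd j)))) _)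
  · exact integrableOn_mul (hA j) (hA k)
  · exact integrableOn_mul (hB j) (hB k)
  · refine integrableOn_mul_bdd (Integrable.const_mul ?_ _) (memLp_lap hφ.memLp_top_pd_pd)
    simpa only [pow_two, IntegrableOn] using integrableOn_mul hq hq

theorem integral_energyRate (hΩ : IsSmoothDomain Ω) {ε : ℝ} (hε : ε ≠ 0) (ha : WaveSlice Ω a)
    (hb : WaveSlice Ω b) (hφ : FluidSlice Ω ρ φ κ)
    (hN : MemLp (fun x => a x ^ 2 + b x ^ 2 - 1) 2 (volume.restrict Ω)) {at' bt' : Euc n → ℝ}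
    (hat : ∀ x ∈ Ω, ε * at' x = -(ε ^ 2 / 2 * lap b x) + (a x ^ 2 + b x ^ 2 - 1) * b x)
    (hbt : ∀ x ∈ Ω, ε * bt' x = ε ^ 2 / 2 * lap a x - (a x ^ 2 + b x ^ 2 - 1) * a x) :
    ∫ x in Ω, energyRate ε a b ρ φ at' bt' x = ∫ x in Ω, modulatedFlux ε a b ρ φ κ x := by
  have hd := hasZeroIntegral_droppedDivergence hΩ ε ha hb hφ hN
  rw [setIntegral_congr_fun hΩ.isOpen.measurableSet fun x hx =>
    energyRate_eq_add (κ := κ) hΩ.isOpen hε ha.neumann.1 hb.neumann.1 hφ.neumann.1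
      hφ.contDiffOn_density hx (hat x hx) (hbt x hx),
    integral_add (integrableOn_modulatedFlux ε ha hb hφ hN) hd.1, hd.2, add_zero]

end RateIdentity

/-! ### Time derivatives in L² and their interchange with the gradient -/

section TimeDerivatives

variable {n : ℕ} {Ω : Set (Euc n)} {T : ℝ}

/-- Cauchy–Schwarz on an interval of length |s − t|, divided by |s − t|². The unordered interval
covers both signs of s − t. -/
theorem enorm_intervalIntegral_sq_le {h : ℝ → ℝ} {s t : ℝ} (hst : s ≠ t)
    (hm : AEStronglyMeasurable h (volume.restrict (uIoc t s))) :
    ‖(s - t)⁻¹ * ∫ τ in t..s, h τ‖ₑ ^ (2 : ℝ) ≤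
      ENNReal.ofReal |s - t|⁻¹ * ∫⁻ τ in uIoc t s, ‖h τ‖ₑ ^ (2 : ℝ) := by
  have hpos : 0 < |s - t| := abs_pos.2 (sub_ne_zero.2 hst)
  set ν := volume.restrict (uIoc t s)
  have h1 : ‖∫ τ in t..s, h τ‖ₑ ≤ eLpNorm h 1 ν := by
    rw [eLpNorm_one_eq_lintegral_enorm]
    rcases le_total t s with hle | hle
    · rw [intervalIntegral.integral_of_le hle, ← uIoc_of_le hle]
      exact enorm_integral_le_lintegral_enorm _
    · rw [intervalIntegral.integral_of_ge hle, enorm_neg, ← uIoc_of_ge hle]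
      exact enorm_integral_le_lintegral_enorm _
  have hν : ν univ = ENNReal.ofReal |s - t| := by
    simp [ν, Real.volume_uIoc]
  have h2 := eLpNorm_le_eLpNorm_mul_rpow_measure_univ (p := 1) (q := 2) one_le_two hm
  have h3 : eLpNorm h 2 ν ^ (2 : ℝ) = ∫⁻ τ, ‖h τ‖ₑ ^ (2 : ℝ) ∂ν := by
    have := eLpNorm_nnreal_pow_eq_lintegral (f := h) (μ := ν) (p := 2) two_ne_zero
    simpa using this
  rw [enorm_mul, ENNReal.mul_rpow_of_nonneg _ _ zero_le_two]
  calc ‖(s - t)⁻¹‖ₑ ^ (2 : ℝ) * ‖∫ τ in t..s, h τ‖ₑ ^ (2 : ℝ)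
      ≤ ENNReal.ofReal |s - t|⁻¹ ^ (2 : ℝ) *
        (eLpNorm h 2 ν * ENNReal.ofReal |s - t| ^ (1 / 2 : ℝ)) ^ (2 : ℝ) := by
        gcongr
        · rw [← ofReal_norm, norm_inv, Real.norm_eq_abs]
        · refine h1.trans (h2.trans (le_of_eq ?_))
          rw [hν]
          norm_num
    _ = ENNReal.ofReal |s - t|⁻¹ ^ (2 : ℝ) * ENNReal.ofReal |s - t| *
        ∫⁻ τ, ‖h τ‖ₑ ^ (2 : ℝ) ∂ν := by
        rw [ENNReal.mul_rpow_of_nonneg _ _ zero_le_two, h3, ← ENNReal.rpow_mul]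
        norm_num
        ring
    _ = _ := by
        congr 1
        rw [ENNReal.rpow_two, pow_two, mul_assoc, ← ENNReal.ofReal_mul (by positivity),
          inv_mul_cancel₀ hpos.ne', ENNReal.ofReal_one, mul_one]

/-- Pointwise time derivatives which depend continuously on time in `L²` are time derivatives in
`L²`. -/
theorem lpTendsto_slope (hΩ : IsOpen Ω) {f g : ℝ → Euc n → ℝ}
    (hg : ContinuousOn (fun q : ℝ × Euc n => g q.1 q.2) (Ioo 0 T ×ˢ Ω))
    (hd : ∀ t ∈ Ioo 0 T, ∀ x ∈ Ω, HasDerivAt (fun s => f s x) (g t x) t)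
    (hL : ContInLp T Ω 2 g)
    (hm : ∀ t ∈ Ioo 0 T, AEStronglyMeasurable (f t) (volume.restrict Ω)) {t : ℝ}
    (ht : t ∈ Ioo 0 T) :
    LpTendsto (𝓝[≠] t) 2 (volume.restrict Ω) (fun s x => (s - t)⁻¹ * (f s x - f t x)) (g t) := by
  have key : ∀ θ : ℝ≥0∞, 0 < θ → ∀ᶠ s in 𝓝[≠] t, eLpNorm ((fun x => (s - t)⁻¹ * (f s x - f t x)) -
      g t) 2 (volume.restrict Ω) ≤ θ := by
    intro θ hθ
    have h1 : ∀ᶠ s in 𝓝 t, s ∈ Ioo 0 T ∧ eLpNorm (g s - g t) 2 (volume.restrict Ω) ≤ θ := by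
      have e1 := (ENNReal.tendsto_nhds_zero.1 (hL.2 t (Ioo_subset_Icc_self ht))) θ hθ
      rw [nhdsWithin_eq_nhds.2 (Icc_mem_nhds ht.1 ht.2)] at e1
      have e0 : ∀ᶠ s in 𝓝 t, s ∈ Ioo 0 T := Ioo_mem_nhds ht.1 ht.2
      exact e0.and e1
    obtain ⟨δ, hδ, hball⟩ := Metric.eventually_nhds_iff_ball.1 h1
    filter_upwards [nhdsWithin_le_nhds (Metric.ball_mem_nhds t hδ), self_mem_nhdsWithin]
      with s hs hst
    have hst : s ≠ t := hst
    have hpos : 0 < |s - t| := abs_pos.2 (sub_ne_zero.2 hst)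
    have hsub : uIcc t s ⊆ Metric.ball t δ := by
      rw [Real.ball_eq_Ioo] at hs ⊢
      exact ordConnected_Ioo.uIcc_subset (by constructor <;> linarith) hs
    have hsubI : uIcc t s ⊆ Ioo 0 T := fun τ hτ => (hball τ (hsub hτ)).1
    have hcx : ∀ x ∈ Ω, ContinuousOn (fun τ => g τ x) (uIcc t s) := fun x hx =>
      hg.comp (f := fun τ => (τ, x)) (by fun_prop) fun τ hτ => ⟨hsubI hτ, hx⟩
    -- The difference quotient minus g(t) is the time average of g(τ) − g(t). Squaring by
    -- Cauchy–Schwarz and exchanging the integrals bounds its L² norm by the supremum of ‖g(τ) −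
    -- g(t)‖ over times near t. That supremum is at most θ by the choice of the ball.
    have pointwise : ∀ x ∈ Ω, ‖((fun x => (s - t)⁻¹ * (f s x - f t x)) - g t) x‖ₑ ^ (2 : ℝ) ≤
        ENNReal.ofReal |s - t|⁻¹ * ∫⁻ τ in uIoc t s, ‖g τ x - g t x‖ₑ ^ (2 : ℝ) := by
      intro x hx
      have hint : IntervalIntegrable (fun τ => g τ x) volume t s :=
        (hcx x hx).intervalIntegrable
      have e1 : ((fun x => (s - t)⁻¹ * (f s x - f t x)) - g t) x =
          (s - t)⁻¹ * ∫ τ in t..s, (g τ x - g t x) := by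
        rw [intervalIntegral.integral_sub hint intervalIntegrable_const,
          intervalIntegral.integral_eq_sub_of_hasDerivAt (fun τ hτ => hd τ (hsubI hτ) x hx) hint,
          intervalIntegral.integral_const, smul_eq_mul, mul_sub, ← mul_assoc,
          inv_mul_cancel₀ (sub_ne_zero.2 hst), one_mul]
        rfl
      rw [e1]
      exact enorm_intervalIntegral_sq_le hst ((((hcx x hx).mono uIoc_subset_uIcc).sub
        continuousOn_const).aestronglyMeasurable measurableSet_uIoc)
    have hpow : ∀ w : Euc n → ℝ, eLpNorm w 2 (volume.restrict Ω) ^ (2 : ℝ) =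
        ∫⁻ x in Ω, ‖w x‖ₑ ^ (2 : ℝ) := fun w => by
      have := eLpNorm_nnreal_pow_eq_lintegral (f := w) (μ := volume.restrict Ω) (p := 2)
        two_ne_zero
      simpa using this
    rw [← ENNReal.rpow_le_rpow_iff (z := 2) two_pos, hpow]
    calc ∫⁻ x in Ω, ‖((fun x => (s - t)⁻¹ * (f s x - f t x)) - g t) x‖ₑ ^ (2 : ℝ)
        ≤ ∫⁻ x in Ω, ENNReal.ofReal |s - t|⁻¹ *
            ∫⁻ τ in uIoc t s, ‖g τ x - g t x‖ₑ ^ (2 : ℝ) :=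
          lintegral_mono_ae ((ae_restrict_mem hΩ.measurableSet).mono pointwise)
      _ = ENNReal.ofReal |s - t|⁻¹ *
            ∫⁻ x in Ω, ∫⁻ τ in uIoc t s, ‖g τ x - g t x‖ₑ ^ (2 : ℝ) :=
          lintegral_const_mul' _ _ ENNReal.ofReal_ne_top
      _ = ENNReal.ofReal |s - t|⁻¹ *
            ∫⁻ τ in uIoc t s, ∫⁻ x in Ω, ‖g τ x - g t x‖ₑ ^ (2 : ℝ) := by
          congr 1
          refine lintegral_lintegral_swap ?_
          have c1 : ContinuousOn (fun q : Euc n × ℝ => g q.2 q.1 - g t q.1) (Ω ×ˢ uIoc t s) := by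
            refine .sub (hg.comp (f := fun q : Euc n × ℝ => (q.2, q.1)) (by fun_prop) fun q hq =>
              ⟨hsubI (uIoc_subset_uIcc hq.2), hq.1⟩) (hg.comp (f := fun q : Euc n × ℝ => (t, q.1))
              (by fun_prop) fun q hq => ⟨ht, hq.1⟩)
          have c2 := c1.aemeasurable (μ := volume.prod volume)
            (hΩ.measurableSet.prod measurableSet_uIoc)
          rw [← Measure.prod_restrict] at c2
          exact c2.enorm.pow_const _
      _ ≤ ENNReal.ofReal |s - t|⁻¹ * ∫⁻ _ in uIoc t s, θ ^ (2 : ℝ) := by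
          refine mul_le_mul_right ?_ _
          refine setLIntegral_mono measurable_const fun τ hτ => ?_
          have := (hball τ (hsub (uIoc_subset_uIcc hτ))).2
          rw [← ENNReal.rpow_le_rpow_iff (z := 2) two_pos, hpow] at this
          exact this
      _ = θ ^ (2 : ℝ) := by
          rw [setLIntegral_const, Real.volume_uIoc, mul_left_comm,
            ← ENNReal.ofReal_mul (by positivity), inv_mul_cancel₀ hpos.ne', ENNReal.ofReal_one,
            mul_one]
  have hgt := hL.1 t (Ioo_subset_Icc_self ht)
  refine ⟨?_, hgt, ENNReal.tendsto_nhds_zero.2 key⟩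
  filter_upwards [key 1 one_pos, nhdsWithin_le_nhds (Ioo_mem_nhds ht.1 ht.2)] with s hs hsI
  have hmeas : AEStronglyMeasurable (fun x => (s - t)⁻¹ * (f s x - f t x))
      (volume.restrict Ω) := ((hm s hsI).sub (hm t ht)).const_mul _
  have : MemLp ((fun x => (s - t)⁻¹ * (f s x - f t x)) - g t) 2 (volume.restrict Ω) :=
    ⟨hmeas.sub hgt.1, hs.trans_lt ENNReal.one_lt_top⟩
  simpa using this.add hgt

/-- Time derivative and spatial gradient commute when the time derivative has a continuous spatial
gradient. -/
theorem hasDerivAt_fderiv (hΩ : IsOpen Ω) {φ f : ℝ → Euc n → ℝ}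
    (hd : ∀ t ∈ Ioo 0 T, ∀ x ∈ Ω, HasDerivAt (fun s => φ s x) (f t x) t)
    (hφ : ∀ t ∈ Ioo 0 T, DifferentiableOn ℝ (φ t) Ω)
    (hf : ∀ t ∈ Ioo 0 T, DifferentiableOn ℝ (f t) Ω)
    (hc : ContinuousOn (fun q : ℝ × Euc n => fderiv ℝ (f q.1) q.2) (Ioo 0 T ×ˢ Ω))
    {t : ℝ} (ht : t ∈ Ioo 0 T) {x : Euc n} (hx : x ∈ Ω) :
    HasDerivAt (fun s => fderiv ℝ (φ s) x) (fderiv ℝ (f t) x) t := by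
  rw [hasDerivAt_iff_isLittleO, Asymptotics.isLittleO_iff]
  intro ε hε
  have hcx : ContinuousAt (fun q : ℝ × Euc n => fderiv ℝ (f q.1) q.2) (t, x) :=
    hc.continuousAt ((isOpen_Ioo.prod hΩ).mem_nhds ⟨ht, hx⟩)
  obtain ⟨δ, hδ, hball⟩ := Metric.eventually_nhds_iff_ball.1
    ((Metric.tendsto_nhds.1 hcx ε hε).and ((isOpen_Ioo.prod hΩ).mem_nhds ⟨ht, hx⟩ :
      ∀ᶠ q in 𝓝 (t, x), q ∈ Ioo 0 T ×ˢ Ω))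
  rw [← ball_prod_same] at hball
  filter_upwards [Metric.ball_mem_nhds t hδ] with s hs
  set L := fderiv ℝ (f t) x
  have hsub : uIcc t s ⊆ Metric.ball t δ := by
    rw [Real.ball_eq_Ioo] at hs ⊢
    exact ordConnected_Ioo.uIcc_subset (by constructor <;> linarith) hs
  have hxb := Metric.mem_ball_self (x := x) hδ
  have hsT := (hball (s, x) ⟨hs, hxb⟩).2.1
  -- A mean value inequality in space, uniform in σ, bounds the remainder of f. The next one, in
  -- time, integrates it to a bound on the mixed second difference of φ with the factor |s − t|·‖y −
  -- x‖.
  have space : ∀ σ ∈ Metric.ball t δ, ∀ y ∈ Metric.ball x δ,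
      ‖f σ y - f σ x - L (y - x)‖ ≤ ε * ‖y - x‖ := by
    intro σ hσ y hy
    refine (convex_ball x δ).norm_image_sub_le_of_norm_hasFDerivWithin_le'
      (f' := fun z => fderiv ℝ (f σ) z) (fun z hz => ?_) (fun z hz => ?_) hxb hy
    · obtain ⟨h1, h2⟩ := (hball (σ, z) ⟨hσ, hz⟩).2
      exact ((hf σ h1 z h2).differentiableAt (hΩ.mem_nhds h2)).hasFDerivAt.hasFDerivWithinAt
    · have := (hball (σ, z) ⟨hσ, hz⟩).1
      rw [dist_eq_norm] at this
      exact this.le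
  have time : ∀ y ∈ Metric.ball x δ,
      ‖(φ s y - φ t y - (s - t) * L y) - (φ s x - φ t x - (s - t) * L x)‖ ≤
        ε * |s - t| * ‖y - x‖ := by
    intro y hy
    have := (convex_uIcc t s).norm_image_sub_le_of_norm_hasDerivWithin_le
      (f := fun σ => φ σ y - φ σ x - σ * L (y - x)) (f' := fun σ => f σ y - f σ x - L (y - x))
      (C := ε * ‖y - x‖) (fun σ hσ => ?_) (fun σ hσ => space σ (hsub hσ) y hy)
      left_mem_uIcc right_mem_uIcc
    · rw [Real.norm_eq_abs (s - t)] at this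
      calc _ = ‖φ s y - φ s x - s * L (y - x) - (φ t y - φ t x - t * L (y - x))‖ := by
            rw [map_sub]; congr 1; ring
        _ ≤ ε * ‖y - x‖ * |s - t| := this
        _ = _ := by ring
    · have h1 := (hball (σ, y) ⟨hsub hσ, hy⟩).2
      have := ((hd σ h1.1 y h1.2).sub (hd σ h1.1 x hx)).sub
        ((hasDerivAt_id σ).mul_const (L (y - x)))
      rw [one_mul] at this
      exact this.hasDerivWithinAt
  have hD : HasFDerivAt (fun y => φ s y - φ t y - (s - t) * L y)
      (fderiv ℝ (φ s) x - fderiv ℝ (φ t) x - (s - t) • L) x :=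
    ((((hφ s hsT x hx).differentiableAt (hΩ.mem_nhds hx)).hasFDerivAt.sub
      ((hφ t ht x hx).differentiableAt (hΩ.mem_nhds hx)).hasFDerivAt)).sub
      (L.hasFDerivAt.const_mul (s - t))
  rw [Real.norm_eq_abs]
  -- A Lipschitz bound at x, with constant ε|s − t|, passes to the derivative in y. This is exactly
  -- the little-o estimate for the spatial gradient.
  refine hD.le_of_lip' (by positivity) ?_
  filter_upwards [Metric.ball_mem_nhds x hδ] with y hy using time y hy

end TimeDerivatives

/-! ### Space-time regularity, and difference quotients of the energy -/

section Flows

variable {n : ℕ} {Ω : Set (Euc n)} {T ε : ℝ}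

/-- The space-time regularity of the real or imaginary part of the wave function. -/
structure WaveFlow (T : ℝ) (Ω : Set (Euc n)) (a : ℝ → Euc n → ℝ) : Prop where
  slice : ∀ t ∈ Ioo 0 T, WaveSlice Ω (a t)
  contInLp_top : ContInLp T Ω ⊤ a
  contInLp_pd : ∀ j, ContInLp T Ω 2 fun t => pd j (a t)
  contInLp_pd_pd : ∀ i j, ContInLp T Ω 2 fun t => pd i (pd j (a t))
  continuousOn : ContinuousOn (fun q : ℝ × Euc n => a q.1 q.2) (Icc 0 T ×ˢ Ω)
  continuousOn_pd_pd : ∀ i j,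
    ContinuousOn (fun q : ℝ × Euc n => pd i (pd j (a q.1)) q.2) (Icc 0 T ×ˢ Ω)

/-- The time derivative of the velocity component `∂_j φ`. -/
def velocityRate (ρ φ : Euc n → ℝ) (j : Fin n) (x : Euc n) : ℝ :=
  -(1 / 2 * pd j (gd φ φ) x + pd j ρ x)

/-- The Euler equation in coordinates, with the space-time regularity of its solution. -/
structure FluidFlow (T : ℝ) (Ω : Set (Euc n)) (ρ φ : ℝ → Euc n → ℝ)
    (κ : ℝ → Fin n → Euc n → ℝ) : Prop where
  slice : ∀ t ∈ Ioo 0 T, FluidSlice Ω (ρ t) (φ t) (κ t)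
  contDiffOn : ∀ t ∈ Icc 0 T, ContDiffOn ℝ 2 (φ t) Ω
  contInLp_pd : ∀ j, ContInLp T Ω 2 fun t => pd j (φ t)
  contInLp_top_pd : ∀ j, ContInLp T Ω ⊤ fun t => pd j (φ t)
  contInLp_pd_pd : ∀ i j, ContInLp T Ω 2 fun t => pd i (pd j (φ t))
  contInLp_top_pd_pd : ∀ i j, ContInLp T Ω ⊤ fun t => pd i (pd j (φ t))
  contInLp_top_density : ContInLp T Ω ⊤ ρ
  contInLp_density : ContInLp T Ω 2 fun t x => ρ t x - 1
  contInLp_pd_density : ∀ j, ContInLp T Ω 2 fun t => pd j (ρ t)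
  contInLp_grad : ∀ j, ContInLp T Ω 2 fun t => κ t j
  contInLp_top_grad : ∀ j, ContInLp T Ω ⊤ fun t => κ t j
  continuousOn_pd : ∀ j, ContinuousOn (fun q : ℝ × Euc n => pd j (φ q.1) q.2) (Icc 0 T ×ˢ Ω)
  continuousOn_pd_pd : ∀ i j,
    ContinuousOn (fun q : ℝ × Euc n => pd i (pd j (φ q.1)) q.2) (Icc 0 T ×ˢ Ω)
  continuousOn_density : ContinuousOn (fun q : ℝ × Euc n => ρ q.1 q.2) (Icc 0 T ×ˢ Ω)
  continuousOn_pd_density : ∀ j,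
    ContinuousOn (fun q : ℝ × Euc n => pd j (ρ q.1) q.2) (Icc 0 T ×ˢ Ω)
  hasDerivAt_pd : ∀ t ∈ Ioo 0 T, ∀ x ∈ Ω, ∀ j,
    HasDerivAt (fun s => pd j (φ s) x) (velocityRate (ρ t) (φ t) j x) t
  hasDerivAt_density : ∀ t ∈ Ioo 0 T, ∀ x ∈ Ω,
    HasDerivAt (fun s => ρ s x) (-(gd (ρ t) (φ t) x + ρ t x * lap (φ t) x)) t

theorem ContInLp.lpTendsto_punctured {F : Type*} [NormedAddCommGroup F] {p : ℝ≥0∞}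
    {f : ℝ → Euc n → F} (h : ContInLp T Ω p f) {t : ℝ} (ht : t ∈ Ioo 0 T) :
    LpTendsto (𝓝[≠] t) p (volume.restrict Ω) f (f t) := by
  have h1 := h.2 t (Ioo_subset_Icc_self ht)
  rw [nhdsWithin_eq_nhds.2 (Icc_mem_nhds ht.1 ht.2)] at h1
  exact ⟨nhdsWithin_le_nhds (mem_of_superset (Icc_mem_nhds ht.1 ht.2) fun s hs => h.1 s hs),
    h.1 t (Ioo_subset_Icc_self ht), h1.mono_left nhdsWithin_le_nhds⟩

/-- The slope of the time-dependent function `f` converges in `L²` to `f'`. -/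
abbrev HasSlope (Ω : Set (Euc n)) (f : ℝ → Euc n → ℝ) (f' : Euc n → ℝ) (t : ℝ) : Prop :=
  LpTendsto (𝓝[≠] t) 2 (volume.restrict Ω) (fun s x => (s - t)⁻¹ * (f s x - f t x)) f'

/-- Factor the difference of squares: the quotient converges in L², and so does the mean of f(s) and
f(t), so the integral of their product converges. -/
theorem tendsto_slope_sq {f : ℝ → Euc n → ℝ} {f' : Euc n → ℝ} {t : ℝ} (ht : t ∈ Ioo 0 T)
    (hf : ContInLp T Ω 2 f) (hs : HasSlope Ω f f' t) :
    Tendsto (fun s => (s - t)⁻¹ * (1 / 2 * (∫ x in Ω, f s x * f s x) -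
      1 / 2 * ∫ x in Ω, f t x * f t x)) (𝓝[≠] t) (𝓝 (∫ x in Ω, f' x * f t x)) := by
  have h1 := hs.integral_mul ((((hf.lpTendsto_punctured ht).add one_le_two
    (.const (hf.1 t (Ioo_subset_Icc_self ht)))).const_mul (1 / 2)))
  have e1 : ∀ y : ℝ, 1 / 2 * (y + y) = y := fun y => by ring
  simp only [e1] at h1
  refine h1.congr' ?_
  filter_upwards [nhdsWithin_le_nhds (Ioo_mem_nhds ht.1 ht.2)] with s hsI
  have m1 := hf.1 s (Ioo_subset_Icc_self hsI)
  have m2 := hf.1 t (Ioo_subset_Icc_self ht)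
  rw [← integral_const_mul, ← integral_const_mul, ← integral_sub
    ((integrableOn_mul m1 m1).const_mul _) ((integrableOn_mul m2 m2).const_mul _),
    ← integral_const_mul]
  exact integral_congr_ae (Eventually.of_forall fun x => by ring)

/-- Green's formula for the modulated gradient `ε ∇a + c ∇φ`. -/
theorem integral_pd_mul_modulated (hΩ : IsSmoothDomain Ω) {a c w ρ φ : Euc n → ℝ}
    {κ : Fin n → Euc n → ℝ} (ha : WaveSlice Ω a) (hφ : FluidSlice Ω ρ φ κ) (hc : BoundedC1 Ω c)
    (hw : BoundedC1 Ω w) (hw2 : MemLp w 2 (volume.restrict Ω)) :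
    ∑ j, ∫ x in Ω, pd j w x * (ε * pd j a x + c x * pd j φ x) =
      -∫ x in Ω, w x * (ε * lap a x + (gd c φ x + c x * lap φ x)) := by
  have ho := hΩ.isOpen
  have d1 := hasZeroIntegral_of_memLp hΩ hw hw2 ha.neumann ha.memLp_pd ha.memLp_pd_pd
  have d2 := hasZeroIntegral_of_memLp hΩ (hw.mul ho hc) (memLp_mul_bdd hw2 hc.memLp_top)
    hφ.neumann hφ.memLp_pd hφ.memLp_pd_pd
  have d := (d1.const_mul ε).add d2
  have i1 : ∀ j, IntegrableOn (fun x => pd j w x * (ε * pd j a x + c x * pd j φ x)) Ω := fun j =>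
    integrableOn_mul (hw.memLp_pd j) (((ha.memLp_pd j).const_mul ε).add
      (memLp_bdd_mul hc.memLp_top (hφ.memLp_pd j)))
  have i2 : IntegrableOn (fun x => w x * (ε * lap a x + (gd c φ x + c x * lap φ x))) Ω :=
    integrableOn_mul hw2 (((memLp_lap ha.memLp_pd_pd).const_mul ε).add
      ((memLp_gd hc.memLp_pd hφ.memLp_top_pd).add
        (memLp_bdd_mul hc.memLp_top (memLp_lap hφ.memLp_pd_pd))))
  rw [eq_neg_iff_add_eq_zero, ← integral_finsetSum _ fun j _ => i1 j,
    ← integral_add (integrable_finsetSum _ fun j _ => i1 j) i2, ← d.2]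
  refine setIntegral_congr_fun ho.measurableSet fun x hx => ?_
  rw [gd_mul_left (differentiableAt_of_contDiffOn ho hw.1 hx)
    (differentiableAt_of_contDiffOn ho hc.1 hx)]
  have : ∑ j, pd j w x * (ε * pd j a x + c x * pd j φ x) = ε * gd w a x + c x * gd w φ x := by
    simp only [gd, Finset.mul_sum, ← Finset.sum_add_distrib]
    exact Finset.sum_congr rfl fun j _ => by ring
  rw [this]
  ring

theorem ContInLp.gd {f g : ℝ → Euc n → ℝ} (hf : ∀ j, ContInLp T Ω 2 fun t => pd j (f t))
    (hg : ∀ j, ContInLp T Ω ⊤ fun t => pd j (g t)) : ContInLp T Ω 2 fun t => gd (f t) (g t) :=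
  .sum one_le_two _ fun j _ => (hf j).mul_bdd (hg j)

theorem ContInLp.lap {p : ℝ≥0∞} (hp : 1 ≤ p) {f : ℝ → Euc n → ℝ}
    (hf : ∀ i j, ContInLp T Ω p fun t => pd i (pd j (f t))) :
    ContInLp T Ω p fun t => lap (f t) :=
  .sum hp _ fun j _ => hf j j

/-- The rate of change of the kinetic part of the modulated energy. -/
theorem tendsto_slope_modulated (hΩ : IsSmoothDomain Ω) {a c ρ φ : ℝ → Euc n → ℝ}
    {κ : ℝ → Fin n → Euc n → ℝ} (ha : WaveFlow T Ω a) (hc : WaveFlow T Ω c)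
    (hφ : FluidFlow T Ω ρ φ κ) {a' : Euc n → ℝ} {V : Fin n → Euc n → ℝ} {t : ℝ}
    (ht : t ∈ Ioo 0 T) (hsa : HasSlope Ω a a' t)
    (hsV : ∀ j, HasSlope Ω (fun s x => c s x * pd j (φ s) x) (V j) t) :
    Tendsto (fun s => (s - t)⁻¹ *
      ((∑ j, 1 / 2 * ∫ x in Ω, (ε * pd j (a s) x + c s x * pd j (φ s) x) *
        (ε * pd j (a s) x + c s x * pd j (φ s) x)) -
      ∑ j, 1 / 2 * ∫ x in Ω, (ε * pd j (a t) x + c t x * pd j (φ t) x) *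
        (ε * pd j (a t) x + c t x * pd j (φ t) x))) (𝓝[≠] t)
      (𝓝 (-(∫ x in Ω, ε * a' x * (ε * lap (a t) x +
          (gd (c t) (φ t) x + c t x * lap (φ t) x))) +
        ∑ j, ∫ x in Ω, V j x * (ε * pd j (a t) x + c t x * pd j (φ t) x))) := by
  have ho := hΩ.isOpen
  have hA : ∀ j, ContInLp T Ω 2 fun s x => ε * pd j (a s) x + c s x * pd j (φ s) x := fun j =>
    ((ha.contInLp_pd j).const_mul ε).add one_le_two (hc.contInLp_top.bdd_mul (hφ.contInLp_pd j))
  have hD : ContInLp T Ω 2 fun s x => ε * lap (a s) x +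
      (gd (c s) (φ s) x + c s x * lap (φ s) x) :=
    ((ContInLp.lap one_le_two ha.contInLp_pd_pd).const_mul ε).add one_le_two
      ((ContInLp.gd hc.contInLp_pd hφ.contInLp_top_pd).add one_le_two
        (hc.contInLp_top.bdd_mul (.lap one_le_two hφ.contInLp_pd_pd)))
  have htI := Ioo_subset_Icc_self ht
  -- ∂ₜ∇a is not available. In the factored difference of squares the part with ∇(a(s) − a(t)) is
  -- integrated by parts, so the quotient of a itself pairs with the mean of the divergences at s
  -- and t, which converges in L². The part with c∇φ has a quotient converging in L² and is treated
  -- directly in `lim2`.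
  have lim1 := ((hsa.const_mul ε).integral_mul (((hD.lpTendsto_punctured ht).add one_le_two
    (.const (hD.1 t htI))).const_mul (1 / 2))).neg
  have lim2 := tendsto_finsetSum (Finset.univ : Finset (Fin n)) fun j _ =>
    (hsV j).integral_mul ((((hA j).lpTendsto_punctured ht).add one_le_two
    (.const ((hA j).1 t htI))).const_mul (1 / 2))
  have e1 : ∀ y : ℝ, 1 / 2 * (y + y) = y := fun y => by ring
  simp only [e1] at lim1 lim2
  refine (lim1.add lim2).congr' ?_
  filter_upwards [hsa.1, nhdsWithin_le_nhds (Ioo_mem_nhds ht.1 ht.2), self_mem_nhdsWithin]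
    with s hs2 hsI hst
  have hst : s ≠ t := hst
  have hsI' := Ioo_subset_Icc_self hsI
  have hw2 : MemLp (fun x => (s - t)⁻¹ * (a s x - a t x)) 2 (volume.restrict Ω) := hs2
  have hw : BoundedC1 Ω fun x => (s - t)⁻¹ * (a s x - a t x) :=
    (BoundedC1.const _).mul ho ((ha.slice s hsI).boundedC1.sub ho (ha.slice t ht).boundedC1)
  have g1 := integral_pd_mul_modulated (ε := ε) hΩ (ha.slice s hsI) (hφ.slice s hsI)
    (hc.slice s hsI).boundedC1 hw hw2
  have g2 := integral_pd_mul_modulated (ε := ε) hΩ (ha.slice t ht) (hφ.slice t ht)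
    (hc.slice t ht).boundedC1 hw hw2
  have hpdw : ∀ j, ∀ x ∈ Ω, pd j (fun x => (s - t)⁻¹ * (a s x - a t x)) x =
      (s - t)⁻¹ * (pd j (a s) x - pd j (a t) x) := by
    intro j x hx
    have d1 := differentiableAt_of_contDiffOn ho (ha.slice s hsI).boundedC1.1 hx
    have d2 := differentiableAt_of_contDiffOn ho (ha.slice t ht).boundedC1.1 hx
    rw [pd_mul (f := fun _ => (s - t)⁻¹) (g := fun x => a s x - a t x)
      (differentiableAt_const _) (d1.sub d2), pd_const, pd_sub d1 d2]
    ring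
  have i1 := integrableOn_mul hw2 (hD.1 s hsI')
  have i2 := integrableOn_mul hw2 (hD.1 t htI)
  have k1 : ∀ j, IntegrableOn (fun x => pd j (fun x => (s - t)⁻¹ * (a s x - a t x)) x *
      (ε * pd j (a s) x + c s x * pd j (φ s) x)) Ω := fun j =>
    integrableOn_mul (hw.memLp_pd j) ((hA j).1 s hsI')
  have k2 : ∀ j, IntegrableOn (fun x => pd j (fun x => (s - t)⁻¹ * (a s x - a t x)) x *
      (ε * pd j (a t) x + c t x * pd j (φ t) x)) Ω := fun j =>
    integrableOn_mul (hw.memLp_pd j) ((hA j).1 t htI)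
  -- Green's formula is applied at both times with the same weight, the difference quotient of a.
  -- That weight is admissible because it is bounded, C¹ and in L².
  have m1 : -∫ x in Ω, ε * ((s - t)⁻¹ * (a s x - a t x)) *
      (1 / 2 * (ε * lap (a s) x + (gd (c s) (φ s) x + c s x * lap (φ s) x) +
        (ε * lap (a t) x + (gd (c t) (φ t) x + c t x * lap (φ t) x)))) =
      ε / 2 * ∑ j, ∫ x in Ω, (s - t)⁻¹ * (pd j (a s) x - pd j (a t) x) *
        (ε * pd j (a s) x + c s x * pd j (φ s) x +
          (ε * pd j (a t) x + c t x * pd j (φ t) x)) := by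
    have l1 : ∫ x in Ω, ε * ((s - t)⁻¹ * (a s x - a t x)) *
      (1 / 2 * (ε * lap (a s) x + (gd (c s) (φ s) x + c s x * lap (φ s) x) +
        (ε * lap (a t) x + (gd (c t) (φ t) x + c t x * lap (φ t) x)))) =
        ε / 2 * (∫ x in Ω, (s - t)⁻¹ * (a s x - a t x) *
          (ε * lap (a s) x + (gd (c s) (φ s) x + c s x * lap (φ s) x))) +
        ε / 2 * ∫ x in Ω, (s - t)⁻¹ * (a s x - a t x) *
          (ε * lap (a t) x + (gd (c t) (φ t) x + c t x * lap (φ t) x)) := by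
      rw [← integral_const_mul, ← integral_const_mul,
        ← integral_add (i1.const_mul _) (i2.const_mul _)]
      exact integral_congr_ae (Eventually.of_forall fun x => by ring)
    have l2 : ∀ j, ∫ x in Ω, (s - t)⁻¹ * (pd j (a s) x - pd j (a t) x) *
        (ε * pd j (a s) x + c s x * pd j (φ s) x +
          (ε * pd j (a t) x + c t x * pd j (φ t) x)) =
        (∫ x in Ω, pd j (fun x => (s - t)⁻¹ * (a s x - a t x)) x *
          (ε * pd j (a s) x + c s x * pd j (φ s) x)) +
        ∫ x in Ω, pd j (fun x => (s - t)⁻¹ * (a s x - a t x)) x *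
          (ε * pd j (a t) x + c t x * pd j (φ t) x) := fun j => by
      rw [← integral_add (k1 j) (k2 j)]
      refine setIntegral_congr_fun ho.measurableSet fun x hx => ?_
      simp only [hpdw j x hx]
      ring
    simp only [l2, Finset.sum_add_distrib, g1, g2, l1]
    ring
  rw [m1, Finset.mul_sum, ← Finset.sum_add_distrib, ← Finset.sum_sub_distrib, Finset.mul_sum]
  refine Finset.sum_congr rfl fun j _ => ?_
  have hAs : MemLp (fun x => ε * pd j (a s) x + c s x * pd j (φ s) x) 2
      (volume.restrict Ω) := (hA j).1 s hsI'
  have hAt : MemLp (fun x => ε * pd j (a t) x + c t x * pd j (φ t) x) 2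
      (volume.restrict Ω) := (hA j).1 t htI
  have hS : MemLp (fun x => ε * pd j (a s) x + c s x * pd j (φ s) x +
      (ε * pd j (a t) x + c t x * pd j (φ t) x)) 2 (volume.restrict Ω) := hAs.add hAt
  have hV : MemLp (fun x => (s - t)⁻¹ * (c s x * pd j (φ s) x - c t x * pd j (φ t) x)) 2
      (volume.restrict Ω) :=
    ((memLp_bdd_mul (hc.contInLp_top.1 s hsI') ((hφ.contInLp_pd j).1 s hsI')).sub
      (memLp_bdd_mul (hc.contInLp_top.1 t htI) ((hφ.contInLp_pd j).1 t htI))).const_mul _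
  have hP : MemLp (fun x => (s - t)⁻¹ * (pd j (a s) x - pd j (a t) x)) 2
      (volume.restrict Ω) :=
    (((ha.contInLp_pd j).1 s hsI').sub ((ha.contInLp_pd j).1 t htI)).const_mul _
  have r1 := (integrableOn_mul hP hS).const_mul (ε / 2)
  have r2 := integrableOn_mul hV (hS.const_mul (1 / 2))
  rw [← integral_const_mul, ← integral_const_mul, ← integral_const_mul, ← integral_sub
    ((integrableOn_mul hAs hAs).const_mul _) ((integrableOn_mul hAt hAt).const_mul _),
    ← integral_const_mul, ← integral_add r1 r2]
  exact integral_congr_ae (Eventually.of_forall fun x => by ring)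

end Flows

/-! ### The balance law of the modulated energy -/

section EnergyDerivative

variable {n : ℕ} {Ω : Set (Euc n)} {T ε : ℝ}

theorem pd_neg (f : Euc n → ℝ) (j : Fin n) : pd j (fun x => -f x) = fun x => -pd j f x := by
  ext x
  simp [pd, fderiv_fun_neg]

/-- The field ε∇b − a∇φ has the form ε∇b + c∇φ with c = −a, so a single slope computation serves
both components of the modulated gradient. -/
theorem WaveFlow.neg {a : ℝ → Euc n → ℝ} (ha : WaveFlow T Ω a) :
    WaveFlow T Ω fun t x => -a t x := by
  refine ⟨fun t ht => ⟨⟨(ha.slice t ht).neumann.1.neg, ?_, fun j => ?_⟩, ?_, fun j => ?_,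
    fun i j => ?_⟩, ha.contInLp_top.neg, fun j => ?_, fun i j => ?_, ha.continuousOn.neg,
    fun i j => ?_⟩
  · intro x hx g hg hloc hgx hgrad
    have h := ((ha.slice t ht).neumann.2 x hx g hg hloc hgx hgrad).neg
    simpa [pd_neg] using h
  · have h := (bddNear_const 0).sub ((ha.slice t ht).neumann.3 j)
    simpa [pd_neg] using h
  · exact (ha.slice t ht).memLp_top.neg
  · rw [pd_neg]; exact ((ha.slice t ht).memLp_pd j).neg
  · rw [pd_neg, pd_neg]; exact ((ha.slice t ht).memLp_pd_pd i j).neg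
  · simpa only [pd_neg] using (ha.contInLp_pd j).neg
  · simpa only [pd_neg] using (ha.contInLp_pd_pd i j).neg
  · simp only [pd_neg]; exact (ha.continuousOn_pd_pd i j).neg

/-- The time derivative of the imaginary part of a solution `a + i b` of the Gross–Pitaevskii
equation; that of the real part is `-schrodingerRate ε b a`. -/
def schrodingerRate (ε : ℝ) (a b : Euc n → ℝ) (x : Euc n) : ℝ :=
  ε / 2 * lap a x - ε⁻¹ * ((a x ^ 2 + b x ^ 2 - 1) * a x)

/-- The Gross–Pitaevskii equation for the real and imaginary parts. -/
structure SchrodingerFlow (T : ℝ) (Ω : Set (Euc n)) (ε : ℝ) (a b : ℝ → Euc n → ℝ) : Prop where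
  re : WaveFlow T Ω a
  im : WaveFlow T Ω b
  density : ContInLp T Ω 2 fun t x => a t x ^ 2 + b t x ^ 2 - 1
  hasDerivAt_re : ∀ t ∈ Ioo 0 T, ∀ x ∈ Ω,
    HasDerivAt (fun s => a s x) (-schrodingerRate ε (b t) (a t) x) t
  hasDerivAt_im : ∀ t ∈ Ioo 0 T, ∀ x ∈ Ω,
    HasDerivAt (fun s => b s x) (schrodingerRate ε (a t) (b t) x) t

theorem WaveFlow.continuousOn_lap {a : ℝ → Euc n → ℝ} (ha : WaveFlow T Ω a) :
    ContinuousOn (fun q : ℝ × Euc n => lap (a q.1) q.2) (Icc 0 T ×ˢ Ω) :=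
  continuousOn_finsetSum _ fun j _ => ha.continuousOn_pd_pd j j

theorem continuousOn_schrodingerRate {a b : ℝ → Euc n → ℝ} (ha : WaveFlow T Ω a)
    (hb : WaveFlow T Ω b) : ContinuousOn (fun q : ℝ × Euc n =>
      schrodingerRate ε (a q.1) (b q.1) q.2) (Icc 0 T ×ˢ Ω) :=
  (continuousOn_const.mul ha.continuousOn_lap).sub (continuousOn_const.mul
    ((((ha.continuousOn.pow 2).add (hb.continuousOn.pow 2)).sub continuousOn_const).mul
      ha.continuousOn))

theorem contInLp_schrodingerRate {a b : ℝ → Euc n → ℝ} (ha : WaveFlow T Ω a)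
    (hN : ContInLp T Ω 2 fun t x => a t x ^ 2 + b t x ^ 2 - 1) :
    ContInLp T Ω 2 fun t => schrodingerRate ε (a t) (b t) :=
  ((ContInLp.lap one_le_two ha.contInLp_pd_pd).const_mul _).sub one_le_two
    ((hN.mul_bdd ha.contInLp_top).const_mul _)

/-- In this form the rate is built from first and second derivatives already known to be continuous
and to lie in L² and L^∞. -/
theorem velocityRate_eq (ho : IsOpen Ω) {ρ φ : Euc n → ℝ} (hφ : ContDiffOn ℝ 2 φ Ω)
    {x : Euc n} (hx : x ∈ Ω) (j : Fin n) : velocityRate ρ φ j x =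
      -(∑ k, pd j (pd k φ) x * pd k φ x + pd j ρ x) := by
  rw [velocityRate, pd_gd ho hφ hφ hx, Finset.mul_sum]
  congr 2
  exact Finset.sum_congr rfl fun k _ => by ring

theorem continuousOn_velocityRate (ho : IsOpen Ω) {ρ φ : ℝ → Euc n → ℝ}
    (hφ : ∀ t ∈ Icc 0 T, ContDiffOn ℝ 2 (φ t) Ω)
    (h1 : ∀ j, ContinuousOn (fun q : ℝ × Euc n => pd j (φ q.1) q.2) (Icc 0 T ×ˢ Ω))
    (h2 : ∀ i j, ContinuousOn (fun q : ℝ × Euc n => pd i (pd j (φ q.1)) q.2) (Icc 0 T ×ˢ Ω))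
    (hρ : ∀ j, ContinuousOn (fun q : ℝ × Euc n => pd j (ρ q.1) q.2) (Icc 0 T ×ˢ Ω)) (j : Fin n) :
    ContinuousOn (fun q : ℝ × Euc n => velocityRate (ρ q.1) (φ q.1) j q.2) (Icc 0 T ×ˢ Ω) := by
  have h : ContinuousOn (fun q : ℝ × Euc n =>
      -(∑ k, pd j (pd k (φ q.1)) q.2 * pd k (φ q.1) q.2 + pd j (ρ q.1) q.2)) (Icc 0 T ×ˢ Ω) :=
    ((continuousOn_finsetSum _ fun k _ => (h2 j k).mul (h1 k)).add (hρ j)).neg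
  exact h.congr fun q hq => velocityRate_eq ho (hφ q.1 hq.1) hq.2 j

namespace FluidFlow

variable {ρ φ : ℝ → Euc n → ℝ} {κ : ℝ → Fin n → Euc n → ℝ}

theorem contInLp_velocityRate (ho : IsOpen Ω) (hφ : FluidFlow T Ω ρ φ κ) (j : Fin n) :
    ContInLp T Ω 2 fun t => velocityRate (ρ t) (φ t) j := by
  have h : ContInLp T Ω 2 fun t x =>
      -(∑ k, pd j (pd k (φ t)) x * pd k (φ t) x + pd j (ρ t) x) :=
    ((ContInLp.sum one_le_two _ fun k _ => (hφ.contInLp_pd_pd j k).mul_bdd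
      (hφ.contInLp_top_pd k)).add one_le_two (hφ.contInLp_pd_density j)).neg
  refine h.congr fun t ht => ?_
  filter_upwards [ae_restrict_mem ho.measurableSet] with x hx
  exact (velocityRate_eq ho (hφ.contDiffOn t ht) hx j).symm

/-- The slope of `c ∂_j φ` for a wave component `c`. -/
theorem hasSlope_mul_pd (ho : IsOpen Ω) (hφ : FluidFlow T Ω ρ φ κ) {c r : ℝ → Euc n → ℝ}
    (hc : WaveFlow T Ω c) (hd : ∀ t ∈ Ioo 0 T, ∀ x ∈ Ω, HasDerivAt (fun s => c s x) (r t x) t)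
    (hrc : ContinuousOn (fun q : ℝ × Euc n => r q.1 q.2) (Icc 0 T ×ˢ Ω))
    (hr : ContInLp T Ω 2 r) {t : ℝ} (ht : t ∈ Ioo 0 T) (j : Fin n) :
    HasSlope Ω (fun s x => c s x * pd j (φ s) x)
      (fun x => r t x * pd j (φ t) x + c t x * velocityRate (ρ t) (φ t) j x) t :=
  lpTendsto_slope (T := T) (g := fun t x => r t x * pd j (φ t) x +
      c t x * velocityRate (ρ t) (φ t) j x) ho
    (((hrc.mul (hφ.continuousOn_pd j)).add (hc.continuousOn.mul
      (continuousOn_velocityRate ho hφ.contDiffOn hφ.continuousOn_pd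
        hφ.continuousOn_pd_pd hφ.continuousOn_pd_density j))).mono
      (prod_mono Ioo_subset_Icc_self subset_rfl))
    (fun t ht x hx => (hd t ht x hx).mul (hφ.hasDerivAt_pd t ht x hx j))
    ((hr.mul_bdd (hφ.contInLp_top_pd j)).add one_le_two
      (hc.contInLp_top.bdd_mul (hφ.contInLp_velocityRate ho j)))
    (fun t ht => ((hc.contInLp_top.1 t (Ioo_subset_Icc_self ht)).1.mul
      ((hφ.contInLp_pd j).1 t (Ioo_subset_Icc_self ht)).1)) ht

theorem continuousOn_lap (hφ : FluidFlow T Ω ρ φ κ) :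
    ContinuousOn (fun q : ℝ × Euc n => lap (φ q.1) q.2) (Icc 0 T ×ˢ Ω) :=
  continuousOn_finsetSum _ fun j _ => hφ.continuousOn_pd_pd j j

theorem continuousOn_gd (hφ : FluidFlow T Ω ρ φ κ) :
    ContinuousOn (fun q : ℝ × Euc n => gd (ρ q.1) (φ q.1) q.2) (Icc 0 T ×ˢ Ω) :=
  continuousOn_finsetSum _ fun j _ => (hφ.continuousOn_pd_density j).mul (hφ.continuousOn_pd j)

end FluidFlow

/-- The modulated energy
`½ ∑ⱼ ∫ (ε ∂ⱼa + b ∂ⱼφ)² + ½ ∑ⱼ ∫ (ε ∂ⱼb - a ∂ⱼφ)² + ½ ∫ (a² + b² - ρ)²`. -/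
def modulatedEnergy (Ω : Set (Euc n)) (ε : ℝ) (a b ρ φ : Euc n → ℝ) : ℝ :=
  (∑ j, 1 / 2 * ∫ x in Ω, (ε * pd j a x + b x * pd j φ x) * (ε * pd j a x + b x * pd j φ x)) +
  (∑ j, 1 / 2 * ∫ x in Ω, (ε * pd j b x + -a x * pd j φ x) * (ε * pd j b x + -a x * pd j φ x)) +
  1 / 2 * ∫ x in Ω, (a x ^ 2 + b x ^ 2 - ρ x) * (a x ^ 2 + b x ^ 2 - ρ x)

theorem neg_integral_add_sum_integral {P R U : Euc n → ℝ} {Q S : Fin n → Euc n → ℝ}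
    (hP : IntegrableOn P Ω) (hQ : ∀ j, IntegrableOn (Q j) Ω) (hR : IntegrableOn R Ω)
    (hS : ∀ j, IntegrableOn (S j) Ω) (hU : IntegrableOn U Ω) :
    (-∫ x in Ω, P x) + (∑ j, ∫ x in Ω, Q j x) + ((-∫ x in Ω, R x) + ∑ j, ∫ x in Ω, S j x) +
      ∫ x in Ω, U x = ∫ x in Ω, (-P x + ∑ j, Q j x + (-R x + ∑ j, S j x) + U x) := by
  have q : IntegrableOn (fun x => ∑ j, Q j x) Ω := integrable_finsetSum _ fun j _ => hQ j
  have s : IntegrableOn (fun x => ∑ j, S j x) Ω := integrable_finsetSum _ fun j _ => hS j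
  have p : IntegrableOn (fun x => -P x) Ω := hP.neg
  have r : IntegrableOn (fun x => -R x) Ω := hR.neg
  have pq : IntegrableOn (fun x => -P x + ∑ j, Q j x) Ω := p.add q
  have rs : IntegrableOn (fun x => -R x + ∑ j, S j x) Ω := r.add s
  have pqrs : IntegrableOn (fun x => -P x + ∑ j, Q j x + (-R x + ∑ j, S j x)) Ω := pq.add rs
  rw [← integral_finsetSum _ fun j _ => hQ j, ← integral_finsetSum _ fun j _ => hS j,
    ← integral_neg, ← integral_neg, ← integral_add p q, ← integral_add r s,
    ← integral_add pq rs, ← integral_add pqrs hU]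

namespace SchrodingerFlow

variable {a b ρ φ : ℝ → Euc n → ℝ} {κ : ℝ → Fin n → Euc n → ℝ}

theorem contInLp_densityGap (hu : SchrodingerFlow T Ω ε a b) (hφ : FluidFlow T Ω ρ φ κ) :
    ContInLp T Ω 2 fun t x => a t x ^ 2 + b t x ^ 2 - ρ t x := by
  simpa using hu.density.sub one_le_two hφ.contInLp_density

theorem density_symm (hu : SchrodingerFlow T Ω ε a b) :
    ContInLp T Ω 2 fun t x => b t x ^ 2 + a t x ^ 2 - 1 := by
  simpa only [add_comm] using hu.density

theorem contInLp_re (hu : SchrodingerFlow T Ω ε a b) (hφ : FluidFlow T Ω ρ φ κ) (j : Fin n) :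
    ContInLp T Ω 2 fun t x => ε * pd j (a t) x + b t x * pd j (φ t) x :=
  ((hu.re.contInLp_pd j).const_mul ε).add one_le_two
    (hu.im.contInLp_top.bdd_mul (hφ.contInLp_pd j))

theorem contInLp_im (hu : SchrodingerFlow T Ω ε a b) (hφ : FluidFlow T Ω ρ φ κ) (j : Fin n) :
    ContInLp T Ω 2 fun t x => ε * pd j (b t) x + -a t x * pd j (φ t) x :=
  ((hu.im.contInLp_pd j).const_mul ε).add one_le_two
    (hu.re.contInLp_top.neg.bdd_mul (hφ.contInLp_pd j))

theorem continuousOn_modulatedEnergy (hu : SchrodingerFlow T Ω ε a b)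
    (hφ : FluidFlow T Ω ρ φ κ) :
    ContinuousOn (fun t => modulatedEnergy Ω ε (a t) (b t) (ρ t) (φ t)) (Icc 0 T) := by
  refine ((continuousOn_finsetSum _ fun j _ => continuousOn_const.mul ?_).add
    (continuousOn_finsetSum _ fun j _ => continuousOn_const.mul ?_)).add
    (continuousOn_const.mul ?_)
  · exact ((hu.contInLp_re hφ j).mul (r := 1) le_rfl (hu.contInLp_re hφ j)).continuousOn_integral
  · exact ((hu.contInLp_im hφ j).mul (r := 1) le_rfl (hu.contInLp_im hφ j)).continuousOn_integral
  · exact ((hu.contInLp_densityGap hφ).mul (r := 1) le_rfl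
      (hu.contInLp_densityGap hφ)).continuousOn_integral

theorem hasSlope_densityGap (ho : IsOpen Ω) (hu : SchrodingerFlow T Ω ε a b)
    (hφ : FluidFlow T Ω ρ φ κ) {t : ℝ} (ht : t ∈ Ioo 0 T) :
    HasSlope Ω (fun s x => a s x ^ 2 + b s x ^ 2 - ρ s x)
      (fun x => 2 * a t x * -schrodingerRate ε (b t) (a t) x +
        2 * b t x * schrodingerRate ε (a t) (b t) x +
        (gd (ρ t) (φ t) x + ρ t x * lap (φ t) x)) t := by
  have hc : ∀ {c r : ℝ → Euc n → ℝ}, WaveFlow T Ω c → ContInLp T Ω 2 r →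
      ContInLp T Ω 2 fun t x => 2 * c t x * r t x := fun hc hr => by
    simpa only [mul_assoc] using (hc.contInLp_top.bdd_mul hr).const_mul 2
  refine lpTendsto_slope (T := T) (g := fun t x => 2 * a t x * -schrodingerRate ε (b t) (a t) x +
        2 * b t x * schrodingerRate ε (a t) (b t) x +
        (gd (ρ t) (φ t) x + ρ t x * lap (φ t) x)) ho ?_ (fun t ht x hx => ?_) ?_ ?_ ht
  · exact (((continuousOn_const.mul hu.re.continuousOn).mul
      (continuousOn_schrodingerRate hu.im hu.re).neg).add
      ((continuousOn_const.mul hu.im.continuousOn).mul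
      (continuousOn_schrodingerRate hu.re hu.im)) |>.add
      (hφ.continuousOn_gd.add (hφ.continuousOn_density.mul hφ.continuousOn_lap))).mono
      (prod_mono Ioo_subset_Icc_self subset_rfl)
  · have h := (((hu.hasDerivAt_re t ht x hx).pow 2).add ((hu.hasDerivAt_im t ht x hx).pow 2)).sub
      (hφ.hasDerivAt_density t ht x hx)
    refine h.congr_deriv ?_
    norm_num
    ring
  · exact ((hc hu.re (contInLp_schrodingerRate hu.im hu.density_symm).neg).add one_le_two
      (hc hu.im (contInLp_schrodingerRate hu.re hu.density))).add one_le_two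
      ((ContInLp.gd hφ.contInLp_pd_density hφ.contInLp_top_pd).add one_le_two
        (hφ.contInLp_top_density.bdd_mul (.lap one_le_two hφ.contInLp_pd_pd)))
  · exact fun t ht => ((hu.contInLp_densityGap hφ).1 t (Ioo_subset_Icc_self ht)).1

/-- The balance of the modulated energy. -/
theorem hasDerivAt_modulatedEnergy (hΩ : IsSmoothDomain Ω) (hε : ε ≠ 0)
    (hu : SchrodingerFlow T Ω ε a b) (hφ : FluidFlow T Ω ρ φ κ) {t : ℝ} (ht : t ∈ Ioo 0 T) :
    HasDerivAt (fun s => modulatedEnergy Ω ε (a s) (b s) (ρ s) (φ s))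
      (∫ x in Ω, modulatedFlux ε (a t) (b t) (ρ t) (φ t) (κ t) x) t := by
  have ho := hΩ.isOpen
  have htI := Ioo_subset_Icc_self ht
  have hsub : Ioo 0 T ×ˢ Ω ⊆ Icc 0 T ×ˢ Ω := prod_mono Ioo_subset_Icc_self subset_rfl
  have ra : ContInLp T Ω 2 fun t x => -schrodingerRate ε (b t) (a t) x :=
    (contInLp_schrodingerRate hu.im hu.density_symm).neg
  have rb : ContInLp T Ω 2 fun t => schrodingerRate ε (a t) (b t) :=
    contInLp_schrodingerRate hu.re hu.density
  have ca : ContinuousOn (fun q : ℝ × Euc n => -schrodingerRate ε (b q.1) (a q.1) q.2)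
    (Icc 0 T ×ˢ Ω) := (continuousOn_schrodingerRate hu.im hu.re).neg
  have cb := continuousOn_schrodingerRate (ε := ε) hu.re hu.im
  have sa : HasSlope Ω a (fun x => -schrodingerRate ε (b t) (a t) x) t :=
    lpTendsto_slope (T := T) ho (ca.mono hsub) hu.hasDerivAt_re ra
      (fun t ht => (hu.re.slice t ht).memLp_top.1) ht
  have sb : HasSlope Ω b (schrodingerRate ε (a t) (b t)) t :=
    lpTendsto_slope (T := T) ho (cb.mono hsub) hu.hasDerivAt_im rb
      (fun t ht => (hu.im.slice t ht).memLp_top.1) ht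
  have l1 := tendsto_slope_modulated (ε := ε) hΩ hu.re hu.im hφ ht sa
    (hφ.hasSlope_mul_pd ho hu.im hu.hasDerivAt_im cb rb ht)
  -- This is the imaginary component, with (b, −a) in place of (a, b).
  have l2 := tendsto_slope_modulated (ε := ε) hΩ hu.im hu.re.neg hφ ht sb
    (hφ.hasSlope_mul_pd ho hu.re.neg (fun t ht x hx => (hu.hasDerivAt_re t ht x hx).neg)
      ca.neg ra.neg ht)
  have l3 := tendsto_slope_sq ht (hu.contInLp_densityGap hφ) (hu.hasSlope_densityGap ho hφ ht)
  have hsa := hu.re.slice t ht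
  have hsb := hu.im.slice t ht
  have hsφ := hφ.slice t ht
  rw [← integral_energyRate hΩ hε hsa hsb hsφ (hu.density.1 t htI)
    (at' := fun x => -schrodingerRate ε (b t) (a t) x) (bt' := schrodingerRate ε (a t) (b t))
    (fun x _ => by simp only [schrodingerRate]; field_simp; ring)
    (fun x _ => by simp only [schrodingerRate]; field_simp),
    hasDerivAt_iff_tendsto_slope]
  have hval := (l1.add l2).add l3
  have m1 : ∀ {r f c : Euc n → ℝ}, MemLp r 2 (volume.restrict Ω) → WaveSlice Ω f →
      WaveSlice Ω c → IntegrableOn (fun x => ε * r x * (ε * lap f x +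
        (gd c (φ t) x + c x * lap (φ t) x))) Ω := fun hr hf hc =>
    integrableOn_mul (hr.const_mul ε) (((memLp_lap hf.memLp_pd_pd).const_mul ε).add
      ((memLp_gd hc.memLp_pd hsφ.memLp_top_pd).add
        (memLp_bdd_mul hc.memLp_top (memLp_lap hsφ.memLp_pd_pd))))
  have m2 : ∀ {r f c : Euc n → ℝ} (j : Fin n), MemLp r 2 (volume.restrict Ω) → WaveSlice Ω f →
      WaveSlice Ω c → IntegrableOn (fun x => (r x * pd j (φ t) x + c x *
        velocityRate (ρ t) (φ t) j x) * (ε * pd j f x + c x * pd j (φ t) x)) Ω :=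
    fun j hr hf hc => integrableOn_mul ((memLp_mul_bdd hr (hsφ.memLp_top_pd j)).add
      (memLp_bdd_mul hc.memLp_top ((hφ.contInLp_velocityRate ho j).1 t htI)))
      (((hf.memLp_pd j).const_mul ε).add (memLp_bdd_mul hc.memLp_top (hsφ.memLp_pd j)))
  have i1 := m1 (ra.1 t htI) hsa hsb
  have i2 := m1 (rb.1 t htI) hsb (hu.re.neg.slice t ht)
  have i3 := fun j => m2 j (rb.1 t htI) hsa hsb
  have i4 := fun j => m2 j (ra.neg.1 t htI) hsb (hu.re.neg.slice t ht)
  have i5 := integrableOn_mul (hu.hasSlope_densityGap ho hφ ht).2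
    ((hu.contInLp_densityGap hφ).1 t htI)
  -- The three limits, collected under one integral, are the energy rate. The two signs carried by c
  -- = −a cancel in the term of the imaginary component.
  have e : _ = ∫ x in Ω, energyRate ε (a t) (b t) (ρ t) (φ t)
      (fun x => -schrodingerRate ε (b t) (a t) x) (schrodingerRate ε (a t) (b t)) x :=
    (neg_integral_add_sum_integral i1 i3 i2 i4 i5).trans
      (integral_congr_ae (Eventually.of_forall fun x => by
        have g : gd (fun x => -a t x) (φ t) x = -gd (a t) (φ t) x := by
          simp [gd, pd_neg]
        have s1 : ∑ j, (- -schrodingerRate ε (b t) (a t) x * pd j (φ t) x +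
            -a t x * velocityRate (ρ t) (φ t) j x) * (ε * pd j (b t) x + -a t x * pd j (φ t) x) =
            -∑ j, (-schrodingerRate ε (b t) (a t) x * pd j (φ t) x +
            a t x * velocityRate (ρ t) (φ t) j x) * (ε * pd j (b t) x - a t x * pd j (φ t) x) := by
          rw [← Finset.sum_neg_distrib]
          exact Finset.sum_congr rfl fun j _ => by ring
        simp only [energyRate, g, s1]
        simp only [velocityRate]
        ring))
  have lim : ∀ {f : ℝ → ℝ} {y z : ℝ}, Tendsto f (𝓝[≠] t) (𝓝 y) → y = z →
      Tendsto f (𝓝[≠] t) (𝓝 z) := fun h e => e ▸ h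
  refine (lim hval e).congr fun s => ?_
  rw [slope_def_module, smul_eq_mul, modulatedEnergy, modulatedEnergy]
  ring

end SchrodingerFlow

end EnergyDerivative

/-! ### Estimate of the flux and Gronwall's inequality -/

section Gronwall

variable {n : ℕ} {Ω : Set (Euc n)} {T ε : ℝ}

/-- f(t)e^{−Ct} is nonincreasing. Derivatives are needed only in the open interval, where the
equations hold, and continuity suffices at the endpoints. -/
theorem le_mul_exp_of_deriv_le {f f' : ℝ → ℝ} {C : ℝ} (hf : ContinuousOn f (Icc 0 T))
    (hd : ∀ t ∈ Ioo 0 T, HasDerivAt f (f' t) t) (hle : ∀ t ∈ Ioo 0 T, f' t ≤ C * f t) {t : ℝ}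
    (ht : t ∈ Icc 0 T) : f t ≤ f 0 * Real.exp (C * t) := by
  have hg : ∀ t ∈ Ioo 0 T, HasDerivAt (fun s => f s * Real.exp (-(C * s)))
      (f' t * Real.exp (-(C * t)) + f t * (Real.exp (-(C * t)) * -(C * 1))) t := fun t ht =>
    (hd t ht).mul ((hasDerivAt_id t).const_mul C).neg.exp
  have hanti : AntitoneOn (fun s => f s * Real.exp (-(C * s))) (Icc 0 T) := by
    refine antitoneOn_of_deriv_nonpos (convex_Icc 0 T) (hf.mul (by fun_prop)) ?_ ?_ <;>
      rw [interior_Icc]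
    · exact fun t ht => (hg t ht).differentiableAt.differentiableWithinAt
    · intro t ht
      rw [(hg t ht).deriv]
      nlinarith [hle t ht, Real.exp_pos (-(C * t))]
  have h := hanti (left_mem_Icc.2 (ht.1.trans ht.2)) ht ht.1
  simp only [mul_zero, neg_zero, Real.exp_zero, mul_one] at h
  rwa [Real.exp_neg, ← div_eq_mul_inv, div_le_iff₀ (Real.exp_pos _)] at h

/-- The modulated energy density. -/
def energyDensity (ε : ℝ) (a b ρ φ : Euc n → ℝ) (x : Euc n) : ℝ :=
  1 / 2 * ∑ j, ((ε * pd j a x + b x * pd j φ x) ^ 2 + (ε * pd j b x - a x * pd j φ x) ^ 2) +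
    1 / 2 * (a x ^ 2 + b x ^ 2 - ρ x) ^ 2

/-- |A j A k| ≤ ½(A j² + A k²). Summing over the free index produces the factor n. -/
theorem neg_sum_sum_mul_le {M : ℝ} {A : Fin n → ℝ} {h : Fin n → Fin n → ℝ}
    (hM : ∀ j k, |h j k| ≤ M) :
    -(∑ j, ∑ k, A j * A k * h j k) ≤ n * M * ∑ j, A j ^ 2 := by
  have h1 : ∀ j k, -(A j * A k * h j k) ≤ M / 2 * A j ^ 2 + M / 2 * A k ^ 2 := fun j k => by
    have h2 : |A j * A k * h j k| ≤ |A j| * |A k| * M := by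
      rw [abs_mul, abs_mul]
      exact mul_le_mul_of_nonneg_left (hM j k) (by positivity)
    have h3 : 0 ≤ M := (abs_nonneg _).trans (hM j k)
    nlinarith [neg_abs_le (A j * A k * h j k), mul_nonneg h3 (sq_nonneg (|A j| - |A k|)),
      sq_abs (A j), sq_abs (A k)]
  calc -(∑ j, ∑ k, A j * A k * h j k) = ∑ j, ∑ k, -(A j * A k * h j k) := by
        simp only [Finset.sum_neg_distrib]
    _ ≤ ∑ j, ∑ k, (M / 2 * A j ^ 2 + M / 2 * A k ^ 2) :=
        Finset.sum_le_sum fun j _ => Finset.sum_le_sum fun k _ => h1 j k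
    _ = n * M * ∑ j, A j ^ 2 := by
        simp only [Finset.sum_add_distrib, Finset.sum_const, Finset.card_univ, Fintype.card_fin,
          nsmul_eq_mul, ← Finset.mul_sum]
        ring

/-- The Hessian and Laplacian terms cost 2nM times the energy density, and the summand n + 1 absorbs
what Young's inequality takes from the third-derivative term. That term is treated through ε(a∇a +
b∇b) = aA + bB, which exchanges a factor ε∇u for the modulated gradient and leaves only O(ε²)
explicitly. -/
theorem modulatedFlux_le {a b ρ φ : Euc n → ℝ} {κ : Fin n → Euc n → ℝ} {x : Euc n} {M R K : ℝ}
    (hM : ∀ j k, |pd j (pd k φ) x| ≤ M) (hM0 : 0 ≤ M) (hR : |ρ x| ≤ R) (hK : ∀ j, |κ j x| ≤ K)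
    (hε0 : 0 ≤ ε) (hε : ε ≤ 1) :
    modulatedFlux ε a b ρ φ κ x ≤ (2 * n * M + n + 1) * energyDensity ε a b ρ φ x +
      ε ^ 2 * ((R + K ^ 2) * ∑ j, κ j x ^ 2) := by
  set A : Fin n → ℝ := fun j => ε * pd j a x + b x * pd j φ x with hA
  set B : Fin n → ℝ := fun j => ε * pd j b x - a x * pd j φ x with hB
  set q := a x ^ 2 + b x ^ 2 - ρ x with hq
  have t1 := neg_sum_sum_mul_le (A := A) hM
  have t2 := neg_sum_sum_mul_le (A := B) hM
  have t3 : -lap φ x ≤ n * M := by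
    calc -lap φ x = ∑ j, -pd j (pd j φ) x := by rw [lap, Finset.sum_neg_distrib]
      _ ≤ ∑ _j : Fin n, M := Finset.sum_le_sum fun j _ => (neg_le_abs _).trans (hM j j)
      _ = n * M := by simp
  have t4 : ∀ j, -(ε ^ 2 / 2 * (κ j x * (a x * pd j a x + b x * pd j b x))) ≤
      1 / 4 * (A j ^ 2 + B j ^ 2) + ε ^ 2 * ((R + K ^ 2) * κ j x ^ 2) + 1 / 4 * q ^ 2 := by
    intro j
    have e : ε ^ 2 / 2 * (κ j x * (a x * pd j a x + b x * pd j b x)) =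
        1 / 2 * ((ε * κ j x * a x) * A j) + 1 / 2 * ((ε * κ j x * b x) * B j) := by
      simp only [hA, hB]; ring
    have e2 : a x ^ 2 + b x ^ 2 = ρ x + q := by rw [hq]; ring
    have k2 : κ j x ^ 2 ≤ K ^ 2 := sq_le_sq' (by linarith [neg_abs_le (κ j x), hK j])
      ((le_abs_self _).trans (hK j))
    have r1 : (ε * κ j x) ^ 2 * ρ x ≤ (ε * κ j x) ^ 2 * R :=
      mul_le_mul_of_nonneg_left ((le_abs_self _).trans hR) (sq_nonneg _)
    -- |u|² = ρ + q replaces an unavailable bound on |u| uniform in ε. The q part gives q² and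
    -- (εκ)⁴, and the latter is at most K²(εκ)² because ε ≤ 1.
    have r2 : (ε * κ j x) ^ 2 * q ≤ 1 / 2 * ((ε * κ j x) ^ 2 * K ^ 2) + 1 / 2 * q ^ 2 := by
      have h1 : (ε * κ j x) ^ 2 * (ε * κ j x) ^ 2 ≤ (ε * κ j x) ^ 2 * K ^ 2 := by
        refine mul_le_mul_of_nonneg_left ?_ (sq_nonneg _)
        rw [mul_pow]
        exact (mul_le_of_le_one_left (sq_nonneg _) (pow_le_one₀ hε0 hε)).trans k2
      nlinarith [sq_nonneg ((ε * κ j x) ^ 2 - q)]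
    have r3 : 0 ≤ R := (abs_nonneg _).trans hR
    rw [e]
    nlinarith [sq_nonneg (ε * κ j x * a x + A j), sq_nonneg (ε * κ j x * b x + B j),
      mul_nonneg (sq_nonneg (ε * κ j x)) r3, mul_nonneg (sq_nonneg (ε * κ j x)) (sq_nonneg K)]
  have t5 : -(ε ^ 2 / 2 * ∑ j, κ j x * (a x * pd j a x + b x * pd j b x)) ≤
      1 / 4 * (∑ j, A j ^ 2 + ∑ j, B j ^ 2) + ε ^ 2 * ((R + K ^ 2) * ∑ j, κ j x ^ 2) +
        n * (1 / 4 * q ^ 2) := by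
    calc -(ε ^ 2 / 2 * ∑ j, κ j x * (a x * pd j a x + b x * pd j b x)) =
        ∑ j, -(ε ^ 2 / 2 * (κ j x * (a x * pd j a x + b x * pd j b x))) := by
          rw [Finset.mul_sum, Finset.sum_neg_distrib]
      _ ≤ ∑ j, (1 / 4 * (A j ^ 2 + B j ^ 2) + ε ^ 2 * ((R + K ^ 2) * κ j x ^ 2) + 1 / 4 * q ^ 2) :=
          Finset.sum_le_sum fun j _ => t4 j
      _ = _ := by
          simp only [Finset.sum_add_distrib, ← Finset.mul_sum, Finset.sum_const, Finset.card_univ,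
            Fintype.card_fin, nsmul_eq_mul]
          ring
  have t6 : modulatedFlux ε a b ρ φ κ x =
      -(∑ j, ∑ k, A j * A k * pd j (pd k φ) x) - (∑ j, ∑ k, B j * B k * pd j (pd k φ) x) +
      1 / 2 * q ^ 2 * -lap φ x +
      -(ε ^ 2 / 2 * ∑ j, κ j x * (a x * pd j a x + b x * pd j b x)) := by
    simp only [modulatedFlux, add_mul, Finset.sum_add_distrib, hA, hB, hq]
    ring
  have t7 : energyDensity ε a b ρ φ x =
      1 / 2 * (∑ j, A j ^ 2 + ∑ j, B j ^ 2) + 1 / 2 * q ^ 2 := by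
    rw [← Finset.sum_add_distrib]
    rfl
  have t8 := mul_le_mul_of_nonneg_left t3 (by positivity : 0 ≤ 1 / 2 * q ^ 2)
  have sA : 0 ≤ ∑ j, A j ^ 2 := Finset.sum_nonneg fun j _ => sq_nonneg _
  have sB : 0 ≤ ∑ j, B j ^ 2 := Finset.sum_nonneg fun j _ => sq_nonneg _
  have hn : (0 : ℝ) ≤ n := n.cast_nonneg
  rw [t6, t7]
  nlinarith [mul_nonneg hn sA, mul_nonneg hn sB, mul_nonneg hn (sq_nonneg q), sq_nonneg q,
    mul_nonneg (mul_nonneg hn hM0) (sq_nonneg q)]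

variable {a b ρ φ : ℝ → Euc n → ℝ} {κ : ℝ → Fin n → Euc n → ℝ}

theorem SchrodingerFlow.integral_energyDensity (hu : SchrodingerFlow T Ω ε a b)
    (hφ : FluidFlow T Ω ρ φ κ) {t : ℝ} (ht : t ∈ Icc 0 T) :
    IntegrableOn (energyDensity ε (a t) (b t) (ρ t) (φ t)) Ω ∧
      ∫ x in Ω, energyDensity ε (a t) (b t) (ρ t) (φ t) x =
        modulatedEnergy Ω ε (a t) (b t) (ρ t) (φ t) := by
  have hA := fun j => (integrableOn_mul ((hu.contInLp_re hφ j).1 t ht)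
    ((hu.contInLp_re hφ j).1 t ht)).const_mul (1 / 2)
  have hB := fun j => (integrableOn_mul ((hu.contInLp_im hφ j).1 t ht)
    ((hu.contInLp_im hφ j).1 t ht)).const_mul (1 / 2)
  have hq := (integrableOn_mul ((hu.contInLp_densityGap hφ).1 t ht)
    ((hu.contInLp_densityGap hφ).1 t ht)).const_mul (1 / 2)
  have sA := integrable_finsetSum Finset.univ fun j _ => hA j
  have sB := integrable_finsetSum Finset.univ fun j _ => hB j
  have e : energyDensity ε (a t) (b t) (ρ t) (φ t) = fun x =>
      (∑ j, 1 / 2 * ((ε * pd j (a t) x + b t x * pd j (φ t) x) *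
        (ε * pd j (a t) x + b t x * pd j (φ t) x))) +
      (∑ j, 1 / 2 * ((ε * pd j (b t) x + -a t x * pd j (φ t) x) *
        (ε * pd j (b t) x + -a t x * pd j (φ t) x))) +
      1 / 2 * ((a t x ^ 2 + b t x ^ 2 - ρ t x) * (a t x ^ 2 + b t x ^ 2 - ρ t x)) := by
    ext x
    rw [energyDensity, ← Finset.sum_add_distrib, Finset.mul_sum]
    congr 1
    · exact Finset.sum_congr rfl fun j _ => by ring
    · ring
  rw [e]
  refine ⟨(sA.add sB).add hq, ?_⟩
  refine (integral_add (sA.add sB) hq).trans ?_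
  refine (congrArg (· + _) (integral_add sA sB)).trans ?_
  rw [integral_finsetSum _ fun j _ => hA j, integral_finsetSum _ fun j _ => hB j]
  simp only [integral_const_mul, modulatedEnergy]

theorem energyDensity_nonneg (ε : ℝ) (a b ρ φ : Euc n → ℝ) (x : Euc n) :
    0 ≤ energyDensity ε a b ρ φ x := by
  unfold energyDensity
  positivity

theorem SchrodingerFlow.modulatedEnergy_nonneg (hu : SchrodingerFlow T Ω ε a b)
    (hφ : FluidFlow T Ω ρ φ κ) {t : ℝ} (ht : t ∈ Icc 0 T) :
    0 ≤ modulatedEnergy Ω ε (a t) (b t) (ρ t) (φ t) := by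
  rw [← (hu.integral_energyDensity hφ ht).2]
  exact integral_nonneg fun x => energyDensity_nonneg _ _ _ _ _ x

/-- The constant is assembled from bounds on ∇²φ, ρ and ∇Δφ on [0,T] before ε and u are introduced,
so it is uniform in both. Both norms of ∇Δφ are used: L^∞ in the pointwise estimate and L² to
integrate the ε² remainder. -/
theorem FluidFlow.exists_integral_modulatedFlux_le
    (hφ : FluidFlow T Ω ρ φ κ) :
    ∃ C : ℝ, 0 ≤ C ∧ ∀ ε ∈ Ioc (0 : ℝ) 1, ∀ a b : ℝ → Euc n → ℝ, SchrodingerFlow T Ω ε a b →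
      ∀ t ∈ Ioo 0 T, ∫ x in Ω, modulatedFlux ε (a t) (b t) (ρ t) (φ t) (κ t) x ≤
        C * (modulatedEnergy Ω ε (a t) (b t) (ρ t) (φ t) + ε ^ 2) := by
  choose M hM0 hM using fun j k => (hφ.contInLp_top_pd_pd j k).exists_ae_bound
  obtain ⟨R, hR0, hR⟩ := hφ.contInLp_top_density.exists_ae_bound
  choose K hK0 hK using fun j => (hφ.contInLp_top_grad j).exists_ae_bound
  have hS : ContinuousOn (fun t => ∫ x in Ω, ∑ j, κ t j x * κ t j x) (Icc 0 T) :=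
    (ContInLp.sum le_rfl Finset.univ fun j _ => (hφ.contInLp_grad j).mul (r := 1) le_rfl
      (hφ.contInLp_grad j)).continuousOn_integral
  obtain ⟨S, hS⟩ := isCompact_Icc.exists_bound_of_continuousOn hS
  set M' := ∑ j, ∑ k, M j k
  set K' := ∑ j, K j
  have hM0' : 0 ≤ M' := Finset.sum_nonneg fun j _ => Finset.sum_nonneg fun k _ => hM0 j k
  have hMle : ∀ j k, M j k ≤ M' := fun j k =>
    (Finset.single_le_sum (fun k _ => hM0 j k) (Finset.mem_univ k)).trans
      (Finset.single_le_sum (f := fun j => ∑ k, M j k)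
        (fun j _ => Finset.sum_nonneg fun k _ => hM0 j k) (Finset.mem_univ j))
  have hKle : ∀ j, K j ≤ K' := fun j => Finset.single_le_sum (fun k _ => hK0 k) (Finset.mem_univ j)
  have hc1 : 0 ≤ 2 * n * M' + n + 1 := by positivity
  have hc2 : 0 ≤ (R + K' ^ 2) * |S| := by positivity
  refine ⟨2 * n * M' + n + 1 + (R + K' ^ 2) * |S|, add_nonneg hc1 hc2, ?_⟩
  intro ε hε a b hu t ht
  have htI := Ioo_subset_Icc_self ht
  have hE := hu.integral_energyDensity hφ htI
  have hκ : IntegrableOn (fun x => ∑ j, κ t j x ^ 2) Ω := integrable_finsetSum _ fun j _ =>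
    ((hφ.contInLp_grad j).1 t htI).integrable_sq
  have hle : ∫ x in Ω, modulatedFlux ε (a t) (b t) (ρ t) (φ t) (κ t) x ≤
      ∫ x in Ω, ((2 * n * M' + n + 1) * energyDensity ε (a t) (b t) (ρ t) (φ t) x +
        ε ^ 2 * ((R + K' ^ 2) * ∑ j, κ t j x ^ 2)) := by
    refine integral_mono_ae (integrableOn_modulatedFlux ε (hu.re.slice t ht) (hu.im.slice t ht)
      (hφ.slice t ht) (hu.density.1 t htI)) ((hE.1.const_mul _).add
      ((hκ.const_mul _).const_mul _)) ?_
    filter_upwards [ae_all_iff.2 fun j => ae_all_iff.2 fun k => hM j k t htI, hR t htI,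
      ae_all_iff.2 fun j => hK j t htI] with x h1 h2 h3
    exact modulatedFlux_le (fun j k => (h1 j k).trans (hMle j k)) hM0' h2
      (fun j => (h3 j).trans (hKle j)) hε.1.le hε.2
  refine hle.trans ?_
  rw [integral_add (hE.1.const_mul _) ((hκ.const_mul _).const_mul _), integral_const_mul,
    integral_const_mul, integral_const_mul, hE.2]
  have h1 : ∫ x in Ω, ∑ j, κ t j x ^ 2 ≤ |S| := by
    have := (le_abs_self _).trans ((hS t htI).trans (le_abs_self S))
    simpa only [pow_two] using this
  have h2 := hu.modulatedEnergy_nonneg hφ htI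
  have h3 : ε ^ 2 * ((R + K' ^ 2) * ∫ x in Ω, ∑ j, κ t j x ^ 2) ≤
      ε ^ 2 * ((R + K' ^ 2) * |S|) := by gcongr
  nlinarith [mul_nonneg hc1 (sq_nonneg ε), mul_nonneg hc2 h2]

/-- The modulated energy estimate. -/
theorem FluidFlow.exists_modulatedEnergy_le (hΩ : IsSmoothDomain Ω) (hφ : FluidFlow T Ω ρ φ κ) :
    ∃ C : ℝ, 0 ≤ C ∧ ∀ ε ∈ Ioc (0 : ℝ) 1, ∀ a b : ℝ → Euc n → ℝ, SchrodingerFlow T Ω ε a b →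
      ∀ t ∈ Icc 0 T, modulatedEnergy Ω ε (a t) (b t) (ρ t) (φ t) ≤
        C * (modulatedEnergy Ω ε (a 0) (b 0) (ρ 0) (φ 0) + ε ^ 2) := by
  obtain ⟨C, hC0, hC⟩ := hφ.exists_integral_modulatedFlux_le
  refine ⟨Real.exp (C * T), (Real.exp_pos _).le, fun ε hε a b hu t ht => ?_⟩
  -- Adding the constant ε² to the energy makes the differential inequality homogeneous.
  have h := le_mul_exp_of_deriv_le
    (f := fun t => modulatedEnergy Ω ε (a t) (b t) (ρ t) (φ t) + ε ^ 2)
    ((hu.continuousOn_modulatedEnergy hφ).add continuousOn_const)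
    (fun t ht => (hu.hasDerivAt_modulatedEnergy hΩ hε.1.ne' hφ ht).add_const _)
    (fun t ht => hC ε hε a b hu t ht) ht
  have h0 := hu.modulatedEnergy_nonneg hφ (left_mem_Icc.2 (ht.1.trans ht.2))
  have h1 : Real.exp (C * t) ≤ Real.exp (C * T) :=
    Real.exp_le_exp.2 (mul_le_mul_of_nonneg_left ht.2 hC0)
  nlinarith [sq_nonneg ε]

end Gronwall

/-! ### From the stated regularity classes to coordinates -/

section Slicing

variable {n : ℕ} {F G : Type*} [NormedAddCommGroup F] [NormedSpace ℝ F] [NormedAddCommGroup G]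
  [NormedSpace ℝ G] {Ω : Set (Euc n)} {T : ℝ} {p : ℝ≥0∞}

theorem continuousOn_slice {F : Type*} [NormedAddCommGroup F] {f : ℝ → Euc n → F}
    (hf : ContinuousOn (fun q : ℝ × Euc n => f q.1 q.2) (Icc 0 T ×ˢ Ω)) {t : ℝ}
    (ht : t ∈ Icc 0 T) : ContinuousOn (f t) Ω :=
  hf.comp (f := fun x => (t, x)) (by fun_prop) fun _ hx => ⟨ht, hx⟩

theorem ContInC1.contDiffOn (ho : IsOpen Ω) {f : ℝ → Euc n → F} (hf : ContInC1 T Ω f) {t : ℝ}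
    (ht : t ∈ Icc 0 T) : ContDiffOn ℝ 1 (f t) Ω := by
  rw [← zero_add (1 : ℕ∞ω), contDiffOn_succ_iff_fderiv_of_isOpen ho]
  exact ⟨hf.1 t ht, by simp, contDiffOn_zero.2 (continuousOn_slice
    (f := fun t => fderiv ℝ (f t)) hf.2.2 ht)⟩

theorem ContInC2.contDiffOn (ho : IsOpen Ω) {f : ℝ → Euc n → F} (hf : ContInC2 T Ω f) {t : ℝ}
    (ht : t ∈ Icc 0 T) : ContDiffOn ℝ 2 (f t) Ω := by
  have h : ContDiffOn ℝ (1 + 1) (f t) Ω := by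
    rw [contDiffOn_succ_iff_fderiv_of_isOpen ho]
    exact ⟨hf.1.1 t ht, by simp, ContInC1.contDiffOn ho hf.2 ht⟩
  exact h.of_le one_add_one_eq_two.ge

theorem ContInC1.differentiableAt (ho : IsOpen Ω) {f : ℝ → Euc n → F} (hf : ContInC1 T Ω f)
    {t : ℝ} (ht : t ∈ Icc 0 T) {x : Euc n} (hx : x ∈ Ω) : DifferentiableAt ℝ (f t) x :=
  (hf.1 t ht x hx).differentiableAt (ho.mem_nhds hx)

theorem ContInC1.congr (ho : IsOpen Ω) {f g : ℝ → Euc n → F} (hf : ContInC1 T Ω f)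
    (h : ∀ t ∈ Icc 0 T, EqOn (g t) (f t) Ω) : ContInC1 T Ω g := by
  refine ⟨fun t ht => (hf.1 t ht).congr (h t ht), hf.2.1.congr fun q hq => h q.1 hq.1 hq.2,
    hf.2.2.congr fun q hq => ?_⟩
  exact ((h q.1 hq.1).eventuallyEq_of_mem (ho.mem_nhds hq.2)).fderiv_eq

theorem fderiv_clm_apply_comp (L : F →L[ℝ] G) {f : Euc n → F} {x : Euc n}
    (hf : DifferentiableAt ℝ f x) :
    fderiv ℝ (fun y => L (f y)) x = L.comp (fderiv ℝ f x) :=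
  (L.hasFDerivAt.comp x hf.hasFDerivAt).fderiv

theorem ContInC1.clm (ho : IsOpen Ω) (L : F →L[ℝ] G) {f : ℝ → Euc n → F} (hf : ContInC1 T Ω f) :
    ContInC1 T Ω fun t x => L (f t x) := by
  refine ⟨fun t ht => L.differentiable.comp_differentiableOn (hf.1 t ht),
    L.continuous.comp_continuousOn hf.2.1,
    (((ContinuousLinearMap.compL ℝ (Euc n) F G) L).continuous.comp_continuousOn hf.2.2).congr
      fun q hq => ?_⟩
  exact fderiv_clm_apply_comp L (hf.differentiableAt ho hq.1 hq.2)

theorem ContInC2.clm (ho : IsOpen Ω) (L : F →L[ℝ] G) {f : ℝ → Euc n → F} (hf : ContInC2 T Ω f) :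
    ContInC2 T Ω fun t x => L (f t x) :=
  ⟨hf.1.clm ho L, (ContInC1.clm ho ((ContinuousLinearMap.compL ℝ (Euc n) F G) L) hf.2).congr ho
    fun _ ht _ hx => fderiv_clm_apply_comp L (hf.1.differentiableAt ho ht hx)⟩

theorem HasWeakFDeriv.congr {f g : Euc n → F} {f' : Euc n → Euc n →L[ℝ] F}
    (h : HasWeakFDeriv Ω f f') (hfg : f =ᵐ[volume.restrict Ω] g) : HasWeakFDeriv Ω g f' := by
  refine ⟨fun x hx => ?_, h.2.1, fun η hη hc hs v => ?_⟩
  · obtain ⟨s, hs, h⟩ := h.1 x hx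
    refine ⟨s ∩ Ω, inter_mem hs self_mem_nhdsWithin, (h.mono_set inter_subset_left).congr ?_⟩
    exact ae_restrict_of_ae_restrict_of_subset inter_subset_right hfg
  · rw [← h.2.2 η hη hc hs v]
    refine integral_congr_ae ?_
    filter_upwards [hfg] with x hx
    rw [hx]

theorem ContInC1.ae_eq_fderiv [CompleteSpace F] (ho : IsOpen Ω) {f : ℝ → Euc n → F}
    (hf : ContInC1 T Ω f) {t : ℝ} (ht : t ∈ Icc 0 T) {f' : Euc n → Euc n →L[ℝ] F}
    (h : HasWeakFDeriv Ω (f t) f') : f' =ᵐ[volume.restrict Ω] fderiv ℝ (f t) :=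
  h.ae_eq_fderiv ho (hf.1 t ht) (continuousOn_slice (f := fun t => fderiv ℝ (f t)) hf.2.2 ht)

theorem ContInX1.contInLp_fderiv [CompleteSpace F] (ho : IsOpen Ω) {f : ℝ → Euc n → F}
    (hX : ContInX1 T Ω f) (hf : ContInC1 T Ω f) : ContInLp T Ω 2 fun t => fderiv ℝ (f t) :=
  let ⟨_, hG, hG2⟩ := hX.2
  hG2.congr fun t ht => hf.ae_eq_fderiv ho ht (hG t ht)

theorem ContInX2.contInLp_fderiv [CompleteSpace F] (ho : IsOpen Ω) {f : ℝ → Euc n → F}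
    (hX : ContInX2 T Ω f) (hf : ContInC2 T Ω f) : (ContInLp T Ω 2 fun t => fderiv ℝ (f t)) ∧
      ContInLp T Ω 2 fun t => fderiv ℝ (fderiv ℝ (f t)) := by
  obtain ⟨G, H, hGH, hG2, hH2⟩ := hX.2
  refine ⟨hG2.congr fun t ht => hf.1.ae_eq_fderiv ho ht (hGH t ht).1,
    hH2.congr fun t ht => ?_⟩
  -- The weak Hessian is given relative to the weak gradient. The latter must first be replaced by
  -- the classical gradient, with which it agrees almost everywhere.
  exact hf.2.ae_eq_fderiv ho ht ((hGH t ht).2.congr (hf.1.ae_eq_fderiv ho ht (hGH t ht).1))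

theorem ContInC1.continuousOn_pd {f : ℝ → Euc n → ℝ} (hf : ContInC1 T Ω f) (j : Fin n) :
    ContinuousOn (fun q : ℝ × Euc n => pd j (f q.1) q.2) (Icc 0 T ×ˢ Ω) :=
  hf.2.2.clm_apply continuousOn_const

theorem ContInC2.continuousOn_pd_pd (ho : IsOpen Ω) {f : ℝ → Euc n → ℝ} (hf : ContInC2 T Ω f)
    (i j : Fin n) :
    ContinuousOn (fun q : ℝ × Euc n => pd i (pd j (f q.1)) q.2) (Icc 0 T ×ˢ Ω) :=
  ((hf.2.2.2.clm_apply continuousOn_const).clm_apply continuousOn_const).congr fun _ hq =>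
    pd_pd_eq ho (ContInC2.contDiffOn ho hf hq.1) hq.2 i j

theorem gradient_apply (f : Euc n → ℝ) (x : Euc n) (j : Fin n) : ∇ f x j = pd j f x := by
  have h := inner_gradient_left (𝕜 := ℝ) (f := f) (x := x) (y := EuclideanSpace.single j 1)
  rw [pd, ← h, EuclideanSpace.inner_single_right]
  simp

theorem sum_smul_single (v : Euc n) : ∑ j, v j • EuclideanSpace.single j (1 : ℝ) = v := by
  simpa using (EuclideanSpace.basisFun (Fin n) ℝ).sum_repr v

theorem fderiv_apply_eq_sum (D : Euc n →L[ℝ] F) (v : Euc n) :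
    D v = ∑ j, v j • D (EuclideanSpace.single j 1) := by
  conv_lhs => rw [← sum_smul_single v]
  simp

theorem NeumannCondition.clm (L : F →L[ℝ] G) {f : Euc n → F} (ho : IsOpen Ω)
    (hf : DifferentiableOn ℝ f Ω) (h : NeumannCondition Ω f) :
    NeumannCondition Ω fun x => L (f x) := by
  obtain ⟨D, hD, hDf, hν⟩ := h
  refine ⟨fun x => L.comp (D x),
    ((ContinuousLinearMap.compL ℝ (Euc n) F G) L).continuous.comp_continuousOn hD,
    fun x hx => ?_, fun x hx ν h => by simp [hν x hx ν h]⟩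
  rw [fderiv_clm_apply_comp L ((hf x hx).differentiableAt (ho.mem_nhds hx))]
  simp only [hDf hx]

/-- By continuity of the extended gradient D, the product ∇g·∇f tends to D x (∇g x) at a boundary
point. This is a multiple of the normal derivative there, hence zero. The same continuity bounds the
gradient near the boundary. -/
theorem NeumannCondition.isNeumann {f : Euc n → ℝ} (h : NeumannCondition Ω f)
    (hf : ContDiffOn ℝ 2 f Ω) : IsNeumann Ω f := by
  obtain ⟨D, hD, hDf, hν⟩ := h
  have hlim : ∀ x ∈ frontier Ω, Tendsto D (𝓝[Ω] x) (𝓝 (D x)) := fun x hx =>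
    (hD x (frontier_subset_closure hx)).mono_left (nhdsWithin_mono _ subset_closure)
  refine ⟨hf, fun x hx g hg hloc hgx hgrad => ?_, fun j x hx => ?_⟩
  · have h0 : D x (∇ g x) = 0 := by
      have h1 := hν x hx (‖∇ g x‖⁻¹ • ∇ g x) ⟨g, hg, hloc, hgx, hgrad, rfl⟩
      rw [map_smul, smul_eq_mul] at h1
      exact (mul_eq_zero.1 h1).resolve_left (inv_ne_zero (norm_ne_zero_iff.2 hgrad))
    have h2 : Tendsto (fun y => ∑ j, pd j g y * D y (EuclideanSpace.single j 1)) (𝓝[Ω] x)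
        (𝓝 (∑ j, pd j g x * D x (EuclideanSpace.single j 1))) := by
      refine tendsto_finsetSum _ fun j _ => Tendsto.mul ?_ ?_
      · exact (((hg.continuous_fderiv (by simp)).clm_apply continuous_const).tendsto
          x).mono_left nhdsWithin_le_nhds
      · exact ((ContinuousLinearMap.apply ℝ ℝ _).continuous.tendsto _).comp (hlim x hx)
    have h3 : ∑ j, pd j g x * D x (EuclideanSpace.single j 1) = 0 := by
      rw [← h0, fderiv_apply_eq_sum (D x)]
      simp [gradient_apply]
    rw [h3] at h2
    refine h2.congr' ?_
    filter_upwards [self_mem_nhdsWithin] with y hy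
    rw [hDf hy]
    rfl
  · have h1 := (((ContinuousLinearMap.apply ℝ ℝ
      (EuclideanSpace.single j (1 : ℝ))).continuous.tendsto _).comp (hlim x hx)).abs
    refine ⟨|D x (EuclideanSpace.single j (1 : ℝ))| + 1, ?_⟩
    filter_upwards [self_mem_nhdsWithin, h1.eventually (ge_mem_nhds (lt_add_one _))] with y hy h
    rw [Function.comp_apply, hDf hy] at h
    exact h

end Slicing

/-! ### Real and imaginary parts of the wave function -/

section WaveComponents

variable {n : ℕ} {Ω : Set (Euc n)} {T ε : ℝ} {u : ℝ → Euc n → ℂ}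

/-- A general real functional `L` treats real and imaginary parts at once: every condition on u is
linear and preserved by `L`. -/
theorem IsGPSolution.waveFlow (ho : IsOpen Ω) (hu : IsGPSolution T Ω ε u) (L : ℂ →L[ℝ] ℝ) :
    WaveFlow T Ω fun t x => L (u t x) := by
  have hc := hu.classical.clm ho L
  obtain ⟨h1, h2⟩ := hu.zhidkov.contInLp_fderiv ho hu.classical
  have l1 : ∀ j, ContInLp T Ω 2 fun t => pd j fun x => L (u t x) := fun j => by
    refine (h1.clm (L.comp (ContinuousLinearMap.apply ℝ ℂ
      (EuclideanSpace.single j (1 : ℝ))))).congr fun t ht => ?_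
    filter_upwards [ae_restrict_mem ho.measurableSet] with x hx
    rw [pd, fderiv_clm_apply_comp L (hu.classical.1.differentiableAt ho ht hx)]
    rfl
  have l2 : ∀ i j, ContInLp T Ω 2 fun t => pd i (pd j fun x => L (u t x)) := fun i j => by
    refine (h2.clm (L.comp ((ContinuousLinearMap.apply ℝ ℂ
      (EuclideanSpace.single j (1 : ℝ))).comp (ContinuousLinearMap.apply ℝ (Euc n →L[ℝ] ℂ)
      (EuclideanSpace.single i (1 : ℝ)))))).congr fun t ht => ?_
    filter_upwards [ae_restrict_mem ho.measurableSet] with x hx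
    rw [pd_pd_eq ho (ContInC2.contDiffOn ho hc ht) hx]
    have e : fderiv ℝ (fun x => L (u t x)) =ᶠ[𝓝 x] fun y =>
        (ContinuousLinearMap.compL ℝ (Euc n) ℂ ℝ) L (fderiv ℝ (u t) y) := by
      filter_upwards [ho.mem_nhds hx] with y hy
      exact fderiv_clm_apply_comp L (hu.classical.1.differentiableAt ho ht hy)
    rw [e.fderiv_eq, fderiv_clm_apply_comp _ (ContInC1.differentiableAt ho hu.classical.2 ht hx)]
    rfl
  refine ⟨fun t ht => ?_, hu.zhidkov.1.clm L, l1, l2, hc.1.2.1, hc.continuousOn_pd_pd ho⟩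
  have htI := Ioo_subset_Icc_self ht
  exact ⟨((hu.neumann t ht).clm L ho (hu.classical.1.1 t htI)).isNeumann
    (ContInC2.contDiffOn ho hc htI), (hu.zhidkov.1.clm L).1 t htI, fun j => (l1 j).1 t htI,
    fun i j => (l2 i j).1 t htI⟩

theorem clm_laplacian (ho : IsOpen Ω) {w : Euc n → ℂ} (hw : ContDiffOn ℝ 2 w Ω) (L : ℂ →L[ℝ] ℝ)
    {x : Euc n} (hx : x ∈ Ω) : L (Δ w x) = lap (fun y => L (w y)) x := by
  have hd : ∀ y ∈ Ω, DifferentiableAt ℝ w y := fun y hy =>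
    (hw.differentiableOn (by simp) y hy).differentiableAt (ho.mem_nhds hy)
  have hd2 : DifferentiableAt ℝ (fderiv ℝ w) x :=
    ((hw.fderiv_of_isOpen ho (m := 1) (by norm_num)).differentiableOn one_ne_zero x
      hx).differentiableAt (ho.mem_nhds hx)
  rw [InnerProductSpace.laplacian_eq_iteratedFDeriv_orthonormalBasis w
    (EuclideanSpace.basisFun (Fin n) ℝ), lap, map_sum]
  refine Finset.sum_congr rfl fun j _ => ?_
  have e : fderiv ℝ (fun x => L (w x)) =ᶠ[𝓝 x] fun y =>
      (ContinuousLinearMap.compL ℝ (Euc n) ℂ ℝ) L (fderiv ℝ w y) := by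
    filter_upwards [ho.mem_nhds hx] with y hy
    exact fderiv_clm_apply_comp L (hd y hy)
  rw [pd_pd_eq (f := fun y => L (w y)) ho (L.contDiff.comp_contDiffOn hw) hx, e.fderiv_eq,
    fderiv_clm_apply_comp _ hd2,
    iteratedFDeriv_two_apply]
  simp

theorem IsGPSolution.schrodingerFlow (ho : IsOpen Ω) (hε : ε ≠ 0) (hu : IsGPSolution T Ω ε u) :
    SchrodingerFlow T Ω ε (fun t x => (u t x).re) (fun t x => (u t x).im) := by
  have hN : ∀ t x, ‖u t x‖ ^ 2 = (u t x).re ^ 2 + (u t x).im ^ 2 := fun t x => by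
    rw [Complex.sq_norm, Complex.normSq_apply]
    ring
  have eq : ∀ t ∈ Ioo 0 T, ∀ x ∈ Ω,
      deriv (fun s => u s x) t = ⟨-schrodingerRate ε (fun x => (u t x).im) (fun x => (u t x).re) x,
        schrodingerRate ε (fun x => (u t x).re) (fun x => (u t x).im) x⟩ := by
    intro t ht x hx
    have hc := ContInC2.contDiffOn ho hu.classical (Ioo_subset_Icc_self ht)
    have hr : (Δ (u t) x).re = lap (fun x => (u t x).re) x := clm_laplacian ho hc Complex.reCLM hx
    have hi : (Δ (u t) x).im = lap (fun x => (u t x).im) x := clm_laplacian ho hc Complex.imCLM hx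
    have h := (hu.equation t ht x hx).2
    have e1 := congrArg Complex.re h
    have e2 := congrArg Complex.im h
    rw [show ((‖u t x‖ : ℂ) ^ 2 - 1) = ((‖u t x‖ ^ 2 - 1 : ℝ) : ℂ) by push_cast; rfl,
      show (ε : ℂ) ^ 2 / 2 = ((ε ^ 2 / 2 : ℝ) : ℂ) by push_cast; rfl,
      mul_assoc] at e1 e2
    rw [Complex.add_re, Complex.I_mul_re, Complex.im_ofReal_mul, Complex.re_ofReal_mul,
      Complex.re_ofReal_mul, hr, hN] at e1
    rw [Complex.add_im, Complex.I_mul_im, Complex.re_ofReal_mul, Complex.im_ofReal_mul,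
      Complex.im_ofReal_mul, hi, hN] at e2
    apply Complex.ext
    · simp only [schrodingerRate]
      field_simp
      linarith
    · simp only [schrodingerRate]
      field_simp
      linarith
  refine ⟨hu.waveFlow ho Complex.reCLM, hu.waveFlow ho Complex.imCLM, ?_, fun t ht x hx => ?_,
    fun t ht x hx => ?_⟩
  · simpa only [hN] using hu.density
  · have h := Complex.reCLM.hasFDerivAt.comp_hasDerivAt t
      (hu.equation t ht x hx).1.hasDerivAt
    rw [eq t ht x hx] at h
    exact h
  · have h := Complex.imCLM.hasFDerivAt.comp_hasDerivAt t
      (hu.equation t ht x hx).1.hasDerivAt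
    rw [eq t ht x hx] at h
    exact h

end WaveComponents

/-! ### The Euler solution in coordinates -/

section FluidComponents

variable {n : ℕ} {Ω : Set (Euc n)} {T : ℝ}

theorem fderiv_eq_sum_proj (f : Euc n → ℝ) (x : Euc n) :
    fderiv ℝ f x = ∑ j, pd j f x • EuclideanSpace.proj (𝕜 := ℝ) j := by
  ext v
  rw [fderiv_apply_eq_sum]
  simp [pd, mul_comm]

/-- The trace of a bounded operator in coordinates. -/
def traceCLM (n : ℕ) : (Euc n →L[ℝ] Euc n) →L[ℝ] ℝ :=
  ∑ j, (EuclideanSpace.proj (𝕜 := ℝ) j).comp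
    (ContinuousLinearMap.apply ℝ (Euc n) (EuclideanSpace.single j (1 : ℝ)))

theorem traceCLM_apply (A : Euc n →L[ℝ] Euc n) :
    traceCLM n A = ∑ j, A (EuclideanSpace.single j 1) j := by
  simp [traceCLM]

theorem differentiableAt_gradient {f : Euc n → ℝ} {x : Euc n}
    (hf : DifferentiableAt ℝ (fderiv ℝ f) x) : DifferentiableAt ℝ (∇ f) x :=
  ((InnerProductSpace.toDual ℝ (Euc n)).symm.toContinuousLinearEquiv.differentiable _).comp x hf

theorem fderiv_gradient_apply {f : Euc n → ℝ} {x : Euc n}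
    (hf : DifferentiableAt ℝ (fderiv ℝ f) x) (i j : Fin n) :
    fderiv ℝ (∇ f) x (EuclideanSpace.single i 1) j = pd i (pd j f) x := by
  have h := fderiv_clm_apply_comp (EuclideanSpace.proj (𝕜 := ℝ) j) (differentiableAt_gradient hf)
  have e : (fun y => EuclideanSpace.proj (𝕜 := ℝ) j (∇ f y)) = pd j f :=
    funext fun y => gradient_apply f y j
  rw [e] at h
  rw [pd, h]
  rfl

theorem ContInC2.gradient (ho : IsOpen Ω) {φ : ℝ → Euc n → ℝ} (hφ : ContInC2 T Ω φ) :
    ContInC1 T Ω fun t => ∇ (φ t) :=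
  (ContInC1.clm ho (∑ j, (ContinuousLinearMap.apply ℝ ℝ
    (EuclideanSpace.single j (1 : ℝ))).smulRight (EuclideanSpace.single j (1 : ℝ)) :
    (Euc n →L[ℝ] ℝ) →L[ℝ] Euc n) hφ.2).congr ho fun t _ x _ => by
      rw [← sum_smul_single (∇ (φ t) x)]
      simp [gradient_apply, pd]

variable {ρ φ : ℝ → Euc n → ℝ}

theorem divergence_smul_gradient {ρ φ : Euc n → ℝ} {x : Euc n} (hρ : DifferentiableAt ℝ ρ x)
    (hφ : DifferentiableAt ℝ (fderiv ℝ φ) x) :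
    divergence (fun y => ρ y • ∇ φ y) x = gd ρ φ x + ρ x * lap φ x := by
  rw [divergence, gd, lap, Finset.mul_sum, ← Finset.sum_add_distrib]
  refine Finset.sum_congr rfl fun j _ => ?_
  rw [fderiv_fun_smul hρ (differentiableAt_gradient hφ), ← fderiv_gradient_apply hφ j j,
    ← gradient_apply φ x j]
  simp [pd, add_comm]

/-- The Bernoulli equation gives ∂ₜφ = −(½|∇φ|² + ρ) + 1, whose spatial gradient is continuous in
space and time. The time derivative may therefore be exchanged with ∇, without assuming that ∂ₜ∇φ
exists. -/
theorem IsEulerSolution.hasDerivAt_pd (ho : IsOpen Ω) (h : IsEulerSolution T Ω ρ φ) {t : ℝ}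
    (ht : t ∈ Ioo 0 T) {x : Euc n} (hx : x ∈ Ω) (j : Fin n) :
    HasDerivAt (fun s => pd j (φ s) x) (velocityRate (ρ t) (φ t) j x) t := by
  have hφ2 : ∀ t ∈ Icc 0 T, ContDiffOn ℝ 2 (φ t) Ω := fun t ht =>
    ContInC2.contDiffOn ho h.classical_phase ht
  have hgd : ∀ t ∈ Ioo 0 T, ∀ x ∈ Ω, DifferentiableAt ℝ (gd (φ t) (φ t)) x := fun t ht x hx =>
    differentiableAt_of_contDiffOn ho (contDiffOn_gd ho (hφ2 t (Ioo_subset_Icc_self ht))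
      (hφ2 t (Ioo_subset_Icc_self ht))) hx
  have hρd : ∀ t ∈ Ioo 0 T, ∀ x ∈ Ω, DifferentiableAt ℝ (ρ t) x := fun t ht x hx =>
    h.classical_density.differentiableAt ho (Ioo_subset_Icc_self ht) hx
  have hf : ∀ t ∈ Ioo 0 T, ∀ x ∈ Ω, ∀ j, pd j (fun x => -(1 / 2 * gd (φ t) (φ t) x + ρ t x) + 1) x =
      velocityRate (ρ t) (φ t) j x := fun t ht x hx j => by
    have d1 := (hgd t ht x hx).hasFDerivAt.const_mul (1 / 2)
    have d2 := ((d1.add (hρd t ht x hx).hasFDerivAt).neg.add_const 1).fderiv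
    rw [pd]
    refine (congrArg (fun D : Euc n →L[ℝ] ℝ => D (EuclideanSpace.single j 1)) d2).trans ?_
    simp [velocityRate, pd]
  have key := hasDerivAt_fderiv (T := T) ho (φ := φ)
    (f := fun t x => -(1 / 2 * gd (φ t) (φ t) x + ρ t x) + 1) (fun t ht x hx => ?_)
    (fun t ht => h.classical_phase.1.1 t (Ioo_subset_Icc_self ht)) (fun t ht x hx => ?_) ?_ ht hx
  · have h1 := ((ContinuousLinearMap.apply ℝ ℝ
      (EuclideanSpace.single j (1 : ℝ))).hasFDerivAt.comp_hasDerivAt t key)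
    rw [← hf t ht x hx j]
    exact h1
  · obtain ⟨d, e⟩ := h.bernoulli t ht x hx
    refine d.hasDerivAt.congr_deriv ?_
    have : ‖∇ (φ t) x‖ ^ 2 = gd (φ t) (φ t) x := by
      rw [EuclideanSpace.norm_sq_eq, gd]
      refine Finset.sum_congr rfl fun j _ => ?_
      rw [gradient_apply, Real.norm_eq_abs, sq_abs, pow_two]
    rw [this] at e
    linarith
  · exact ((((hgd t ht x hx).const_mul (1 / 2)).add (hρd t ht x hx)).neg.add_const
      1).differentiableWithinAt
  · have hc : ContinuousOn (fun q : ℝ × Euc n => ∑ j, velocityRate (ρ q.1) (φ q.1) j q.2 •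
        EuclideanSpace.proj (𝕜 := ℝ) j) (Ioo 0 T ×ˢ Ω) :=
      continuousOn_finsetSum _ fun j _ => ((continuousOn_velocityRate ho hφ2
        h.classical_phase.1.continuousOn_pd (h.classical_phase.continuousOn_pd_pd ho)
        h.classical_density.continuousOn_pd j).mono
        (prod_mono Ioo_subset_Icc_self subset_rfl)).smul continuousOn_const
    refine hc.congr fun q hq => ?_
    rw [fderiv_eq_sum_proj]
    exact Finset.sum_congr rfl fun j _ => by rw [hf q.1 hq.1 q.2 hq.2 j]

/-- κ is the trace, over the two Hessian indices, of the weak third derivative B of φ. Commuting the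
trace with the weak derivative makes it the weak gradient of Δφ, with the L² and L^∞ continuity of
B. -/
theorem IsEulerSolution.exists_fluidFlow (ho : IsOpen Ω) (h : IsEulerSolution T Ω ρ φ) :
    ∃ κ, FluidFlow T Ω ρ φ κ := by
  obtain ⟨A, B, hAB, hp⟩ := h.phase
  have hφ2 : ∀ t ∈ Icc 0 T, ContDiffOn ℝ 2 (φ t) Ω := fun t ht =>
    ContInC2.contDiffOn ho h.classical_phase ht
  have hd2 : ∀ t ∈ Icc 0 T, ∀ x ∈ Ω, DifferentiableAt ℝ (fderiv ℝ (φ t)) x := fun t ht x hx =>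
    ContInC1.differentiableAt ho h.classical_phase.2 ht hx
  have hA : ∀ t ∈ Icc 0 T, A t =ᵐ[volume.restrict Ω] fderiv ℝ (∇ (φ t)) := fun t ht =>
    (h.classical_phase.gradient ho).ae_eq_fderiv ho ht (hAB t ht).1
  have v1 : ∀ p : ℝ≥0∞, p = 2 ∨ p = ⊤ → ∀ j, ContInLp T Ω p fun t => pd j (φ t) := fun p h2 j => by
    have h3 := (hp p h2).1.clm (EuclideanSpace.proj (𝕜 := ℝ) j)
    refine h3.congr fun t _ => Eventually.of_forall fun x => ?_
    exact gradient_apply (φ t) x j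
  have v2 : ∀ p : ℝ≥0∞, p = 2 ∨ p = ⊤ → ∀ i j, ContInLp T Ω p fun t => pd i (pd j (φ t)) :=
    fun p h2 i j => by
      refine ((hp p h2).2.1.clm ((EuclideanSpace.proj (𝕜 := ℝ) j).comp
        (ContinuousLinearMap.apply ℝ (Euc n) (EuclideanSpace.single i (1 : ℝ))))).congr
        fun t ht => ?_
      filter_upwards [hA t ht, ae_restrict_mem ho.measurableSet] with x h3 hx
      rw [← fderiv_gradient_apply (hd2 t ht x hx), ← h3]
      rfl
  have v3 : ∀ p : ℝ≥0∞, p = 2 ∨ p = ⊤ → ∀ j : Fin n, ContInLp T Ω p fun t x =>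
      traceCLM n (B t x (EuclideanSpace.single j 1)) := fun p h2 j =>
    ((hp p h2).2.2.clm (ContinuousLinearMap.apply ℝ (Euc n →L[ℝ] Euc n)
      (EuclideanSpace.single j (1 : ℝ)))).clm (traceCLM n)
  have r1 : ∀ j, ContInLp T Ω 2 fun t => pd j (ρ t) := fun j =>
    (h.zhidkov.contInLp_fderiv ho h.classical_density).clm
      (ContinuousLinearMap.apply ℝ ℝ (EuclideanSpace.single j (1 : ℝ)))
  have hw : ∀ t ∈ Icc 0 T, HasWeakGrad Ω (lap (φ t))
      fun j x => traceCLM n (B t x (EuclideanSpace.single j 1)) := fun t ht => by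
    refine ((hAB t ht).2.hasWeakGrad (traceCLM n)).congr ?_
    filter_upwards [hA t ht, ae_restrict_mem ho.measurableSet] with x h3 hx
    rw [traceCLM_apply, h3, lap]
    exact Finset.sum_congr rfl fun j _ => fderiv_gradient_apply (hd2 t ht x hx) j j
  refine ⟨fun t j x => traceCLM n (B t x (EuclideanSpace.single j 1)), fun t ht => ?_, hφ2,
    v1 2 (.inl rfl), v1 ⊤ (.inr rfl), v2 2 (.inl rfl), v2 ⊤ (.inr rfl), h.zhidkov.1, h.density, r1,
    v3 2 (.inl rfl), v3 ⊤ (.inr rfl), h.classical_phase.1.continuousOn_pd,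
    h.classical_phase.continuousOn_pd_pd ho, h.classical_density.2.1,
    h.classical_density.continuousOn_pd, fun t ht x hx j => h.hasDerivAt_pd ho ht hx j,
    fun t ht x hx => ?_⟩
  · have htI := Ioo_subset_Icc_self ht
    exact ⟨(h.neumann t ht).isNeumann (hφ2 t htI), fun j => (v1 2 (.inl rfl) j).1 t htI,
      fun j => (v1 ⊤ (.inr rfl) j).1 t htI, fun i j => (v2 2 (.inl rfl) i j).1 t htI,
      fun i j => (v2 ⊤ (.inr rfl) i j).1 t htI, h.classical_density.contDiffOn ho htI,
      h.zhidkov.1.1 t htI, h.density.1 t htI, fun j => (r1 j).1 t htI, hw t htI,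
      fun j => (v3 2 (.inl rfl) j).1 t htI⟩
  · have htI := Ioo_subset_Icc_self ht
    obtain ⟨d, e⟩ := h.continuity t ht x hx
    rw [divergence_smul_gradient (h.classical_density.differentiableAt ho htI hx)
      (hd2 t htI x hx)] at e
    exact d.hasDerivAt.congr_deriv (by linarith)

end FluidComponents

/-! ### The modulated energy density in terms of u -/

section Convergence

variable {n : ℕ} {Ω : Set (Euc n)} {T ε : ℝ}

theorem eLpNorm_two_le_iff {α F : Type*} [MeasurableSpace α] {μ : Measure α}
    [NormedAddCommGroup F] {f : α → F} (hf : MemLp f 2 μ) {c : ℝ} (hc : 0 ≤ c) :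
    eLpNorm f 2 μ ≤ ENNReal.ofReal c ↔ ∫ x, ‖f x‖ ^ 2 ∂μ ≤ c ^ 2 := by
  have h0 : 0 ≤ ∫ x, ‖f x‖ ^ 2 ∂μ := integral_nonneg fun x => by positivity
  rw [hf.eLpNorm_eq_integral_rpow_norm two_ne_zero ENNReal.ofNat_ne_top,
    ENNReal.ofReal_le_ofReal_iff hc]
  simp only [ENNReal.toReal_ofNat, Real.rpow_two]
  rw [← one_div, ← Real.sqrt_eq_rpow, Real.sqrt_le_left hc]

variable {u : Euc n → ℂ} {ρ φ : Euc n → ℝ}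

theorem cpartial_eq {x : Euc n} (hu : DifferentiableAt ℝ u x) (j : Fin n) :
    cpartial u j x = ⟨pd j (fun y => (u y).re) x, pd j (fun y => (u y).im) x⟩ := by
  have h1 := fderiv_clm_apply_comp Complex.reCLM hu
  have h2 := fderiv_clm_apply_comp Complex.imCLM hu
  apply Complex.ext
  · exact (congrArg (fun D : Euc n →L[ℝ] ℝ => D (EuclideanSpace.single j 1)) h1).symm
  · exact (congrArg (fun D : Euc n →L[ℝ] ℝ => D (EuclideanSpace.single j 1)) h2).symm

theorem modulatedGradient_apply {x : Euc n} (hu : DifferentiableAt ℝ u x) (j : Fin n) :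
    modulatedGradient ε u φ x j =
      ⟨ε * pd j (fun y => (u y).re) x + (u x).im * pd j φ x,
        ε * pd j (fun y => (u y).im) x - (u x).re * pd j φ x⟩ := by
  simp only [modulatedGradient, cpartial_eq hu, gradient_apply]
  apply Complex.ext <;> simp

theorem two_mul_energyDensity {x : Euc n} (hu : DifferentiableAt ℝ u x) :
    2 * energyDensity ε (fun y => (u y).re) (fun y => (u y).im) ρ φ x =
      ‖modulatedGradient ε u φ x‖ ^ 2 + ‖‖u x‖ ^ 2 - ρ x‖ ^ 2 := by
  rw [EuclideanSpace.norm_sq_eq, Real.norm_eq_abs, sq_abs, Complex.sq_norm, Complex.normSq_apply,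
    energyDensity]
  simp only [modulatedGradient_apply hu, Complex.sq_norm, Complex.normSq_apply, ← pow_two]
  ring

/-- Multiplying the modulated gradient by ū and taking imaginary parts gives ε Im(ū∇u) − |u|²∇φ. The
momentum error is this plus (|u|² − ρ)∇φ. -/
theorem norm_momentum_sub_le {x : Euc n} (hu : DifferentiableAt ℝ u x) :
    ‖momentum ε u x - ρ x • ∇ φ x‖ ≤
      ‖u x‖ * ‖modulatedGradient ε u φ x‖ + ‖‖u x‖ ^ 2 - ρ x‖ * ‖∇ φ x‖ := by
  have e : momentum ε u x - ρ x • ∇ φ x = WithLp.toLp 2 (fun j =>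
      (starRingEnd ℂ (u x) * modulatedGradient ε u φ x j).im) + (‖u x‖ ^ 2 - ρ x) • ∇ φ x := by
    ext j
    simp only [momentum, modulatedGradient_apply hu, cpartial_eq hu, Complex.sq_norm,
      Complex.normSq_apply, PiLp.sub_apply, PiLp.add_apply, PiLp.smul_apply, smul_eq_mul,
      gradient_apply, Complex.mul_im, Complex.conj_re, Complex.conj_im]
    ring
  rw [e]
  refine (norm_add_le _ _).trans (add_le_add ?_ (norm_smul_le _ _))
  refine (pow_le_pow_iff_left₀ (norm_nonneg _) (by positivity) two_ne_zero).1 ?_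
  rw [mul_pow, EuclideanSpace.norm_sq_eq, EuclideanSpace.norm_sq_eq, Finset.mul_sum]
  refine Finset.sum_le_sum fun j _ => ?_
  rw [← mul_pow, ← Complex.norm_conj (u x), ← norm_mul]
  refine pow_le_pow_left₀ (norm_nonneg _) ?_ 2
  exact Complex.abs_im_le_norm _

end Convergence

/-! ### The O(ε²) energy bound and its two consequences -/

section MainEstimate

variable {n : ℕ} {Ω : Set (Euc n)} {T : ℝ} {ρ φ : ℝ → Euc n → ℝ}

/-- The initial modulated energy of well-prepared data. -/
theorem integral_energyDensity_le_of_eLpNorm_le {ε c : ℝ} {u : Euc n → ℂ} {ρ φ : Euc n → ℝ}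
    (ho : IsOpen Ω) (hu : DifferentiableOn ℝ u Ω)
    (hM : AEStronglyMeasurable (modulatedGradient ε u φ) (volume.restrict Ω))
    (hq : AEStronglyMeasurable (fun x => ‖u x‖ ^ 2 - ρ x) (volume.restrict Ω)) (hc : 0 ≤ c)
    (h : eLpNorm (modulatedGradient ε u φ) 2 (volume.restrict Ω) +
      eLpNorm (fun x => ‖u x‖ ^ 2 - ρ x) 2 (volume.restrict Ω) ≤ ENNReal.ofReal c) :
    ∫ x in Ω, energyDensity ε (fun y => (u y).re) (fun y => (u y).im) ρ φ x ≤ c ^ 2 := by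
  have b1 := le_self_add.trans h
  have b2 := le_add_self.trans h
  have m1 : MemLp (modulatedGradient ε u φ) 2 (volume.restrict Ω) :=
    ⟨hM, b1.trans_lt ENNReal.ofReal_lt_top⟩
  have m2 : MemLp (fun x => ‖u x‖ ^ 2 - ρ x) 2 (volume.restrict Ω) :=
    ⟨hq, b2.trans_lt ENNReal.ofReal_lt_top⟩
  rw [eLpNorm_two_le_iff m1 hc] at b1
  rw [eLpNorm_two_le_iff m2 hc] at b2
  have e : ∫ x in Ω, 2 * energyDensity ε (fun y => (u y).re) (fun y => (u y).im) ρ φ x =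
      ∫ x in Ω, (‖modulatedGradient ε u φ x‖ ^ 2 + ‖‖u x‖ ^ 2 - ρ x‖ ^ 2) :=
    setIntegral_congr_fun ho.measurableSet fun x hx =>
      two_mul_energyDensity ((hu x hx).differentiableAt (ho.mem_nhds hx))
  rw [integral_const_mul, integral_add (m1.integrable_norm_pow two_ne_zero)
    (m2.integrable_norm_pow two_ne_zero)] at e
  linarith

theorem IsGPSolution.aestronglyMeasurable_modulatedGradient {ε t : ℝ} {u : ℝ → Euc n → ℂ}
    (ho : IsOpen Ω) (hu : IsGPSolution T Ω ε u) (hφ : ContInC2 T Ω φ) (ht : t ∈ Icc 0 T) :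
    AEStronglyMeasurable (modulatedGradient ε (u t) (φ t)) (volume.restrict Ω) := by
  refine ContinuousOn.aestronglyMeasurable ?_ ho.measurableSet
  refine (PiLp.continuous_toLp 2 _).comp_continuousOn (continuousOn_pi.2 fun j => ?_)
  have h1 : ContinuousOn (fun x => cpartial (u t) j x) Ω :=
    (continuousOn_slice (f := fun t => fderiv ℝ (u t)) hu.classical.1.2.2 ht).clm_apply
      continuousOn_const
  have h2 : ContinuousOn (fun x => ∇ (φ t) x j) Ω := by
    simp only [gradient_apply]
    exact continuousOn_pd ho ((ContInC2.contDiffOn ho hφ ht).of_le one_le_two) j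
  exact (continuousOn_const.mul h1).sub ((continuousOn_const.mul
    (continuousOn_slice hu.classical.1.2.1 ht)).mul
    (Complex.continuous_ofReal.comp_continuousOn h2))

/-- The modulated energy of well-prepared solutions is `O(ε²)`. -/
theorem IsEulerSolution.exists_integral_energyDensity_le (hΩ : IsSmoothDomain Ω)
    (h : IsEulerSolution T Ω ρ φ) (C₀ : ℝ) :
    ∃ C : ℝ, 0 ≤ C ∧ ∀ ε ∈ Ioc (0 : ℝ) 1, ∀ u : ℝ → Euc n → ℂ, IsGPSolution T Ω ε u →
      eLpNorm (modulatedGradient ε (u 0) (φ 0)) 2 (volume.restrict Ω) +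
        eLpNorm (fun x => ‖u 0 x‖ ^ 2 - ρ 0 x) 2 (volume.restrict Ω) ≤ ENNReal.ofReal (C₀ * ε) →
      ∀ t ∈ Icc 0 T,
        IntegrableOn (energyDensity ε (fun y => (u t y).re) (fun y => (u t y).im) (ρ t) (φ t)) Ω ∧
        MemLp (fun x => ‖u t x‖ ^ 2 - ρ t x) 2 (volume.restrict Ω) ∧
        ∫ x in Ω, energyDensity ε (fun y => (u t y).re) (fun y => (u t y).im) (ρ t) (φ t) x ≤
          C * ε ^ 2 := by
  have ho := hΩ.isOpen
  obtain ⟨κ, hφ⟩ := h.exists_fluidFlow ho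
  obtain ⟨C, hC0, hC⟩ := hφ.exists_modulatedEnergy_le hΩ
  -- |C₀|²ε² bounds the initial energy and the 1 accounts for the ε² remainder of the energy
  -- estimate. The absolute value covers a negative C₀.
  refine ⟨C * (|C₀| ^ 2 + 1), by positivity, fun ε hε u hu hin t ht => ?_⟩
  have hs := hu.schrodingerFlow ho hε.1.ne'
  have h0 : (0 : ℝ) ∈ Icc 0 T := left_mem_Icc.2 (ht.1.trans ht.2)
  have hq : ∀ t ∈ Icc 0 T, MemLp (fun x => ‖u t x‖ ^ 2 - ρ t x) 2 (volume.restrict Ω) :=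
    fun t ht => by simpa using (hu.density.sub one_le_two h.density).1 t ht
  have hle := hC ε hε _ _ hs t ht
  rw [← (hs.integral_energyDensity hφ ht).2, ← (hs.integral_energyDensity hφ h0).2] at hle
  refine ⟨(hs.integral_energyDensity hφ ht).1, hq t ht, hle.trans ?_⟩
  have hc0 : 0 ≤ |C₀| * ε := mul_nonneg (abs_nonneg _) hε.1.le
  have hin' := integral_energyDensity_le_of_eLpNorm_le ho (hu.classical.1.1 0 h0)
    (hu.aestronglyMeasurable_modulatedGradient ho h.classical_phase h0) (hq 0 h0).1 hc0
    (hin.trans (ENNReal.ofReal_le_ofReal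
      (mul_le_mul_of_nonneg_right (le_abs_self _) hε.1.le)))
  rw [mul_assoc]
  refine mul_le_mul_of_nonneg_left ?_ hC0
  linarith

/-- Twice the energy density dominates (|u|² − ρ)², so the squared L² norm is at most 2Cε². -/
theorem exists_eLpNorm_density_le (hΩ : IsSmoothDomain Ω) (h : IsEulerSolution T Ω ρ φ) (C₀ : ℝ) :
    ∃ C : ℝ, ∀ ε ∈ Ioc (0 : ℝ) 1, ∀ u : ℝ → Euc n → ℂ, IsGPSolution T Ω ε u →
      eLpNorm (modulatedGradient ε (u 0) (φ 0)) 2 (volume.restrict Ω) +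
        eLpNorm (fun x => ‖u 0 x‖ ^ 2 - ρ 0 x) 2 (volume.restrict Ω) ≤ ENNReal.ofReal (C₀ * ε) →
      ∀ t ∈ Icc 0 T,
        eLpNorm (fun x => ‖u t x‖ ^ 2 - ρ t x) 2 (volume.restrict Ω) ≤ ENNReal.ofReal (C * ε) := by
  obtain ⟨C, hC0, hC⟩ := h.exists_integral_energyDensity_le hΩ C₀
  refine ⟨Real.sqrt (2 * C), fun ε hε u hu hin t ht => ?_⟩
  obtain ⟨hi, hq, hle⟩ := hC ε hε u hu hin t ht
  have ho := hΩ.isOpen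
  rw [eLpNorm_two_le_iff hq (mul_nonneg (Real.sqrt_nonneg _) hε.1.le), mul_pow,
    Real.sq_sqrt (by positivity), mul_assoc]
  refine (setIntegral_mono_on (hq.integrable_norm_pow two_ne_zero) (hi.const_mul 2)
    ho.measurableSet fun x hx => ?_).trans ((integral_const_mul _ _).trans_le
      (mul_le_mul_of_nonneg_left hle zero_le_two))
  rw [two_mul_energyDensity (hu.classical.1.differentiableAt ho ht hx)]
  exact le_add_of_nonneg_left (by positivity)

/-- Young's inequality with weights ε and ε⁻¹ balances the two kinds of factors. The modulated
gradient and the density gap have squared L² norms O(ε²), which becomes O(ε) after division by ε.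
The squares of |u| and |∇φ| are multiplied by ε, and their bounded part is integrable only on Ω ∩ K.
This is the source of the dependence on K. -/
theorem exists_eLpNorm_momentum_le (hΩ : IsSmoothDomain Ω) (h : IsEulerSolution T Ω ρ φ) (C₀ : ℝ)
    {K : Set (Euc n)} (hK : IsCompact K) :
    ∃ C : ℝ, ∀ ε ∈ Ioc (0 : ℝ) 1, ∀ u : ℝ → Euc n → ℂ, IsGPSolution T Ω ε u →
      eLpNorm (modulatedGradient ε (u 0) (φ 0)) 2 (volume.restrict Ω) +
        eLpNorm (fun x => ‖u 0 x‖ ^ 2 - ρ 0 x) 2 (volume.restrict Ω) ≤ ENNReal.ofReal (C₀ * ε) →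
      ∀ t ∈ Icc 0 T, eLpNorm (fun x => momentum ε (u t) x - ρ t x • ∇ (φ t) x) 1
        (volume.restrict (Ω ∩ K)) ≤ ENNReal.ofReal (C * ε) := by
  obtain ⟨C, hC0, hC⟩ := h.exists_integral_energyDensity_le hΩ C₀
  obtain ⟨R, hR0, hR⟩ := h.zhidkov.1.exists_ae_bound
  obtain ⟨A, B, -, hp⟩ := h.phase
  obtain ⟨V, hV0, hV⟩ := (hp ⊤ (.inr rfl)).1.exists_ae_bound
  have ho := hΩ.isOpen
  set D := 1 / 2 * (R + 1 + V ^ 2)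
  refine ⟨D * volume.real (Ω ∩ K) + 2 * C, fun ε hε u hu hin t ht => ?_⟩
  obtain ⟨hi, -, hle⟩ := hC ε hε u hu hin t ht
  set E := energyDensity ε (fun y => (u t y).re) (fun y => (u t y).im) (ρ t) (φ t) with hE
  have hE0 : ∀ x, 0 ≤ E x := fun x => energyDensity_nonneg _ _ _ _ _ x
  have hfin : volume (Ω ∩ K) ≠ ⊤ :=
    ((measure_mono inter_subset_right).trans_lt hK.measure_lt_top).ne
  have hbound : ∀ᵐ x ∂(volume.restrict (Ω ∩ K)), ‖momentum ε (u t) x - ρ t x • ∇ (φ t) x‖ ≤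
      ε * D + (ε + ε⁻¹) * E x := by
    refine ae_restrict_of_ae_restrict_of_subset inter_subset_left ?_
    filter_upwards [hR t ht, hV t ht, ae_restrict_mem ho.measurableSet] with x h1 h2 hx
    have hd := hu.classical.1.differentiableAt ho ht hx
    refine (norm_momentum_sub_le hd).trans ?_
    have e2 := two_mul_energyDensity (ε := ε) (ρ := ρ t) (φ := φ t) hd
    rw [← hE] at e2
    set m := ‖modulatedGradient ε (u t) (φ t) x‖
    set q := ‖‖u t x‖ ^ 2 - ρ t x‖ with hq
    have hq0 : 0 ≤ q := norm_nonneg _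
    -- From |u|² ≤ ρ + q and q ≤ 1 + q². The q² is absorbed by the energy density, so |u| needs no
    -- bound uniform in ε.
    have u2 : ‖u t x‖ ^ 2 ≤ R + 1 + q ^ 2 := by
      have h3 : ‖u t x‖ ^ 2 - ρ t x ≤ q := le_abs_self _
      have h4 : ρ t x ≤ R := (le_abs_self _).trans h1
      nlinarith [sq_nonneg (q - 1)]
    have amgm : ∀ y z : ℝ, y * z ≤ 1 / 2 * (ε * y ^ 2 + ε⁻¹ * z ^ 2) := fun y z => by
      have h5 : 1 / 2 * (ε * y ^ 2 + ε⁻¹ * z ^ 2) - y * z = 1 / 2 * ε⁻¹ * (ε * y - z) ^ 2 := by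
        have := hε.1.ne'
        field_simp
        ring
      have h6 : 0 ≤ 1 / 2 * ε⁻¹ * (ε * y - z) ^ 2 :=
        mul_nonneg (mul_nonneg (by norm_num) (inv_nonneg.2 hε.1.le)) (sq_nonneg _)
      linarith
    have a1 := amgm ‖u t x‖ m
    have a2 := amgm ‖∇ (φ t) x‖ q
    have a3 : ε * ‖u t x‖ ^ 2 ≤ ε * (R + 1 + q ^ 2) := mul_le_mul_of_nonneg_left u2 hε.1.le
    have a4 : ε * ‖∇ (φ t) x‖ ^ 2 ≤ ε * V ^ 2 :=
      mul_le_mul_of_nonneg_left (pow_le_pow_left₀ (norm_nonneg _) h2 2) hε.1.le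
    have e3 : E x = 1 / 2 * (m ^ 2 + q ^ 2) := by linarith
    have a5 : 0 ≤ ε * m ^ 2 := mul_nonneg hε.1.le (sq_nonneg _)
    rw [e3]
    simp only [D]
    linarith
  have hiE : IntegrableOn (fun x => ε * D + (ε + ε⁻¹) * E x) (Ω ∩ K) :=
    (integrableOn_const hfin).add ((hi.mono_set inter_subset_left).const_mul _)
  have hnn : ∀ x, 0 ≤ ε * D + (ε + ε⁻¹) * E x := fun x =>
    add_nonneg (mul_nonneg hε.1.le (by positivity)) (mul_nonneg
      (add_nonneg hε.1.le (inv_nonneg.2 hε.1.le)) (hE0 x))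
  rw [eLpNorm_one_eq_lintegral_enorm]
  calc ∫⁻ x in Ω ∩ K, ‖momentum ε (u t) x - ρ t x • ∇ (φ t) x‖ₑ
      ≤ ∫⁻ x in Ω ∩ K, ENNReal.ofReal (ε * D + (ε + ε⁻¹) * E x) := by
        refine lintegral_mono_ae (hbound.mono fun x hx => ?_)
        rw [← ofReal_norm]
        exact ENNReal.ofReal_le_ofReal hx
    _ = ENNReal.ofReal (∫ x in Ω ∩ K, (ε * D + (ε + ε⁻¹) * E x)) :=
        (ofReal_integral_eq_lintegral_ofReal hiE (Eventually.of_forall hnn)).symm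
    _ ≤ ENNReal.ofReal ((D * volume.real (Ω ∩ K) + 2 * C) * ε) := by
        refine ENNReal.ofReal_le_ofReal ?_
        have h1 : ∫ x in Ω ∩ K, E x ≤ C * ε ^ 2 :=
          (setIntegral_mono_set hi (Eventually.of_forall hE0)
            inter_subset_left.eventuallyLE).trans hle
        have hconst : Integrable (fun _ : Euc n => ε * D) (volume.restrict (Ω ∩ K)) :=
          integrableOn_const hfin
        rw [integral_add hconst ((hi.mono_set inter_subset_left).const_mul _),
          setIntegral_const, smul_eq_mul, integral_const_mul]
        have h2 : (ε + ε⁻¹) * ∫ x in Ω ∩ K, E x ≤ (ε + ε⁻¹) * (C * ε ^ 2) :=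
          mul_le_mul_of_nonneg_left h1 (add_nonneg hε.1.le (inv_nonneg.2 hε.1.le))
        have h3 : (ε + ε⁻¹) * (C * ε ^ 2) = C * ε * ε ^ 2 + C * ε := by
          have := hε.1.ne'
          field_simp
        have h4 : C * ε * ε ^ 2 ≤ C * ε := mul_le_of_le_one_right (mul_nonneg hC0 hε.1.le)
          (pow_le_one₀ hε.1.le hε.2)
        linarith

end MainEstimate

end GPHydro

end

theorem theorem6p1 (n : ℕ) (hn : n = 2 ∨ n = 3) (Ω : Set (EuclideanSpace ℝ (Fin n)))
    (hΩ : GPHydro.IsSmoothDomain Ω) (T : ℝ) (hT : 0 < T)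
    (ρ φ : ℝ → EuclideanSpace ℝ (Fin n) → ℝ) (hρφ : GPHydro.IsEulerSolution T Ω ρ φ) (C₀ : ℝ) :
    (∃ C : ℝ, ∀ ε ∈ Set.Ioc (0 : ℝ) 1, ∀ u : ℝ → EuclideanSpace ℝ (Fin n) → ℂ,
      GPHydro.IsGPSolution T Ω ε u →
      eLpNorm (GPHydro.modulatedGradient ε (u 0) (φ 0)) 2 (volume.restrict Ω) +
        eLpNorm (fun x => ‖u 0 x‖ ^ 2 - ρ 0 x) 2 (volume.restrict Ω) ≤ ENNReal.ofReal (C₀ * ε) →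
      ∀ t ∈ Set.Icc 0 T,
        eLpNorm (fun x => ‖u t x‖ ^ 2 - ρ t x) 2 (volume.restrict Ω) ≤ ENNReal.ofReal (C * ε)) ∧
    (∀ K : Set (EuclideanSpace ℝ (Fin n)), IsCompact K →
      ∃ C : ℝ, ∀ ε ∈ Set.Ioc (0 : ℝ) 1, ∀ u : ℝ → EuclideanSpace ℝ (Fin n) → ℂ,
      GPHydro.IsGPSolution T Ω ε u →
      eLpNorm (GPHydro.modulatedGradient ε (u 0) (φ 0)) 2 (volume.restrict Ω) +
        eLpNorm (fun x => ‖u 0 x‖ ^ 2 - ρ 0 x) 2 (volume.restrict Ω) ≤ ENNReal.ofReal (C₀ * ε) →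
      ∀ t ∈ Set.Icc 0 T,
        eLpNorm (fun x => GPHydro.momentum ε (u t) x - ρ t x • gradient (φ t) x) 1
          (volume.restrict (Ω ∩ K)) ≤ ENNReal.ofReal (C * ε)) := by
  exact ⟨GPHydro.exists_eLpNorm_density_le hΩ hρφ C₀,
    fun _ hK => GPHydro.exists_eLpNorm_momentum_le hΩ hρφ C₀ hK⟩
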